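/- **Proposition 3.1.** Let $d\ge 1$ and fix radial functions $\psi,\varphi\in C_c^\infty(\mathbb R^d)$, $\psi,\varphi\ge 0$, with $\operatorname{supp}\psi\subset\{|\xi|\le1\}$, $\operatorname{supp}\varphi\subset\{\tfrac12\le|\xi|\le2\}$ and $\psi(\xi)+\sum_{k\ge0}\varphi(2^{-k}\xi)=1$ for all $\xi$. For $k\in\mathbb Z$ put $S_k=\psi(2^{-k}D)$ and $\Delta_k=\varphi(2^{-k}D)$ (Fourier multipliers with $D=-i\nabla$). For $s\in\mathbb R$ and $p,q\in[1,\infty]$, let $\dot B^s_{p,q}$ be the space of (complex-valued) tempered distributions $u$ on $\mathbb R^d$ with $\lim_{k\to-\infty}\|S_ku\|_{L^\infty}=0$ and $$\|u\|_{\dot B^s_{p,q}}=\big\|\big(2^{ks}\|\Delta_ku\|_{L^p}\big)_{k\in\mathbb Z}\big\|_{\ell^q}<\infty .$$ For $0<T\le\infty$ (with $[0,T]$ read as $[0,\infty)$ if $T=\infty$), $L^r([0,T];\dot B^s_{p,q})$ is the space of strongly measurable functions $f$ from $[0,T]$ to $\dot B^s_{p,q}$ with $\|f\|_{L^r([0,T];\dot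 B^s_{p,q})}=\big\|\,\|f(t)\|_{\dot B^s_{p,q}}\big\|_{L^r([0,T])}<\infty$. Let $\sigma\in\mathbb R$, $1<r\le m<\infty$, $p\in[1,\infty]$ and $1\le q\le m$. There is a constant $C$, depending only on $d,\psi,\varphi,\sigma,r,m,p,q$ (in particular not on $T$), such that the following holds for all $0<T\le\infty$ and all $f\in L^r([0,T];\dot B^{\sigma+\frac2r}_{p,q})$. Consider the solution of $$\partial_tw-\Delta w=f,\qquad w|_{t=0}=0,$$ that is, the function $$w(t)=\int_0^te^{(t-\tau)\Delta}f(\tau)\,d\tau ,\qquad t\in[0,T],$$ where the integral converges absolutely in the weak sense of tempered distributions (after pairing with each Schwartz function). 1. If $\sigma+\frac2r<\frac dp$, or $\sigma+\frac2r=\frac dp$ and $q=1$ (the range in which $\dot B^{\sigma+\frac2r}_{p,q}$ is a Banach space), then this solution exists, and $\lim_{k\to-\infty}\|S_kw(t)\|_{L^\infty}=0$ for all $t\in[0,T]$. 2. For every $\sigma\in\mathbb R$: if the solution $w$ exists and $\lim_{k\to-\infty}\|S_kw(t)\|_{L^\infty}=0$ for almost every $t\in[0,T]$, then $w\in L^m([0,T];\dot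 B^{\sigma+2+\frac2m}_{p,q})$ and $$\|w\|_{L^m([0,T];\dot B^{\sigma+2+\frac2m}_{p,q})}\le C\,\|f\|_{L^r([0,T];\dot B^{\sigma+\frac2r}_{p,q})} .$$ -/

import Mathlib

open MeasureTheory Filter Topology
open scoped ENNReal NNReal SchwartzMap ContDiff

noncomputable section

namespace HeatBesov

/-- A Littlewood-Paley pair on `ℝ^d`: radial nonnegative functions `ψ, φ ∈ C_c^∞` with
`supp ψ ⊆ {|ξ| ≤ 1}`, `supp φ ⊆ {1/2 ≤ |ξ| ≤ 2}` and `ψ(ξ) + ∑_{k ≥ 0} φ(2^{-k} ξ) = 1`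
for all `ξ`. -/
structure LittlewoodPaley (d : ℕ) where
  ψ : EuclideanSpace ℝ (Fin d) → ℝ
  φ : EuclideanSpace ℝ (Fin d) → ℝ
  contDiff_ψ : ContDiff ℝ ∞ ψ
  contDiff_φ : ContDiff ℝ ∞ φ
  nonneg_ψ : ∀ ξ, 0 ≤ ψ ξ
  nonneg_φ : ∀ ξ, 0 ≤ φ ξ
  radial_ψ : ∀ ξ η, ‖ξ‖ = ‖η‖ → ψ ξ = ψ η
  radial_φ : ∀ ξ η, ‖ξ‖ = ‖η‖ → φ ξ = φ η
  support_ψ : ∀ ξ, ψ ξ ≠ 0 → ‖ξ‖ ≤ 1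
  support_φ : ∀ ξ, φ ξ ≠ 0 → 1 / 2 ≤ ‖ξ‖ ∧ ‖ξ‖ ≤ 2
  partition : ∀ ξ, HasSum (fun k : ℕ => φ ((2 : ℝ) ^ (-(k : ℤ)) • ξ)) (1 - ψ ξ)

/-- The Fourier multiplier `m(D)` on tempered distributions, `(m(D) f)^(ξ) = m(ξ) f^(ξ)`, for the
convention `f^(ξ) = ∫ e^{-i ξ·x} f(x) dx`. Mathlib's Fourier transform has the kernel
`e^{-2π i ξ·x}`, so its symbol is `ξ ↦ m(2πξ)`. -/
def multiplier {d : ℕ} (m : EuclideanSpace ℝ (Fin d) → ℝ) :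
    𝓢'(EuclideanSpace ℝ (Fin d), ℂ) →L[ℂ] 𝓢'(EuclideanSpace ℝ (Fin d), ℂ) :=
  TemperedDistribution.fourierMultiplierCLM ℂ (fun ξ => ((m ((2 * Real.pi) • ξ) : ℝ) : ℂ))

/-- The low-frequency cut-off `S_k = ψ(2^{-k} D)`. -/
def LittlewoodPaley.S {d : ℕ} (L : LittlewoodPaley d) (k : ℤ) :
    𝓢'(EuclideanSpace ℝ (Fin d), ℂ) →L[ℂ] 𝓢'(EuclideanSpace ℝ (Fin d), ℂ) :=
  multiplier (fun ξ => L.ψ ((2 : ℝ) ^ (-k) • ξ))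

/-- The dyadic block `Δ_k = φ(2^{-k} D)`. -/
def LittlewoodPaley.block {d : ℕ} (L : LittlewoodPaley d) (k : ℤ) :
    𝓢'(EuclideanSpace ℝ (Fin d), ℂ) →L[ℂ] 𝓢'(EuclideanSpace ℝ (Fin d), ℂ) :=
  multiplier (fun ξ => L.φ ((2 : ℝ) ^ (-k) • ξ))

/-- The embedding of `L^p(ℝ^d)` in the tempered distributions. -/
abbrev ofLp {d : ℕ} (p : ℝ≥0∞) [Fact (1 ≤ p)] :
    Lp ℂ p (volume : Measure (EuclideanSpace ℝ (Fin d))) →L[ℂ]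
      𝓢'(EuclideanSpace ℝ (Fin d), ℂ) :=
  Lp.toTemperedDistributionCLM ℂ volume p

theorem ofLp_injective {d : ℕ} (p : ℝ≥0∞) [Fact (1 ≤ p)] :
    Function.Injective (ofLp (d := d) p) :=
  LinearMap.ker_eq_bot.mp (Lp.ker_toTemperedDistributionCLM_eq_bot (F := ℂ) (p := p)
    (μ := (volume : Measure (EuclideanSpace ℝ (Fin d)))))

/-- `‖S_k f‖_{L^∞} → 0` as `k → -∞` (with `S_k f ∈ L^∞` for `k` near `-∞`). -/
def LowFreqVanish {d : ℕ} (L : LittlewoodPaley d)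
    (f : 𝓢'(EuclideanSpace ℝ (Fin d), ℂ)) : Prop :=
  ∃ g : ℤ → Lp ℂ ⊤ (volume : Measure (EuclideanSpace ℝ (Fin d))),
    (∀ᶠ k in atBot, ofLp ⊤ (g k) = L.S k f) ∧ Tendsto (fun k => ‖g k‖) atBot (𝓝 0)

/-- The tempered distributions `f` with `‖S_k f‖_{L^∞} → 0` as `k → -∞` and
`(2^{ks} Δ_k f)_{k ∈ ℤ} ∈ ℓ^q(ℤ; L^p(ℝ^d))`. -/
def besovSubmodule {d : ℕ} (L : LittlewoodPaley d) (s : ℝ) (p q : ℝ≥0∞)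
    [Fact (1 ≤ p)] [Fact (1 ≤ q)] : Submodule ℂ 𝓢'(EuclideanSpace ℝ (Fin d), ℂ) where
  carrier := {f | LowFreqVanish L f ∧
    ∃ a : lp (fun _ : ℤ => Lp ℂ p (volume : Measure (EuclideanSpace ℝ (Fin d)))) q,
      ∀ k, ofLp p (a k) = (((2 : ℝ) ^ ((k : ℝ) * s) : ℝ) : ℂ) • L.block k f}
  add_mem' := by
    rintro f₁ f₂ ⟨⟨g₁, h₁, t₁⟩, a₁, ha₁⟩ ⟨⟨g₂, h₂, t₂⟩, a₂, ha₂⟩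
    refine ⟨⟨fun k => g₁ k + g₂ k, ?_, ?_⟩, a₁ + a₂, fun k => ?_⟩
    · filter_upwards [h₁, h₂] with k e₁ e₂
      rw [map_add, map_add, e₁, e₂]
    · refine squeeze_zero (fun k => norm_nonneg _) (fun k => norm_add_le _ _) ?_
      simpa using t₁.add t₂
    · rw [lp.coeFn_add, Pi.add_apply, map_add, map_add, smul_add, ha₁, ha₂]
  zero_mem' := by
    refine ⟨⟨fun _ => 0, Eventually.of_forall fun k => ?_, by simp⟩, 0, fun k => ?_⟩
    · rw [map_zero, map_zero]
    · rw [lp.coeFn_zero, Pi.zero_apply, map_zero, map_zero]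
      exact (smul_zero (A := 𝓢'(EuclideanSpace ℝ (Fin d), ℂ))
        (((2 : ℝ) ^ ((k : ℝ) * s) : ℝ) : ℂ)).symm
  smul_mem' := by
    rintro c f ⟨⟨g, h, t⟩, a, ha⟩
    refine ⟨⟨fun k => c • g k, ?_, ?_⟩, c • a, fun k => ?_⟩
    · filter_upwards [h] with k e
      rw [map_smul, map_smul, e]
    · simpa [norm_smul] using t.const_mul ‖c‖
    · rw [lp.coeFn_smul, Pi.smul_apply, map_smul, map_smul, ha, smul_comm]

/-- The homogeneous Besov space `Ḃ^s_{p,q}(ℝ^d)`. It is a type of its own, so that its topology is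
that of its norm and not the one induced by the tempered distributions. -/
def Besov {d : ℕ} (L : LittlewoodPaley d) (s : ℝ) (p q : ℝ≥0∞)
    [Fact (1 ≤ p)] [Fact (1 ≤ q)] : Type :=
  ↥(besovSubmodule L s p q)

namespace Besov

instance {d : ℕ} (L : LittlewoodPaley d) (s : ℝ) (p q : ℝ≥0∞)
    [Fact (1 ≤ p)] [Fact (1 ≤ q)] : AddCommGroup (Besov L s p q) :=
  inferInstanceAs (AddCommGroup ↥(besovSubmodule L s p q))

instance {d : ℕ} (L : LittlewoodPaley d) (s : ℝ) (p q : ℝ≥0∞)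
    [Fact (1 ≤ p)] [Fact (1 ≤ q)] : Module ℂ (Besov L s p q) :=
  inferInstanceAs (Module ℂ ↥(besovSubmodule L s p q))

/-- The underlying tempered distribution. -/
def toDist {d : ℕ} {L : LittlewoodPaley d} {s : ℝ} {p q : ℝ≥0∞}
    [Fact (1 ≤ p)] [Fact (1 ≤ q)] (f : Besov L s p q) : 𝓢'(EuclideanSpace ℝ (Fin d), ℂ) :=
  f.1

/-- The sequence `(2^{ks} Δ_k f)_{k ∈ ℤ} ∈ ℓ^q(ℤ; L^p)`. -/
def coeff {d : ℕ} {L : LittlewoodPaley d} {s : ℝ} {p q : ℝ≥0∞}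
    [Fact (1 ≤ p)] [Fact (1 ≤ q)] (f : Besov L s p q) :
    lp (fun _ : ℤ => Lp ℂ p (volume : Measure (EuclideanSpace ℝ (Fin d)))) q :=
  f.2.2.choose

theorem ofLp_coeff {d : ℕ} {L : LittlewoodPaley d} {s : ℝ} {p q : ℝ≥0∞}
    [Fact (1 ≤ p)] [Fact (1 ≤ q)] (f : Besov L s p q) (k : ℤ) :
    ofLp p (coeff f k) = (((2 : ℝ) ^ ((k : ℝ) * s) : ℝ) : ℂ) • L.block k f.toDist :=
  f.2.2.choose_spec k

/-- `coeff` as an additive map. -/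
def coeffHom {d : ℕ} (L : LittlewoodPaley d) (s : ℝ) (p q : ℝ≥0∞)
    [Fact (1 ≤ p)] [Fact (1 ≤ q)] : Besov L s p q →+
      lp (fun _ : ℤ => Lp ℂ p (volume : Measure (EuclideanSpace ℝ (Fin d)))) q :=
  AddMonoidHom.mk' coeff (by
    intro f g
    ext1
    funext k
    apply ofLp_injective p
    have h : (f + g).toDist = f.toDist + g.toDist := rfl
    rw [lp.coeFn_add, Pi.add_apply, map_add, ofLp_coeff, ofLp_coeff, ofLp_coeff, h, map_add,
      smul_add])

/-- The norm `‖f‖ = ‖(2^{ks} Δ_k f)_{k ∈ ℤ}‖_{ℓ^q(ℤ; L^p)}`. -/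
instance {d : ℕ} (L : LittlewoodPaley d) (s : ℝ) (p q : ℝ≥0∞)
    [Fact (1 ≤ p)] [Fact (1 ≤ q)] : SeminormedAddCommGroup (Besov L s p q) :=
  SeminormedAddCommGroup.induced (Besov L s p q) _ (coeffHom L s p q)

/-- For `q < ∞`: `‖f‖ = (∑_k 2^{ksq} ‖Δ_k f‖_{L^p}^q)^{1/q}`. -/
theorem norm_eq {d : ℕ} {L : LittlewoodPaley d} {s : ℝ} {p q : ℝ≥0∞}
    [Fact (1 ≤ p)] [Fact (1 ≤ q)] (hq : q ≠ ⊤) (f : Besov L s p q)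
    (b : ℤ → Lp ℂ p (volume : Measure (EuclideanSpace ℝ (Fin d))))
    (hb : ∀ k, ofLp p (b k) = L.block k f.toDist) :
    ‖f‖ = (∑' k : ℤ, (2 : ℝ) ^ ((k : ℝ) * s * q.toReal) * ‖b k‖ ^ q.toReal) ^
      (1 / q.toReal) := by
  have hq1 : 1 ≤ q := Fact.out
  have hq0 : 0 < q.toReal := ENNReal.toReal_pos (by positivity) hq
  have h : ‖f‖ = ‖coeff f‖ := rfl
  rw [h, lp.norm_eq_tsum_rpow hq0]
  congr 1
  refine tsum_congr fun k => ?_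
  have hk : coeff f k = (((2 : ℝ) ^ ((k : ℝ) * s) : ℝ) : ℂ) • b k := by
    apply ofLp_injective p
    rw [ofLp_coeff, map_smul, hb]
  have h2 : (0 : ℝ) ≤ 2 ^ ((k : ℝ) * s) := by positivity
  rw [hk, norm_smul, Complex.norm_real, Real.norm_of_nonneg h2,
    Real.mul_rpow h2 (norm_nonneg _), ← Real.rpow_mul (by norm_num)]

end Besov

/-- The time interval `[0,T]` for `T < ∞`, and `[0,∞)` for `T = ∞`. -/
def timeInterval (T : ℝ≥0∞) : Set ℝ :=
  {t | 0 ≤ t ∧ ENNReal.ofReal t ≤ T}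

/-- The heat semigroup `e^{tΔ}` on tempered distributions, for `t ≥ 0`. -/
def heat {d : ℕ} (t : ℝ) :
    𝓢'(EuclideanSpace ℝ (Fin d), ℂ) →L[ℂ] 𝓢'(EuclideanSpace ℝ (Fin d), ℂ) :=
  multiplier (fun ξ => Real.exp (-t * ‖ξ‖ ^ 2))

/-- `w` is the solution of `∂_t w - Δ w = f`, `w(0) = 0`, on the time interval given by `T`:
`w(t) = ∫_0^t e^{(t-τ)Δ} f(τ) dτ`, as an (absolutely convergent) weak integral of tempered
distributions. -/
def IsHeatSolution {d : ℕ} (T : ℝ≥0∞) (f w : ℝ → 𝓢'(EuclideanSpace ℝ (Fin d), ℂ)) : Prop :=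
  ∀ t ∈ timeInterval T, ∀ χ : 𝓢(EuclideanSpace ℝ (Fin d), ℂ),
    IntervalIntegrable (fun τ => heat (t - τ) (f τ) χ) volume 0 t ∧
      w t χ = ∫ τ in (0 : ℝ)..t, heat (t - τ) (f τ) χ

end HeatBesov

end

noncomputable section
namespace HeatBesov

/-! On a dyadic block the heat semigroup decays exponentially: `‖Δ_k e^{tΔ} g‖_p ≤ K e^{-c 4^k t}
‖Δ_k g‖_p`. Hence the Besov norm of `w(t)` is controlled by the scalar convolutions of `a_k =
2^{k(σ+2/r)} ‖Δ_k f‖_p` with `e^{-c 4^k t}`, carrying the weights `4^{k(1-1/r+1/m)}`. The maximal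
estimate thus reduces to the boundedness `L^r(ℓ^q) → L^m(ℓ^q)` of this family on the half-line
(`exists_lintegral_lq_conv_le`); extending the source by zero makes the constant independent of `T`.

If `q ≥ r`, Minkowski's inequality at both ends reduces it to a single frequency. If `q < r`,
Jensen's inequality for the exponential kernel reduces it to `ℓ¹` with the exponents `R = r/q > 1`
and `M = m/q`. This `ℓ¹` case, `exists_lintegral_tsum_conv_le`, is the heart of the matter. Let
`g_k` be the weighted convolutions, `G_k = ∑_{j ≤ k} g_j` and `G` the full (finite) sum. Then `G^M ≤
M ∑_k g_k G_k^{M-1}` (`sum_rpow_le_sum_mul`). Multiplying the equation for `G_k` by `G_k^{M-1}` and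
integrating in time gains a factor `4^{-k}` on `∫ g_k G_k^{M-1}` (`lintegral_rpow_mul_conv_le`).
Part of the power `G_k^{M-1}` is estimated pointwise in time by Hölder's inequality, the rest by
`G`; the sum over `k` becomes geometric, and what is left is absorbed into `∫ G^M`.

Kernel bounds come from Young's inequality, since the `L^s` norm of a Fourier transform is a
continuous seminorm on the Schwartz space, and from dilation. The condition on `S_k` as `k → -∞`
makes a distribution equal to the sum of its blocks, so the Besov space embeds into `ℓ^q(L^p)`,
where measurability and norms are computed.

For existence, `e^{tΔ} f` is split at frequency one. Its low part is an absolutely convergent series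
in `L^∞`, by Bernstein's inequality and the hypothesis on `σ + 2/r`. Its high part is `|D|^{2N}`
applied to an absolutely convergent series in `L^p`. Both are Bochner integrable in time, and the
tails of the low series give the decay of `S_k w(t)`. -/

/-! ### Energy inequality for sums of damped scalar equations -/

theorem absolutelyContinuousOnInterval_comp_of_lipschitz {f φ : ℝ → ℝ} {a b : ℝ}
    (hf : AbsolutelyContinuousOnInterval f a b) {s : Set ℝ} {K : ℝ≥0} (hφ : LipschitzOnWith K φ s)
    (hs : ∀ x ∈ Set.uIcc a b, f x ∈ s) :
    AbsolutelyContinuousOnInterval (fun x => φ (f x)) a b := by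
  rw [absolutelyContinuousOnInterval_iff] at hf ⊢
  intro ε hε
  obtain ⟨δ, hδ, h⟩ := hf (ε / (K + 1)) (by positivity)
  refine ⟨δ, hδ, fun E hE hlt => ?_⟩
  have h1 := h E hE hlt
  have hE' := hE
  simp only [AbsolutelyContinuousOnInterval.disjWithin, Set.mem_ofPred_eq] at hE'
  have hK : (0 : ℝ) ≤ K := K.2
  calc ∑ i ∈ Finset.range E.1, dist (φ (f (E.2 i).1)) (φ (f (E.2 i).2))
      ≤ ∑ i ∈ Finset.range E.1, K * dist (f (E.2 i).1) (f (E.2 i).2) := by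
        refine Finset.sum_le_sum fun i hi => hφ.dist_le_mul _ (hs _ ?_) _ (hs _ ?_)
        · exact (hE'.1 i (by simpa using hi)).1
        · exact (hE'.1 i (by simpa using hi)).2
    _ = K * ∑ i ∈ Finset.range E.1, dist (f (E.2 i).1) (f (E.2 i).2) := by
        rw [Finset.mul_sum]
    _ ≤ K * (ε / (K + 1)) := by gcongr
    _ < ε := by
        rw [mul_div_assoc', div_lt_iff₀ (by positivity)]
        nlinarith

/-- The solution of `y' + c y = x`, `y(0) = 0`. -/
def damped (c : ℝ) (x : ℝ → ℝ) (t : ℝ) : ℝ := ∫ τ in (0 : ℝ)..t, Real.exp (-c * (t - τ)) * x τ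

theorem damped_eq (c : ℝ) (x : ℝ → ℝ) (t : ℝ) :
    damped c x t = Real.exp (-c * t) * ∫ τ in (0 : ℝ)..t, Real.exp (c * τ) * x τ := by
  rw [damped, ← intervalIntegral.integral_const_mul]
  congr 1
  ext τ
  rw [← mul_assoc, ← Real.exp_add]
  ring_nf

theorem damped_nonneg {c : ℝ} {x : ℝ → ℝ} (hx : ∀ t, 0 ≤ x t) {t : ℝ} (ht : 0 ≤ t) :
    0 ≤ damped c x t :=
  intervalIntegral.integral_nonneg ht fun τ _ => mul_nonneg (Real.exp_nonneg _) (hx τ)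

theorem intervalIntegrable_exp_mul {x : ℝ → ℝ} {b : ℝ} (hx : IntervalIntegrable x volume 0 b)
    (c : ℝ) : IntervalIntegrable (fun τ => Real.exp (c * τ) * x τ) volume 0 b :=
  hx.continuousOn_mul (by fun_prop)

theorem absolutelyContinuous_damped {x : ℝ → ℝ} {b : ℝ} (hx : IntervalIntegrable x volume 0 b)
    (c : ℝ) : AbsolutelyContinuousOnInterval (damped c x) 0 b := by
  have h1 := (intervalIntegrable_exp_mul hx c).absolutelyContinuousOnInterval_intervalIntegral
    (c := 0) (by simp)
  have h2 : AbsolutelyContinuousOnInterval (fun t => Real.exp (-c * t)) 0 b :=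
    ContDiffOn.absolutelyContinuousOnInterval (by fun_prop)
  have : damped c x = fun t => Real.exp (-c * t) * ∫ τ in (0 : ℝ)..t, Real.exp (c * τ) * x τ :=
    funext (damped_eq c x)
  rw [this]
  exact h2.fun_mul h1

theorem ae_hasDerivAt_damped {x : ℝ → ℝ} {b : ℝ} (hx : IntervalIntegrable x volume 0 b) (c : ℝ) :
    ∀ᵐ t, t ∈ Set.uIcc 0 b → HasDerivAt (damped c x) (x t - c * damped c x t) t := by
  filter_upwards [(intervalIntegrable_exp_mul hx c).ae_hasDerivAt_integral] with t ht htb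
  have h1 := ht htb 0 (by simp)
  have h2 : HasDerivAt (fun t => Real.exp (-c * t)) (Real.exp (-c * t) * (-c)) t := by
    simpa using ((hasDerivAt_id t).const_mul (-c)).exp
  have h3 := h2.mul h1
  have : damped c x = fun t => Real.exp (-c * t) * ∫ τ in (0 : ℝ)..t, Real.exp (c * τ) * x τ :=
    funext (damped_eq c x)
  rw [this]
  refine h3.congr_deriv ?_
  have : Real.exp (-c * t) * (Real.exp (c * t) * x t) = x t := by
    rw [← mul_assoc, ← Real.exp_add]; simp
  rw [this]; ring

/-- For the sum `G` of the solutions, `(G^M)' = M G^{M-1} (∑ x_j - ∑ c_j y_j)` almost everywhere.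
Integrating, the difference of the two sides is `(G(b)^M - G(0)^M) / M`, which is nonnegative
because `G(0) = 0`. The sources are only integrable, so the fundamental theorem of calculus is used
for absolutely continuous functions. -/
theorem integral_rpow_mul_damped_le {ι : Type*} (J : Finset ι) (c : ι → ℝ) (x : ι → ℝ → ℝ) {b : ℝ}
    (hb : 0 ≤ b) (hx : ∀ j ∈ J, IntervalIntegrable (x j) volume 0 b) (hx0 : ∀ j t, 0 ≤ x j t)
    {M : ℝ} (hM : 1 ≤ M) :
    ∫ t in (0 : ℝ)..b, (∑ j ∈ J, damped (c j) (x j) t) ^ (M - 1) *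
        ∑ j ∈ J, c j * damped (c j) (x j) t ≤
      ∫ t in (0 : ℝ)..b, (∑ j ∈ J, damped (c j) (x j) t) ^ (M - 1) * ∑ j ∈ J, x j t := by
  set G : ℝ → ℝ := fun t => ∑ j ∈ J, damped (c j) (x j) t with hG
  have hGac : AbsolutelyContinuousOnInterval G 0 b := by
    rw [hG]
    induction J using Finset.cons_induction with
    | empty => exact ContDiffOn.absolutelyContinuousOnInterval (by simpa using contDiffOn_const)
    | cons j J hj ih =>
      simp only [Finset.sum_cons]
      exact (absolutelyContinuous_damped (hx j (by simp)) _).add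
        (ih (fun i hi => hx i (by simp [hi])) rfl)
  have hG0 : ∀ t, 0 ≤ t → 0 ≤ G t := fun t ht =>
    Finset.sum_nonneg fun j _ => damped_nonneg (hx0 j) ht
  obtain ⟨B, hB⟩ := hGac.exists_bound
  -- As `M ≥ 1`, the real power is `C¹` on the whole line, so it is Lipschitz on the bounded range
  -- of `G` and preserves absolute continuity.
  have hlip : ∃ K : ℝ≥0, LipschitzOnWith K (fun y : ℝ => y ^ M) (Set.Icc (-B) B) := by
    have : ContDiffOn ℝ 1 (fun y : ℝ => y ^ M) (Set.Icc (-B) B) := by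
      have := Real.contDiff_rpow_const_of_le (p := M) (n := 1) (by exact_mod_cast hM)
      exact this.contDiffOn
    exact this.exists_lipschitzOnWith (by decide) (convex_Icc _ _) isCompact_Icc
  obtain ⟨K, hK⟩ := hlip
  have hGM := absolutelyContinuousOnInterval_comp_of_lipschitz hGac hK (fun t ht => by
    have := hB t ht
    rw [Real.norm_eq_abs, abs_le] at this
    exact this)
  have hder : ∀ᵐ t, t ∈ Set.uIcc 0 b → HasDerivAt G
      (∑ j ∈ J, x j t - ∑ j ∈ J, c j * damped (c j) (x j) t) t := by
    have : ∀ᵐ t, ∀ j ∈ J, t ∈ Set.uIcc 0 b →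
        HasDerivAt (damped (c j) (x j)) (x j t - c j * damped (c j) (x j) t) t := by
      exact (Finset.eventually_all J).2 fun j hj => ae_hasDerivAt_damped (hx j hj) (c j)
    filter_upwards [this] with t ht htb
    rw [← Finset.sum_sub_distrib]
    exact HasDerivAt.fun_sum fun j hj => ht j hj htb
  have hFTC := hGM.integral_deriv_eq_sub
  have hGc := hGac.continuousOn
  have hpc : ContinuousOn (fun t => G t ^ (M - 1)) (Set.uIcc 0 b) :=
    hGc.rpow_const fun t _ => Or.inr (by linarith)
  have i1 : IntervalIntegrable (fun t => G t ^ (M - 1) * ∑ j ∈ J, x j t) volume 0 b :=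
    IntervalIntegrable.continuousOn_mul (IntervalIntegrable.sum _ hx |>.congr (by
      intro t _; simp)) hpc
  have i2 : IntervalIntegrable (fun t => G t ^ (M - 1) * ∑ j ∈ J, c j * damped (c j) (x j) t)
      volume 0 b := by
    refine ContinuousOn.intervalIntegrable (hpc.mul (continuousOn_finsetSum _ fun j hj =>
      continuousOn_const.mul (absolutelyContinuous_damped (hx j hj) _).continuousOn))
  have e : ∫ t in (0 : ℝ)..b, deriv (fun t => G t ^ M) t =
      M * (∫ t in (0 : ℝ)..b, G t ^ (M - 1) * ∑ j ∈ J, x j t) -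
      M * ∫ t in (0 : ℝ)..b, G t ^ (M - 1) * ∑ j ∈ J, c j * damped (c j) (x j) t := by
    rw [← mul_sub, ← intervalIntegral.integral_sub i1 i2, ← intervalIntegral.integral_const_mul]
    refine intervalIntegral.integral_congr_ae ?_
    filter_upwards [hder] with t ht htb
    have := ((ht (Set.uIoc_subset_uIcc htb)).rpow_const (p := M) (Or.inr hM)).deriv
    rw [this]
    ring
  rw [e] at hFTC
  have h0 : 0 ≤ G b ^ M - G 0 ^ M := by
    have : G 0 = 0 := by simp [hG, damped]
    rw [this, Real.zero_rpow (by linarith)]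
    simpa using Real.rpow_nonneg (hG0 b hb) M
  have hM0 : 0 < M := by linarith
  rw [← hFTC, ← mul_sub] at h0
  have := nonneg_of_mul_nonneg_right h0 hM0
  linarith

/-! ### Dyadic weights and geometric sums -/

/-- The dyadic weight `4^{k s}`. -/
def wt (s : ℝ) (k : ℤ) : ℝ≥0∞ := (4 : ℝ≥0∞) ^ ((k : ℝ) * s)

theorem wt_ne_top (s : ℝ) (k : ℤ) : wt s k ≠ ⊤ := by
  simp [wt, ENNReal.rpow_eq_top_iff]

theorem wt_mul (s s' : ℝ) (k : ℤ) : wt s k * wt s' k = wt (s + s') k := by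
  rw [wt, wt, wt, ← ENNReal.rpow_add _ _ (by norm_num) (by norm_num)]
  ring_nf

theorem wt_rpow (s a : ℝ) (k : ℤ) : wt s k ^ a = wt (s * a) k := by
  rw [wt, wt, ← ENNReal.rpow_mul]
  ring_nf

theorem wt_zero (k : ℤ) : wt 0 k = 1 := by simp [wt]

theorem wt_mul_neg (s : ℝ) (k : ℤ) : wt s k * wt (-s) k = 1 := by
  rw [wt_mul, add_neg_cancel, wt_zero]

theorem wt_eq_ofReal (s : ℝ) (k : ℤ) : wt s k = ENNReal.ofReal ((4 : ℝ) ^ ((k : ℝ) * s)) := by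
  rw [wt, ← ENNReal.ofReal_rpow_of_pos (by norm_num)]
  norm_num

theorem wt_one (k : ℤ) : wt 1 k = ENNReal.ofReal ((4 : ℝ) ^ k) := by
  rw [wt_eq_ofReal, mul_one, Real.rpow_intCast]

/-- The sum of the geometric series `∑ 4^{-n s}`. -/
def geo (s : ℝ) : ℝ≥0∞ := ∑' n : ℕ, wt (-s) n

theorem geo_ne_top {s : ℝ} (hs : 0 < s) : geo s ≠ ⊤ := by
  have h : ∀ n : ℕ, wt (-s) n = ((4 : ℝ≥0∞) ^ (-s)) ^ n := fun n => by
    rw [wt, ← ENNReal.rpow_natCast, ← ENNReal.rpow_mul]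
    simp [mul_comm]
  have hlt : (4 : ℝ≥0∞) ^ (-s) < 1 :=
    ENNReal.rpow_lt_one_of_one_lt_of_neg (by norm_num) (by linarith)
  simp only [geo, h, ENNReal.tsum_geometric]
  exact ENNReal.inv_ne_top.2 (tsub_pos_of_lt hlt).ne'

/-- Counting down from `k`, with `n = k - j`, turns the sum into part of a geometric series. No sign
of `s` is needed, as `geo` takes values in `[0,∞]`. -/
theorem sum_wt_le (J : Finset ℤ) {s : ℝ} (k : ℤ) :
    ∑ j ∈ J with j ≤ k, wt s j ≤ wt s k * geo s := by
  have h : ∀ j ∈ J.filter (· ≤ k), wt s j = wt s k * wt (-s) ((k - j).toNat : ℕ) := by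
    intro j hj
    have hjk : ((k - j).toNat : ℤ) = k - j :=
      Int.toNat_of_nonneg (by have := (Finset.mem_filter.1 hj).2; omega)
    rw [hjk, wt, wt, wt, ← ENNReal.rpow_add _ _ (by norm_num) (by norm_num)]
    push_cast
    ring_nf
  rw [Finset.sum_congr rfl h, ← Finset.mul_sum]
  gcongr
  have hinj : Set.InjOn (fun j : ℤ => (k - j).toNat) (J.filter (· ≤ k)) := by
    intro i hi j hj hij
    simp at hi hj hij
    omega
  rw [← Finset.sum_image (f := fun n : ℕ => wt (-s) n) hinj]
  exact ENNReal.sum_le_tsum _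

theorem sum_wt_neg_le (J : Finset ℤ) {s : ℝ} (j : ℤ) :
    ∑ k ∈ J with j ≤ k, wt (-s) k ≤ wt (-s) j * geo s := by
  have h : ∀ k ∈ J.filter (j ≤ ·), wt (-s) k = wt (-s) j * wt (-s) ((k - j).toNat : ℕ) := by
    intro k hk
    have hjk : ((k - j).toNat : ℤ) = k - j :=
      Int.toNat_of_nonneg (by have := (Finset.mem_filter.1 hk).2; omega)
    rw [hjk, wt, wt, wt, ← ENNReal.rpow_add _ _ (by norm_num) (by norm_num)]
    push_cast
    ring_nf
  rw [Finset.sum_congr rfl h, ← Finset.mul_sum]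
  gcongr
  have hinj : Set.InjOn (fun k : ℤ => (k - j).toNat) (J.filter (j ≤ ·)) := by
    intro i hi j hj hij
    simp at hi hj hij
    omega
  rw [← Finset.sum_image (f := fun n : ℕ => wt (-s) n) hinj]
  exact ENNReal.sum_le_tsum _

/-! ### Powers of sums by summation over partial sums -/

/-- Convexity of the power at `y = x + g`: this is Bernoulli's inequality for `(x / y)^M = (1 - g /
y)^M`, multiplied by `y^M`. -/
theorem add_rpow_le_rpow_add_mul {M : ℝ} (hM : 1 ≤ M) (x g : ℝ≥0∞) :
    (x + g) ^ M ≤ x ^ M + ENNReal.ofReal M * g * (x + g) ^ (M - 1) := by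
  have hM0 : 0 < M := by linarith
  rcases eq_or_ne x ⊤ with rfl | hx
  · simp [ENNReal.top_rpow_of_pos hM0]
  rcases eq_or_ne g ⊤ with rfl | hg
  · have h1 : (⊤ : ℝ≥0∞) ^ (M - 1) ≠ 0 := by
      simp [ENNReal.rpow_eq_zero_iff]; linarith
    have h2 : ENNReal.ofReal M * ⊤ * (⊤ : ℝ≥0∞) ^ (M - 1) = ⊤ := by
      rw [ENNReal.mul_top (by simpa using hM0), ENNReal.top_mul h1]
    simp [h2]
  lift x to ℝ≥0 using hx
  lift g to ℝ≥0 using hg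
  rcases eq_or_ne (x + g) 0 with h0 | h0
  · have : (x : ℝ≥0∞) + g = 0 := by exact_mod_cast h0
    rw [this, ENNReal.zero_rpow_of_pos hM0]
    exact zero_le
  have hreal : ((x : ℝ) + g) ^ M ≤ (x : ℝ) ^ M + M * g * ((x : ℝ) + g) ^ (M - 1) := by
    set y : ℝ := x + g with hy
    have hy0 : 0 < y := by
      have : 0 < x + g := pos_iff_ne_zero.2 h0
      exact_mod_cast this
    have hB := one_add_mul_self_le_rpow_one_add (s := -(g / y)) (p := M) (by
      rw [neg_le_neg_iff, div_le_one hy0]; have := x.2; simp [hy]) hM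
    have e1 : 1 + -((g : ℝ) / y) = x / y := by field_simp; rw [hy]; ring
    rw [e1, Real.div_rpow x.coe_nonneg hy0.le] at hB
    have e2 : y ^ (M - 1) = y ^ M / y := by rw [Real.rpow_sub_one hy0.ne']
    rw [e2]
    have hyM : 0 < y ^ M := Real.rpow_pos_of_pos hy0 M
    rw [le_div_iff₀ hyM] at hB
    have : (1 + M * -((g : ℝ) / y)) * y ^ M = y ^ M - M * g * (y ^ M / y) := by field_simp; ring
    rw [this] at hB
    linarith
  have := ENNReal.ofReal_le_ofReal hreal
  rw [ENNReal.ofReal_add (by positivity) (by positivity), ENNReal.ofReal_mul (by positivity),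
    ENNReal.ofReal_mul (by positivity),
    ← ENNReal.ofReal_rpow_of_nonneg (by positivity) (by positivity),
    ← ENNReal.ofReal_rpow_of_nonneg (by positivity) (by positivity),
    ← ENNReal.ofReal_rpow_of_nonneg (by positivity) (by linarith),
    ENNReal.ofReal_add (by positivity) (by positivity)] at this
  simpa using this

/-- The discrete form of `d(G^M) = M G^{M-1} dG`. Indices are added in increasing order, so a new
largest index leaves the earlier partial sums unchanged and costs one application of the convexity
inequality. -/
theorem sum_rpow_le_sum_mul {M : ℝ} (hM : 1 ≤ M) (J : Finset ℤ) (g : ℤ → ℝ≥0∞) :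
    (∑ j ∈ J, g j) ^ M ≤
      ∑ k ∈ J, ENNReal.ofReal M * g k * (∑ j ∈ J with j ≤ k, g j) ^ (M - 1) := by
  induction J using Finset.induction_on_max with
  | empty => simp [ENNReal.zero_rpow_of_pos (by linarith : 0 < M)]
  | insert a s ha ih =>
    have hn : a ∉ s := fun h => lt_irrefl _ (ha a h)
    have e : ∀ k ∈ s, (insert a s).filter (· ≤ k) = s.filter (· ≤ k) := fun k hk => by
      rw [Finset.filter_insert, if_neg (not_le.2 (ha k hk))]
    have e' : (insert a s).filter (· ≤ a) = insert a s := by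
      refine Finset.filter_true_of_mem fun x hx => ?_
      rcases Finset.mem_insert.1 hx with rfl | h
      · exact le_rfl
      · exact (ha x h).le
    have hsum : ∑ k ∈ s, ENNReal.ofReal M * g k *
          (∑ j ∈ insert a s with j ≤ k, g j) ^ (M - 1) =
        ∑ k ∈ s, ENNReal.ofReal M * g k * (∑ j ∈ s with j ≤ k, g j) ^ (M - 1) :=
      Finset.sum_congr rfl fun k hk => by rw [e k hk]
    rw [Finset.sum_insert hn, Finset.sum_insert hn, e', hsum, Finset.sum_insert hn, add_comm (g a)]
    refine (add_rpow_le_rpow_add_mul hM _ _).trans ?_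
    rw [add_comm]
    gcongr

/-! ### Convolution with exponentials for extended nonnegative functions -/

/-- `∫_0^t e^{-c(t-τ)} A(τ) dτ` as a Lebesgue integral. -/
def conv (c : ℝ) (A : ℝ → ℝ≥0∞) (t : ℝ) : ℝ≥0∞ :=
  ∫⁻ τ in Set.Ioc 0 t, ENNReal.ofReal (Real.exp (-c * (t - τ))) * A τ

theorem measurable_conv (c : ℝ) {A : ℝ → ℝ≥0∞} (hA : Measurable A) : Measurable (conv c A) := by
  have : conv c A = fun t => ∫⁻ τ, (Set.indicator {p : ℝ × ℝ | 0 < p.2 ∧ p.2 ≤ p.1}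
      (fun p => ENNReal.ofReal (Real.exp (-c * (p.1 - p.2))) * A p.2) (t, τ)) := by
    ext t
    rw [conv, ← lintegral_indicator measurableSet_Ioc]
    rfl
  rw [this]
  refine Measurable.lintegral_prod_right' (f := Set.indicator {p : ℝ × ℝ | 0 < p.2 ∧ p.2 ≤ p.1}
      (fun p => ENNReal.ofReal (Real.exp (-c * (p.1 - p.2))) * A p.2)) ?_
  refine Measurable.indicator (by fun_prop) ?_
  exact (measurableSet_lt measurable_const measurable_snd).inter
    (measurableSet_le measurable_snd measurable_fst)

theorem conv_const_mul {c t : ℝ} {A : ℝ → ℝ≥0∞} {w : ℝ≥0∞} (hw : w ≠ ⊤) :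
    conv c (fun τ => w * A τ) t = w * conv c A t := by
  rw [conv, conv, ← lintegral_const_mul' _ _ hw]
  congr 1; ext τ; ring

theorem conv_eq_ofReal_damped {c t : ℝ} {x : ℝ → ℝ} (ht : 0 ≤ t) (hx0 : ∀ τ, 0 ≤ x τ)
    (hx : IntervalIntegrable x volume 0 t) :
    conv c (fun τ => ENNReal.ofReal (x τ)) t = ENNReal.ofReal (damped c x t) := by
  have hi : IntervalIntegrable (fun τ => Real.exp (-c * (t - τ)) * x τ) volume 0 t :=
    hx.continuousOn_mul (by fun_prop)
  rw [conv, damped, intervalIntegral.integral_of_le ht,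
    ofReal_integral_eq_lintegral_ofReal ((intervalIntegrable_iff_integrableOn_Ioc_of_le ht).1 hi)
    (ae_of_all _ fun τ => mul_nonneg (Real.exp_nonneg _) (hx0 τ))]
  refine lintegral_congr fun τ => ?_
  rw [ENNReal.ofReal_mul (Real.exp_nonneg _)]

/-- Integrability makes each source finite almost everywhere, so it may be replaced by its real part
`x j`; the statement is then the energy inequality for `damped`. -/
theorem lintegral_rpow_mul_conv_le {ι : Type*} (J : Finset ι) {c : ι → ℝ} (hc : ∀ j, 0 ≤ c j)
    {A : ι → ℝ → ℝ≥0∞} (hA : ∀ j, Measurable (A j)) {b : ℝ} (hb : 0 ≤ b)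
    (hfin : ∀ j ∈ J, ∫⁻ t in Set.Ioc 0 b, A j t ≠ ⊤) {M : ℝ} (hM : 1 ≤ M) :
    ∫⁻ t in Set.Ioc 0 b, (∑ j ∈ J, conv (c j) (A j) t) ^ (M - 1) *
        ∑ j ∈ J, ENNReal.ofReal (c j) * conv (c j) (A j) t ≤
      ∫⁻ t in Set.Ioc 0 b, (∑ j ∈ J, conv (c j) (A j) t) ^ (M - 1) * ∑ j ∈ J, A j t := by
  set x : ι → ℝ → ℝ := fun j t => (A j t).toReal with hxdef
  have hx0 : ∀ j t, 0 ≤ x j t := fun j t => ENNReal.toReal_nonneg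
  have hae : ∀ j ∈ J, ∀ᵐ t ∂(volume.restrict (Set.Ioc 0 b)), A j t = ENNReal.ofReal (x j t) := by
    intro j hj
    filter_upwards [ae_lt_top (hA j) (hfin j hj)] with t ht
    rw [hxdef, ENNReal.ofReal_toReal ht.ne]
  have hint : ∀ j ∈ J, IntervalIntegrable (x j) volume 0 b := by
    intro j hj
    rw [intervalIntegrable_iff_integrableOn_Ioc_of_le hb]
    exact integrable_toReal_of_lintegral_ne_top (hA j).aemeasurable (hfin j hj)
  have hconv : ∀ j ∈ J, ∀ t ∈ Set.Ioc 0 b,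
      conv (c j) (A j) t = ENNReal.ofReal (damped (c j) (x j) t) := by
    intro j hj t ht
    rw [← conv_eq_ofReal_damped ht.1.le (hx0 j) ((hint j hj).mono_set (by
      rw [Set.uIcc_of_le ht.1.le, Set.uIcc_of_le hb]; exact Set.Icc_subset_Icc_right ht.2))]
    refine lintegral_congr_ae ?_
    have := ae_restrict_of_ae_restrict_of_subset (Set.Ioc_subset_Ioc_right ht.2) (hae j hj)
    filter_upwards [this] with τ hτ
    rw [hτ]
  have hd0 : ∀ j, ∀ t ∈ Set.Ioc 0 b, 0 ≤ damped (c j) (x j) t := fun j t ht =>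
    damped_nonneg (hx0 j) ht.1.le
  set G : ℝ → ℝ := fun t => ∑ j ∈ J, damped (c j) (x j) t with hG
  have hG0 : ∀ t ∈ Set.Ioc 0 b, 0 ≤ G t := fun t ht => Finset.sum_nonneg fun j _ => hd0 j t ht
  have hGe : ∀ t ∈ Set.Ioc 0 b, ∑ j ∈ J, conv (c j) (A j) t = ENNReal.ofReal (G t) := by
    intro t ht
    rw [hG, ENNReal.ofReal_sum_of_nonneg fun j _ => hd0 j t ht]
    exact Finset.sum_congr rfl fun j hj => hconv j hj t ht
  have hdc : ∀ j ∈ J, ContinuousOn (damped (c j) (x j)) (Set.uIcc 0 b) := fun j hj =>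
    (absolutelyContinuous_damped (hint j hj) _).continuousOn
  have hGc : ContinuousOn G (Set.uIcc 0 b) := continuousOn_finsetSum _ hdc
  have hpc : ContinuousOn (fun t => G t ^ (M - 1)) (Set.uIcc 0 b) :=
    hGc.rpow_const fun t _ => Or.inr (by linarith)
  have i1 : IntervalIntegrable (fun t => G t ^ (M - 1) * ∑ j ∈ J, x j t) volume 0 b :=
    IntervalIntegrable.continuousOn_mul (IntervalIntegrable.sum _ hint |>.congr (by
      intro t _; simp)) hpc
  have i2 : IntervalIntegrable (fun t => G t ^ (M - 1) * ∑ j ∈ J, c j * damped (c j) (x j) t)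
      volume 0 b := ContinuousOn.intervalIntegrable (hpc.mul (continuousOn_finsetSum _
        fun j hj => continuousOn_const.mul (hdc j hj)))
  have key := ENNReal.ofReal_le_ofReal (integral_rpow_mul_damped_le J c x hb hint hx0 hM)
  rw [intervalIntegral.integral_of_le hb, intervalIntegral.integral_of_le hb,
    ofReal_integral_eq_lintegral_ofReal ((intervalIntegrable_iff_integrableOn_Ioc_of_le hb).1 i2)
      (by
        filter_upwards [ae_restrict_mem measurableSet_Ioc] with t ht
        exact mul_nonneg (Real.rpow_nonneg (hG0 t ht) _)
          (Finset.sum_nonneg fun j _ => mul_nonneg (hc j) (hd0 j t ht))),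
    ofReal_integral_eq_lintegral_ofReal ((intervalIntegrable_iff_integrableOn_Ioc_of_le hb).1 i1)
      (by
        filter_upwards [ae_restrict_mem measurableSet_Ioc] with t ht
        exact mul_nonneg (Real.rpow_nonneg (hG0 t ht) _)
          (Finset.sum_nonneg fun j _ => hx0 j t))] at key
  refine le_of_eq_of_le ?_ (key.trans_eq ?_)
  · refine setLIntegral_congr_fun measurableSet_Ioc fun t ht => ?_
    rw [ENNReal.ofReal_mul (Real.rpow_nonneg (hG0 t ht) _),
      ← ENNReal.ofReal_rpow_of_nonneg (hG0 t ht) (by linarith), ← hGe t ht,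
      ENNReal.ofReal_sum_of_nonneg fun j _ => mul_nonneg (hc j) (hd0 j t ht)]
    congr 1
    exact Finset.sum_congr rfl fun j hj => by
      rw [hconv j hj t ht, ENNReal.ofReal_mul (hc j)]
  · refine lintegral_congr_ae ?_
    have : ∀ᵐ t ∂(volume.restrict (Set.Ioc 0 b)), ∀ j ∈ J, A j t = ENNReal.ofReal (x j t) :=
      (Finset.eventually_all J).2 hae
    filter_upwards [ae_restrict_mem measurableSet_Ioc, this] with t ht hAt
    rw [ENNReal.ofReal_mul (Real.rpow_nonneg (hG0 t ht) _),
      ← ENNReal.ofReal_rpow_of_nonneg (hG0 t ht) (by linarith), ← hGe t ht,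
      ENNReal.ofReal_sum_of_nonneg fun j _ => hx0 j t]
    congr 1
    exact Finset.sum_congr rfl fun j hj => (hAt j hj).symm

/-- Fatou's lemma along the frequencies in `[-n, n]` and the times in `(0, n]`. The absorption
argument needs a finite quantity to divide by, hence is carried out on such truncations. -/
theorem lintegral_rpow_tsum_le_of_finset {g : ℤ → ℝ → ℝ≥0∞} (hg : ∀ k, Measurable (g k)) {M : ℝ}
    {B : ℝ≥0∞} (h : ∀ (J : Finset ℤ) (b : ℝ), 0 ≤ b →
      ∫⁻ t in Set.Ioc 0 b, (∑ k ∈ J, g k t) ^ M ≤ B) :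
    ∫⁻ t in Set.Ioi 0, (∑' k, g k t) ^ M ≤ B := by
  set F : ℕ → ℝ → ℝ≥0∞ := fun n => (Set.Ioc (0 : ℝ) n).indicator
    (fun t => (∑ k ∈ Finset.Icc (-(n : ℤ)) n, g k t) ^ M) with hF
  have hFm : ∀ n, Measurable (F n) := fun n =>
    Measurable.indicator (by fun_prop) measurableSet_Ioc
  have hlim : ∀ t ∈ Set.Ioi (0 : ℝ), Tendsto (fun n => F n t) atTop (𝓝 ((∑' k, g k t) ^ M)) := by
    intro t ht
    have h1 : Tendsto (fun n : ℕ => ∑ k ∈ Finset.Icc (-(n : ℤ)) n, g k t) atTop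
        (𝓝 (∑' k, g k t)) := by
      have := (ENNReal.summable (f := fun k => g k t)).hasSum
      exact this.comp (tendsto_atTop_finset_of_monotone
        (fun m n hmn => Finset.Icc_subset_Icc (by omega) (by omega))
        (fun k => ⟨k.natAbs, Finset.mem_Icc.2 ⟨by omega, by omega⟩⟩))
    have h2 := (ENNReal.continuous_rpow_const (y := M)).continuousAt.tendsto.comp h1
    refine h2.congr' ?_
    obtain ⟨N, hN⟩ := exists_nat_ge t
    filter_upwards [eventually_ge_atTop N] with n hn
    have : t ∈ Set.Ioc (0 : ℝ) n := ⟨ht, hN.trans (by exact_mod_cast hn)⟩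
    simp [hF, Set.indicator_of_mem this]
  calc ∫⁻ t in Set.Ioi 0, (∑' k, g k t) ^ M
      = ∫⁻ t in Set.Ioi 0, liminf (fun n => F n t) atTop :=
        setLIntegral_congr_fun measurableSet_Ioi fun t ht => (hlim t ht).liminf_eq.symm
    _ ≤ liminf (fun n => ∫⁻ t in Set.Ioi 0, F n t) atTop := lintegral_liminf_le hFm
    _ ≤ B := by
        refine liminf_le_of_le (by isBoundedDefault) fun b hb => ?_
        obtain ⟨n, hn⟩ := hb.exists
        refine hn.trans (le_trans ?_ (h (Finset.Icc (-(n : ℤ)) n) n (Nat.cast_nonneg n)))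
        rw [← lintegral_indicator measurableSet_Ioc]
        exact setLIntegral_le_lintegral _ _

theorem lintegral_exp_neg_le {a t : ℝ} (ha : 0 < a) :
    ∫⁻ τ in Set.Ioc 0 t, ENNReal.ofReal (Real.exp (-a * (t - τ))) ≤ ENNReal.ofReal a⁻¹ := by
  rcases le_or_gt t 0 with ht | ht
  · simp [Set.Ioc_eq_empty (not_lt.2 ht)]
  have hc : IntervalIntegrable (fun τ => Real.exp (-a * (t - τ))) volume 0 t :=
    Continuous.intervalIntegrable (by fun_prop) _ _
  rw [← ofReal_integral_eq_lintegral_ofReal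
    ((intervalIntegrable_iff_integrableOn_Ioc_of_le ht.le).1 hc)
    (ae_of_all _ fun τ => Real.exp_nonneg _), ← intervalIntegral.integral_of_le ht.le]
  refine ENNReal.ofReal_le_ofReal ?_
  have hd : ∀ τ ∈ Set.uIcc 0 t, HasDerivAt (fun τ => a⁻¹ * Real.exp (-a * (t - τ)))
      (Real.exp (-a * (t - τ))) τ := by
    intro τ _
    have h1 : HasDerivAt (fun τ => -a * (t - τ)) a τ := by
      simpa using ((hasDerivAt_id τ).const_sub t).const_mul (-a)
    have h2 := h1.exp.const_mul a⁻¹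
    refine h2.congr_deriv ?_
    field_simp
  rw [intervalIntegral.integral_eq_sub_of_hasDerivAt hd hc]
  have : 0 ≤ a⁻¹ * Real.exp (-a * (t - 0)) := by positivity
  simp only [sub_self, mul_zero, Real.exp_zero, mul_one]
  linarith

/-- Hölder's inequality for `conv`. -/
theorem conv_le_holder {c t R : ℝ} (hc : 0 < c) (hR : 1 < R) {A : ℝ → ℝ≥0∞} (hA : Measurable A) :
    conv c A t ≤ ENNReal.ofReal (c⁻¹) ^ (1 - 1 / R) *
      ENNReal.ofReal (1 - 1 / R) ^ (1 - 1 / R) *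
        (∫⁻ τ in Set.Ioc 0 t, A τ ^ R) ^ (1 / R) := by
  have hR0 : 0 < R := by linarith
  have hconj := Real.HolderConjugate.conjExponent hR
  have hpos : 0 < 1 - 1 / R := by
    have : 1 / R < 1 := (div_lt_one hR0).2 hR
    linarith
  have hq : R.conjExponent = (1 - 1 / R)⁻¹ := by
    rw [Real.conjExponent]; field_simp
  have h := ENNReal.lintegral_mul_le_Lp_mul_Lq (volume.restrict (Set.Ioc 0 t)) hconj.symm
    (f := fun τ => ENNReal.ofReal (Real.exp (-c * (t - τ)))) (g := A) (by fun_prop)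
    hA.aemeasurable
  refine le_trans h ?_
  gcongr
  have e : ∀ τ, ENNReal.ofReal (Real.exp (-c * (t - τ))) ^ R.conjExponent =
      ENNReal.ofReal (Real.exp (-(c * R.conjExponent) * (t - τ))) := fun τ => by
    rw [ENNReal.ofReal_rpow_of_pos (Real.exp_pos _), ← Real.exp_mul]
    ring_nf
  simp only [e]
  -- With `R'` the conjugate exponent, the `L^{R'}` norm of the exponential is at most `(c
  -- R')^{-1/R'}`, and `1/R' = 1 - 1/R` appears both as a factor and as the exponent.
  rw [← ENNReal.mul_rpow_of_nonneg _ _ hpos.le, ← ENNReal.ofReal_mul (by positivity)]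
  have : 1 / R.conjExponent = 1 - 1 / R := by rw [hq]; simp
  rw [this]
  gcongr
  refine (lintegral_exp_neg_le (by rw [hq]; positivity)).trans (ENNReal.ofReal_le_ofReal ?_)
  rw [mul_inv, hq, inv_inv]

/-! ### The `ℓ¹` estimate -/

/-- The estimate `L^R(ℓ¹) → L^M(ℓ¹)` for the kernels `4^{k(1-1/R+1/M)} e^{-c 4^k t}`. -/
theorem exists_lintegral_tsum_conv_le {c R M : ℝ} (hc : 0 < c) (hR : 1 < R) (hRM : R ≤ M) :
    ∃ C : ℝ≥0∞, C ≠ ⊤ ∧ ∀ A : ℤ → ℝ → ℝ≥0∞, (∀ k, Measurable (A k)) →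
      ∫⁻ t in Set.Ioi 0, (∑' k, wt (1 - 1 / R + 1 / M) k * conv (c * 4 ^ k) (A k) t) ^ M ≤
        C * (∫⁻ t in Set.Ioi 0, (∑' k, A k t) ^ R) ^ (M / R) := by
  have hR0 : 0 < R := by linarith
  have hM0 : 0 < M := by linarith
  have hM1 : 1 ≤ M := by linarith
  have hR' : 0 < 1 - 1 / R := by
    have : 1 / R < 1 := (div_lt_one hR0).2 hR
    linarith
  -- The gain of integrability in time. It satisfies `0 ≤ β < 1`, and the weights become
  -- `4^{k(1-β)}`.
  set β := 1 / R - 1 / M with hβ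
  have hβ0 : 0 ≤ β := sub_nonneg.2 (one_div_le_one_div_of_le hR0 hRM)
  have hMinv : 0 < 1 / M := by positivity
  have hβ1 : 0 < 1 - β := by rw [hβ]; linarith
  have hβe : 1 - 1 / R + 1 / M = 1 - β := by rw [hβ]; ring
  rw [hβe]
  set H : ℝ≥0∞ := ENNReal.ofReal c⁻¹ ^ (1 - 1 / R) * ENNReal.ofReal (1 - 1 / R) ^ (1 - 1 / R)
    with hH
  have hHtop : H ≠ ⊤ := ENNReal.mul_ne_top (ENNReal.rpow_ne_top_of_nonneg hR'.le ENNReal.ofReal_ne_top)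
    (ENNReal.rpow_ne_top_of_nonneg hR'.le ENNReal.ofReal_ne_top)
  set P : ℝ≥0∞ := H * geo (1 / M) with hP
  have hPtop : P ≠ ⊤ := ENNReal.mul_ne_top hHtop (geo_ne_top hMinv)
  set D : ℝ≥0∞ := ENNReal.ofReal M * ENNReal.ofReal c⁻¹ * P ^ (M * β) * geo (1 - β) with hD
  have hDtop : D ≠ ⊤ := by
    refine ENNReal.mul_ne_top (ENNReal.mul_ne_top (ENNReal.mul_ne_top ENNReal.ofReal_ne_top
      ENNReal.ofReal_ne_top) (ENNReal.rpow_ne_top_of_nonneg (by positivity) hPtop)) (geo_ne_top hβ1)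
  -- The added `1` keeps the constant nonzero, so that the bound is `⊤` when the norm of the source
  -- is infinite.
  refine ⟨D ^ R + 1, by simp [ENNReal.rpow_ne_top_of_nonneg hR0.le hDtop], fun A hA => ?_⟩
  set S : ℝ → ℝ≥0∞ := fun t => ∑' k, A k t with hS
  have hSm : Measurable S := Measurable.tsum hA
  set N := ∫⁻ t in Set.Ioi 0, S t ^ R with hN
  rcases eq_or_ne N ⊤ with hNt | hNt
  · rw [hNt, ENNReal.top_rpow_of_pos (by positivity), ENNReal.mul_top (by simp)]
    exact le_top
  have hAS : ∀ k t, A k t ≤ S t := fun k t => ENNReal.le_tsum k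
  refine lintegral_rpow_tsum_le_of_finset
    (fun k => (measurable_conv _ (hA k)).const_mul _) fun J b hb => ?_
  set g : ℤ → ℝ → ℝ≥0∞ := fun k t => wt (1 - β) k * conv (c * 4 ^ k) (A k) t with hg
  have hgm : ∀ k, Measurable (g k) := fun k => (measurable_conv _ (hA k)).const_mul _
  have hck : ∀ k : ℤ, 0 < c * (4 : ℝ) ^ k := fun k => by positivity
  -- Hölder in time loses `4^{-k(1-1/R)}` against the weight `4^{k(1-β)}`, which leaves `4^{k/M}`.
  -- This grows with `k`, so the sum over `j ≤ k` is dominated by its last term.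
  have hgle : ∀ k t, g k t ≤ wt (1 / M) k * (H * N ^ (1 / R)) := by
    intro k t
    have h1 := conv_le_holder (t := t) (hck k) hR (hA k)
    have h2 : ∫⁻ τ in Set.Ioc 0 t, A k τ ^ R ≤ N :=
      (lintegral_mono_set Set.Ioc_subset_Ioi_self).trans (lintegral_mono fun τ => by
        gcongr; exact hAS k τ)
    have h3 : ENNReal.ofReal ((c * 4 ^ k)⁻¹) ^ (1 - 1 / R) =
        ENNReal.ofReal c⁻¹ ^ (1 - 1 / R) * wt (-(1 - 1 / R)) k := by
      rw [mul_inv, ENNReal.ofReal_mul (by positivity), ENNReal.mul_rpow_of_nonneg _ _ hR'.le]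
      congr 1
      rw [wt_eq_ofReal, ENNReal.ofReal_rpow_of_pos (by positivity)]
      congr 1
      rw [← Real.rpow_intCast, ← Real.rpow_neg (by norm_num), ← Real.rpow_mul (by norm_num)]
      ring_nf
    calc g k t ≤ wt (1 - β) k * (ENNReal.ofReal c⁻¹ ^ (1 - 1 / R) * wt (-(1 - 1 / R)) k *
          ENNReal.ofReal (1 - 1 / R) ^ (1 - 1 / R) * N ^ (1 / R)) := by
          rw [← h3]
          simp only [hg]
          gcongr
          refine h1.trans ?_
          gcongr
      _ = (wt (1 - β) k * wt (-(1 - 1 / R)) k) * (H * N ^ (1 / R)) := by rw [hH]; ring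
      _ = _ := by rw [wt_mul, hβ]; ring_nf
  have hNR : N ^ (1 / R) ≠ ⊤ := ENNReal.rpow_ne_top_of_nonneg (by positivity) hNt
  have hGk : ∀ k t, ∑ j ∈ J with j ≤ k, g j t ≤ wt (1 / M) k * (P * N ^ (1 / R)) := by
    intro k t
    calc ∑ j ∈ J with j ≤ k, g j t
        ≤ ∑ j ∈ J with j ≤ k, wt (1 / M) j * (H * N ^ (1 / R)) :=
          Finset.sum_le_sum fun j _ => hgle j t
      _ = (∑ j ∈ J with j ≤ k, wt (1 / M) j) * (H * N ^ (1 / R)) := by rw [Finset.sum_mul]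
      _ ≤ (wt (1 / M) k * geo (1 / M)) * (H * N ^ (1 / R)) := by gcongr; exact sum_wt_le J k
      _ = _ := by rw [hP]; ring
  set G : ℝ → ℝ≥0∞ := fun t => ∑ j ∈ J, g j t with hG
  have hGm : Measurable G := Finset.measurable_fun_sum _ fun k _ => hgm k
  have hGkG : ∀ k t, ∑ j ∈ J with j ≤ k, g j t ≤ G t := fun k t =>
    Finset.sum_le_sum_of_subset (Finset.filter_subset _ _)
  set X := ∫⁻ t in Set.Ioc 0 b, G t ^ M with hX
  -- Finiteness, needed for the absorption at the end; it holds because `J` is finite and the time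
  -- interval bounded.
  have hXtop : X ≠ ⊤ := by
    have hbd : ∀ t, G t ^ M ≤ (∑ j ∈ J, wt (1 / M) j * (H * N ^ (1 / R))) ^ M := fun t => by
      refine ENNReal.rpow_le_rpow (Finset.sum_le_sum fun j _ => hgle j t) hM0.le
    refine ne_top_of_le_ne_top ?_ (lintegral_mono hbd)
    rw [lintegral_const]
    refine ENNReal.mul_ne_top (ENNReal.rpow_ne_top_of_nonneg hM0.le ?_) (by simp)
    exact ENNReal.sum_ne_top.2 fun j _ => ENNReal.mul_ne_top (wt_ne_top _ _)
      (ENNReal.mul_ne_top hHtop hNR)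
  have hAfin : ∀ k, ∫⁻ t in Set.Ioc 0 b, A k t ≠ ⊤ := by
    intro k
    have hconj := Real.HolderConjugate.conjExponent hR
    have h := ENNReal.lintegral_mul_le_Lp_mul_Lq (volume.restrict (Set.Ioc 0 b)) hconj
      (f := A k) (g := fun _ => 1) (hA k).aemeasurable (by fun_prop)
    simp only [Pi.mul_apply, mul_one, ENNReal.one_rpow, lintegral_const, one_mul] at h
    refine ne_top_of_le_ne_top ?_ h
    refine ENNReal.mul_ne_top (ENNReal.rpow_ne_top_of_nonneg (by positivity) ?_)
      (ENNReal.rpow_ne_top_of_nonneg (by have := hconj.symm.pos; positivity) (by simp))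
    refine ne_top_of_le_ne_top hNt ((lintegral_mono_set Set.Ioc_subset_Ioi_self).trans
      (lintegral_mono fun τ => ?_))
    gcongr
    exact hAS k τ
  -- the energy estimate for the partial sums
  have hen : ∀ k ∈ J, ∫⁻ t in Set.Ioc 0 b, g k t * (∑ j ∈ J with j ≤ k, g j t) ^ (M - 1) ≤
      ENNReal.ofReal c⁻¹ * wt (-1) k * ∫⁻ t in Set.Ioc 0 b,
        (∑ j ∈ J with j ≤ k, g j t) ^ (M - 1) * ∑ j ∈ J with j ≤ k, wt (1 - β) j * A j t := by
    intro k hk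
    have h := lintegral_rpow_mul_conv_le (J.filter (· ≤ k)) (c := fun j => c * 4 ^ j)
      (fun j => (hck j).le) (A := fun j t => wt (1 - β) j * A j t)
      (fun j => (hA j).const_mul _) hb (fun j _ => by
        rw [lintegral_const_mul _ (hA j)]
        exact ENNReal.mul_ne_top (wt_ne_top _ _) (hAfin j)) hM1
    simp only [conv_const_mul (wt_ne_top _ _)] at h
    -- On the dissipative side only the top frequency `j = k` is kept; its rate `c 4^k` is the gain.
    have h1 : ENNReal.ofReal c * wt 1 k *
        ∫⁻ t in Set.Ioc 0 b, g k t * (∑ j ∈ J with j ≤ k, g j t) ^ (M - 1) ≤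
        ∫⁻ t in Set.Ioc 0 b, (∑ j ∈ J with j ≤ k, g j t) ^ (M - 1) *
          ∑ j ∈ J with j ≤ k, wt (1 - β) j * A j t := by
      refine le_trans ?_ h
      rw [← lintegral_const_mul' _ _ (ENNReal.mul_ne_top ENNReal.ofReal_ne_top (wt_ne_top _ _))]
      refine lintegral_mono fun t => ?_
      have h2 : ENNReal.ofReal c * wt 1 k * g k t ≤
          ∑ j ∈ J with j ≤ k, ENNReal.ofReal (c * 4 ^ j) * g j t := by
        have := Finset.single_le_sum (f := fun j => ENNReal.ofReal (c * 4 ^ j) * g j t)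
          (s := J.filter (· ≤ k)) (fun _ _ => zero_le) (a := k) (by simp [hk])
        refine le_trans (le_of_eq ?_) this
        rw [ENNReal.ofReal_mul hc.le, wt_one]
      calc ENNReal.ofReal c * wt 1 k * (g k t * (∑ j ∈ J with j ≤ k, g j t) ^ (M - 1))
          = (∑ j ∈ J with j ≤ k, g j t) ^ (M - 1) * (ENNReal.ofReal c * wt 1 k * g k t) := by ring
        _ ≤ _ := by gcongr
    have hcc : ENNReal.ofReal c⁻¹ * ENNReal.ofReal c = 1 := by
      rw [← ENNReal.ofReal_mul (by positivity), inv_mul_cancel₀ hc.ne', ENNReal.ofReal_one]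
    have hww : wt (-1) k * wt 1 k = 1 := by rw [mul_comm, wt_mul_neg]
    calc _ = (ENNReal.ofReal c⁻¹ * ENNReal.ofReal c) * (wt (-1) k * wt 1 k) *
          ∫⁻ t in Set.Ioc 0 b, g k t * (∑ j ∈ J with j ≤ k, g j t) ^ (M - 1) := by
          rw [hcc, hww, one_mul, one_mul]
      _ = ENNReal.ofReal c⁻¹ * wt (-1) k * (ENNReal.ofReal c * wt 1 k *
          ∫⁻ t in Set.Ioc 0 b, g k t * (∑ j ∈ J with j ≤ k, g j t) ^ (M - 1)) := by ring
      _ ≤ _ := by gcongr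
  -- In `G_k^{M-1}`, the power `M(1-1/R)` is estimated by `G`, ready for Hölder against the source
  -- in `L^R`; the power `Mβ` is estimated by the pointwise bound, contributing `4^{kβ}`. With the
  -- `4^{-k}` of the energy estimate this gives `4^{-k(1-β)}`.
  have hMe : M - 1 = M * (1 - 1 / R) + M * β := by rw [hβ]; field_simp; ring
  have hpw : ∀ k t, wt (-1) k * (∑ j ∈ J with j ≤ k, g j t) ^ (M - 1) ≤
      wt (-(1 - β)) k * (G t ^ (M * (1 - 1 / R)) * (P * N ^ (1 / R)) ^ (M * β)) := by
    intro k t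
    rw [hMe, ENNReal.rpow_add_of_nonneg _ _ (by positivity) (by positivity)]
    calc _ ≤ wt (-1) k * (G t ^ (M * (1 - 1 / R)) *
          (wt (1 / M) k * (P * N ^ (1 / R))) ^ (M * β)) := by
          gcongr
          · exact hGkG k t
          · exact hGk k t
      _ = (wt (-1) k * wt (1 / M * (M * β)) k) *
          (G t ^ (M * (1 - 1 / R)) * (P * N ^ (1 / R)) ^ (M * β)) := by
          rw [ENNReal.mul_rpow_of_nonneg _ _ (by positivity), wt_rpow]; ring
      _ = _ := by
          rw [wt_mul]
          congr 2
          field_simp; ring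
  set Q : ℝ≥0∞ := (P * N ^ (1 / R)) ^ (M * β) with hQ
  have hQtop : Q ≠ ⊤ := ENNReal.rpow_ne_top_of_nonneg (by positivity)
    (ENNReal.mul_ne_top hPtop hNR)
  have hsum : ∑ k ∈ J, ∫⁻ t in Set.Ioc 0 b, g k t * (∑ j ∈ J with j ≤ k, g j t) ^ (M - 1) ≤
      ENNReal.ofReal c⁻¹ * Q * geo (1 - β) *
        ∫⁻ t in Set.Ioc 0 b, G t ^ (M * (1 - 1 / R)) * S t := by
    calc _ ≤ ∑ k ∈ J, ENNReal.ofReal c⁻¹ * wt (-1) k * ∫⁻ t in Set.Ioc 0 b,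
          (∑ j ∈ J with j ≤ k, g j t) ^ (M - 1) * ∑ j ∈ J with j ≤ k, wt (1 - β) j * A j t :=
          Finset.sum_le_sum hen
      _ = ∫⁻ t in Set.Ioc 0 b, ∑ k ∈ J, ENNReal.ofReal c⁻¹ * wt (-1) k *
          ((∑ j ∈ J with j ≤ k, g j t) ^ (M - 1) * ∑ j ∈ J with j ≤ k, wt (1 - β) j * A j t) := by
          rw [lintegral_finsetSum]
          · refine Finset.sum_congr rfl fun k _ => ?_
            rw [lintegral_const_mul' _ _ (ENNReal.mul_ne_top ENNReal.ofReal_ne_top (wt_ne_top _ _))]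
          · intro k _
            refine Measurable.const_mul (Measurable.mul ?_ ?_) _
            · exact (Finset.measurable_fun_sum _ fun j _ => hgm j).pow_const _
            · exact Finset.measurable_fun_sum _ fun j _ => (hA j).const_mul _
      _ ≤ ∫⁻ t in Set.Ioc 0 b, ENNReal.ofReal c⁻¹ * Q * geo (1 - β) *
          (G t ^ (M * (1 - 1 / R)) * S t) := by
          refine lintegral_mono fun t => ?_
          calc _ = ENNReal.ofReal c⁻¹ * ∑ k ∈ J, (wt (-1) k *
                (∑ j ∈ J with j ≤ k, g j t) ^ (M - 1)) *
                ∑ j ∈ J with j ≤ k, wt (1 - β) j * A j t := by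
                rw [Finset.mul_sum]; exact Finset.sum_congr rfl fun k _ => by ring
            _ ≤ ENNReal.ofReal c⁻¹ * ∑ k ∈ J, (wt (-(1 - β)) k *
                (G t ^ (M * (1 - 1 / R)) * Q)) *
                ∑ j ∈ J with j ≤ k, wt (1 - β) j * A j t := by
                refine mul_le_mul_right (Finset.sum_le_sum fun k _ => ?_) _
                exact mul_le_mul_left (hpw k t) _
            _ = ENNReal.ofReal c⁻¹ * (G t ^ (M * (1 - 1 / R)) * Q) *
                ∑ k ∈ J, ∑ j ∈ J with j ≤ k, wt (-(1 - β)) k * (wt (1 - β) j * A j t) := by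
                rw [Finset.mul_sum, Finset.mul_sum]
                refine Finset.sum_congr rfl fun k _ => ?_
                rw [← Finset.mul_sum]; ring
            -- After the interchange, the sum of `4^{-k(1-β)}` over `k ≥ j` is geometric and cancels
            -- the weight `4^{j(1-β)}` of the source.
            _ = ENNReal.ofReal c⁻¹ * (G t ^ (M * (1 - 1 / R)) * Q) *
                ∑ j ∈ J, ∑ k ∈ J with j ≤ k, wt (-(1 - β)) k * (wt (1 - β) j * A j t) := by
                congr 1
                refine Finset.sum_comm' ?_
                intro x y; simp; tauto
            _ ≤ ENNReal.ofReal c⁻¹ * (G t ^ (M * (1 - 1 / R)) * Q) *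
                ∑ j ∈ J, geo (1 - β) * A j t := by
                gcongr with j _
                rw [← Finset.sum_mul]
                calc _ ≤ wt (-(1 - β)) j * geo (1 - β) * (wt (1 - β) j * A j t) := by
                      gcongr; exact sum_wt_neg_le J j
                  _ = (wt (1 - β) j * wt (-(1 - β)) j) * (geo (1 - β) * A j t) := by ring
                  _ = _ := by rw [wt_mul_neg, one_mul]
            _ ≤ ENNReal.ofReal c⁻¹ * (G t ^ (M * (1 - 1 / R)) * Q) * (geo (1 - β) * S t) := by
                rw [← Finset.mul_sum]
                gcongr
                exact ENNReal.sum_le_tsum J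
            _ = _ := by ring
      _ = _ := by
          rw [lintegral_const_mul' _ _ (ENNReal.mul_ne_top (ENNReal.mul_ne_top
            ENNReal.ofReal_ne_top hQtop) (geo_ne_top hβ1))]
  have hhol : ∫⁻ t in Set.Ioc 0 b, G t ^ (M * (1 - 1 / R)) * S t ≤
      X ^ (1 - 1 / R) * N ^ (1 / R) := by
    have hconj := Real.HolderConjugate.conjExponent hR
    have h := ENNReal.lintegral_mul_le_Lp_mul_Lq (volume.restrict (Set.Ioc 0 b)) hconj.symm
      (f := fun t => G t ^ (M * (1 - 1 / R))) (g := S) (hGm.pow_const _).aemeasurable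
      hSm.aemeasurable
    have hq : R.conjExponent = (1 - 1 / R)⁻¹ := by rw [Real.conjExponent]; field_simp
    rw [hq] at h
    refine h.trans ?_
    simp only [← ENNReal.rpow_mul, mul_assoc, mul_inv_cancel₀ hR'.ne', mul_one]
    rw [one_div (1 - 1 / R)⁻¹, inv_inv]
    gcongr
    exact lintegral_mono_set Set.Ioc_subset_Ioi_self
  have hXle : X ≤ D * N ^ (M / R / R) * X ^ (1 - 1 / R) := by
    calc X ≤ ∫⁻ t in Set.Ioc 0 b, ∑ k ∈ J, ENNReal.ofReal M *
          (g k t * (∑ j ∈ J with j ≤ k, g j t) ^ (M - 1)) := by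
          refine lintegral_mono fun t => ?_
          refine (sum_rpow_le_sum_mul hM1 J fun k => g k t).trans_eq ?_
          exact Finset.sum_congr rfl fun k _ => by ring
      _ = ENNReal.ofReal M * ∑ k ∈ J, ∫⁻ t in Set.Ioc 0 b,
          g k t * (∑ j ∈ J with j ≤ k, g j t) ^ (M - 1) := by
          rw [lintegral_finsetSum, Finset.mul_sum]
          · refine Finset.sum_congr rfl fun k _ => ?_
            rw [lintegral_const_mul' _ _ ENNReal.ofReal_ne_top]
          · intro k _
            exact ((hgm k).mul ((Finset.measurable_fun_sum _ fun j _ => hgm j).pow_const _)).const_mul _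
      _ ≤ ENNReal.ofReal M * (ENNReal.ofReal c⁻¹ * Q * geo (1 - β) *
          (X ^ (1 - 1 / R) * N ^ (1 / R))) := by
          gcongr
          refine hsum.trans ?_
          gcongr
      _ = D * (N ^ (1 / R * (M * β)) * N ^ (1 / R)) * X ^ (1 - 1 / R) := by
          rw [hQ, ENNReal.mul_rpow_of_nonneg _ _ (by positivity), ← ENNReal.rpow_mul, hD]
          ring
      _ = _ := by
          rw [← ENNReal.rpow_add_of_nonneg _ _ (by positivity) (by positivity)]
          congr 3
          rw [hβ]; field_simp; ring
  rcases eq_or_ne X 0 with hX0 | hX0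
  · rw [hX0]; exact zero_le
  -- Absorption: division by `X^{1-1/R}`, which is neither `0` nor `⊤`.
  have hXR : X ^ (1 / R) ≤ D * N ^ (M / R / R) := by
    have hXp0 : X ^ (1 - 1 / R) ≠ 0 := by
      simp [ENNReal.rpow_eq_zero_iff, hX0, hXtop]
    have hXpt : X ^ (1 - 1 / R) ≠ ⊤ := ENNReal.rpow_ne_top_of_nonneg hR'.le hXtop
    rw [← ENNReal.mul_le_mul_iff_left hXp0 hXpt]
    refine le_trans (le_of_eq ?_) hXle
    rw [← ENNReal.rpow_add_of_nonneg _ _ (by positivity) hR'.le]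
    simp
  calc X = (X ^ (1 / R)) ^ R := by rw [← ENNReal.rpow_mul, one_div_mul_cancel hR0.ne', ENNReal.rpow_one]
    _ ≤ (D * N ^ (M / R / R)) ^ R := by gcongr
    _ = D ^ R * N ^ (M / R) := by
        rw [ENNReal.mul_rpow_of_nonneg _ _ hR0.le, ← ENNReal.rpow_mul, div_mul_cancel₀ _ hR0.ne']
    _ ≤ (D ^ R + 1) * N ^ (M / R) := by gcongr; exact le_self_add

/-! ### Jensen and Minkowski inequalities, and the `ℓ^q` estimate -/

/-- Jensen's inequality for the measure `K dμ`, obtained from Hölder's inequality by splitting `K =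
K^{1/q} K^{1/q'}`. It serves both for convolutions in time and for Young's inequality in space. -/
theorem lintegral_mul_rpow_le {α : Type*} [MeasurableSpace α] (μ : Measure α) {K f : α → ℝ≥0∞}
    (hK : Measurable K) (hf : Measurable f) {q : ℝ} (hq : 1 ≤ q) :
    (∫⁻ x, K x * f x ∂μ) ^ q ≤ (∫⁻ x, K x ∂μ) ^ (q - 1) * ∫⁻ x, K x * f x ^ q ∂μ := by
  rcases hq.eq_or_lt with rfl | hq1
  · simp
  have hq0 : 0 < q := by linarith
  have hconj := Real.HolderConjugate.conjExponent hq1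
  have h := ENNReal.lintegral_mul_le_Lp_mul_Lq μ hconj
    (f := fun x => K x ^ (1 / q) * f x) (g := fun x => K x ^ (1 / q.conjExponent))
    (by fun_prop) (by fun_prop)
  have hsum : 1 / q + 1 / q.conjExponent = 1 := by
    simpa [one_div] using hconj.inv_add_inv_eq_one
  have e : ∀ x, K x * f x = K x ^ (1 / q) * f x * K x ^ (1 / q.conjExponent) := fun x => by
    have h0 : 0 ≤ 1 / q.conjExponent := by have := hconj.symm.pos; positivity
    have : K x = K x ^ (1 / q) * K x ^ (1 / q.conjExponent) := by
      rw [← ENNReal.rpow_add_of_nonneg _ _ (by positivity) h0, hsum, ENNReal.rpow_one]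
    calc K x * f x = K x ^ (1 / q) * K x ^ (1 / q.conjExponent) * f x := by rw [← this]
      _ = _ := by ring
  have e2 : ∀ x, (K x ^ (1 / q) * f x) ^ q = K x * f x ^ q := fun x => by
    rw [ENNReal.mul_rpow_of_nonneg _ _ hq0.le, ← ENNReal.rpow_mul, one_div_mul_cancel hq0.ne',
      ENNReal.rpow_one]
  have e3 : ∀ x, (K x ^ (1 / q.conjExponent)) ^ q.conjExponent = K x := fun x => by
    rw [← ENNReal.rpow_mul, one_div_mul_cancel hconj.symm.pos.ne', ENNReal.rpow_one]
  simp only [Pi.mul_apply, e2, e3] at h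
  simp only [← e] at h
  calc (∫⁻ x, K x * f x ∂μ) ^ q ≤
        ((∫⁻ x, K x * f x ^ q ∂μ) ^ (1 / q) * (∫⁻ x, K x ∂μ) ^ (1 / q.conjExponent)) ^ q := by
        gcongr
    _ = _ := by
        rw [ENNReal.mul_rpow_of_nonneg _ _ hq0.le, ← ENNReal.rpow_mul, one_div_mul_cancel hq0.ne',
          ENNReal.rpow_one, ← ENNReal.rpow_mul, mul_comm]
        congr 2
        have : 1 / q.conjExponent = 1 - 1 / q := by linarith
        rw [this]; field_simp

theorem conv_rpow_le {c t q : ℝ} (hc : 0 < c) (hq : 1 ≤ q) {A : ℝ → ℝ≥0∞} (hA : Measurable A) :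
    conv c A t ^ q ≤ ENNReal.ofReal c⁻¹ ^ (q - 1) * conv c (fun τ => A τ ^ q) t := by
  refine (lintegral_mul_rpow_le _ (by fun_prop) hA hq).trans ?_
  rw [conv]
  gcongr
  exact lintegral_exp_neg_le hc

theorem lintegral_sum_rpow_le {α ι : Type*} [MeasurableSpace α] (μ : Measure α) (J : Finset ι)
    {F : ι → α → ℝ≥0∞} (hF : ∀ k, Measurable (F k)) {M : ℝ} (hM : 1 ≤ M) :
    (∫⁻ x, (∑ k ∈ J, F k x) ^ M ∂μ) ^ (1 / M) ≤ ∑ k ∈ J, (∫⁻ x, F k x ^ M ∂μ) ^ (1 / M) := by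
  have hM0 : 0 < M := by linarith
  induction J using Finset.cons_induction with
  | empty => simp [ENNReal.zero_rpow_of_pos hM0, hM0]
  | cons j J hj ih =>
    simp only [Finset.sum_cons]
    refine (ENNReal.lintegral_Lp_add_le (f := F j) (g := fun x => ∑ k ∈ J, F k x)
      (hF j).aemeasurable (Finset.measurable_fun_sum _ fun k _ => hF k).aemeasurable hM).trans ?_
    gcongr

/-- Minkowski's integral inequality, by duality: the integrals `B_k` are tested against `B_k^{ρ-1}`,
the sum is estimated by Hölder under the integral sign, and the resulting power of `∑ B_k^ρ` is
divided out. -/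
theorem tsum_lintegral_rpow_le {α : Type*} {ι : Type*} [MeasurableSpace α] (μ : Measure α)
    {b : ι → α → ℝ≥0∞} (hb : ∀ k, Measurable (b k)) {ρ : ℝ} (hρ : 1 ≤ ρ) :
    ∑' k, (∫⁻ x, b k x ∂μ) ^ ρ ≤ (∫⁻ x, (∑' k, b k x ^ ρ) ^ (1 / ρ) ∂μ) ^ ρ := by
  have hρ0 : 0 < ρ := by linarith
  set N := ∫⁻ x, (∑' k, b k x ^ ρ) ^ (1 / ρ) ∂μ with hN
  rcases eq_or_ne N ⊤ with hNt | hNt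
  · rw [hNt, ENNReal.top_rpow_of_pos hρ0]; exact le_top
  rw [ENNReal.tsum_eq_iSup_sum]
  refine iSup_le fun J => ?_
  rcases hρ.eq_or_lt with rfl | hρ1
  · simp only [ENNReal.rpow_one, div_one] at hN ⊢
    rw [← lintegral_finsetSum _ fun k _ => hb k, hN]
    exact lintegral_mono fun x => ENNReal.sum_le_tsum J
  have hconj := Real.HolderConjugate.conjExponent hρ1
  have hB : ∀ k, ∫⁻ x, b k x ∂μ ≠ ⊤ := fun k => by
    refine ne_top_of_le_ne_top hNt (lintegral_mono fun x => ?_)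
    calc b k x = (b k x ^ ρ) ^ (1 / ρ) := by
          rw [← ENNReal.rpow_mul, mul_one_div_cancel hρ0.ne', ENNReal.rpow_one]
      _ ≤ _ := by gcongr; exact ENNReal.le_tsum k
  set B : ι → ℝ≥0∞ := fun k => ∫⁻ x, b k x ∂μ with hBdef
  set Y := ∑ k ∈ J, B k ^ ρ with hY
  have hYt : Y ≠ ⊤ := ENNReal.sum_ne_top.2 fun k _ => ENNReal.rpow_ne_top_of_nonneg hρ0.le (hB k)
  have hce : 1 / ρ.conjExponent = 1 - 1 / ρ := by
    have : 1 / ρ + 1 / ρ.conjExponent = 1 := by simpa [one_div] using hconj.inv_add_inv_eq_one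
    linarith
  have hρ' : 0 < 1 - 1 / ρ := by rw [← hce]; have := hconj.symm.pos; positivity
  have hYle : Y ≤ Y ^ (1 - 1 / ρ) * N := by
    calc Y = ∑ k ∈ J, B k ^ (ρ - 1) * ∫⁻ x, b k x ∂μ := by
          refine Finset.sum_congr rfl fun k _ => ?_
          have : B k ^ ρ = B k ^ (ρ - 1) * B k ^ (1 : ℝ) := by
            rw [← ENNReal.rpow_add_of_nonneg _ _ (by linarith) (by norm_num)]; ring_nf
          rw [this, ENNReal.rpow_one]
      _ = ∫⁻ x, ∑ k ∈ J, B k ^ (ρ - 1) * b k x ∂μ := by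
          rw [lintegral_finsetSum _ fun k _ => (hb k).const_mul _]
          refine Finset.sum_congr rfl fun k _ => ?_
          rw [lintegral_const_mul _ (hb k)]
      _ ≤ ∫⁻ x, Y ^ (1 - 1 / ρ) * (∑' k, b k x ^ ρ) ^ (1 / ρ) ∂μ := by
          refine lintegral_mono fun x => ?_
          refine (ENNReal.inner_le_Lp_mul_Lq J _ _ hconj.symm).trans ?_
          rw [hce]
          have : ∀ k, (B k ^ (ρ - 1)) ^ ρ.conjExponent = B k ^ ρ := fun k => by
            rw [← ENNReal.rpow_mul, hconj.sub_one_mul_conj]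
          simp only [this]
          gcongr
          exact ENNReal.sum_le_tsum J
      _ = _ := by
          rw [lintegral_const_mul' _ _ (ENNReal.rpow_ne_top_of_nonneg hρ'.le hYt)]
  rcases eq_or_ne Y 0 with hY0 | hY0
  · rw [hY0]; exact zero_le
  have hYρ : Y ^ (1 / ρ) ≤ N := by
    have h0 : Y ^ (1 - 1 / ρ) ≠ 0 := by simp [ENNReal.rpow_eq_zero_iff, hY0, hYt]
    have ht : Y ^ (1 - 1 / ρ) ≠ ⊤ := ENNReal.rpow_ne_top_of_nonneg hρ'.le hYt
    rw [← ENNReal.mul_le_mul_iff_right h0 ht]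
    refine le_trans (le_of_eq ?_) hYle
    rw [← ENNReal.rpow_add_of_nonneg _ _ hρ'.le (by positivity)]
    simp
  calc Y = (Y ^ (1 / ρ)) ^ ρ := by
        rw [← ENNReal.rpow_mul, one_div_mul_cancel hρ0.ne', ENNReal.rpow_one]
    _ ≤ _ := by gcongr

/-- The estimate `L^r(ℓ^q) → L^m(ℓ^q)` for the kernels `4^{k(1-1/r+1/m)} e^{-c 4^k t}`. -/
theorem exists_lintegral_lq_conv_le {c r m q : ℝ} (hc : 0 < c) (hr : 1 < r) (hrm : r ≤ m)
    (hq : 1 ≤ q) (hqm : q ≤ m) :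
    ∃ C : ℝ≥0∞, C ≠ ⊤ ∧ ∀ a : ℤ → ℝ → ℝ≥0∞, (∀ k, Measurable (a k)) →
      ∫⁻ t in Set.Ioi 0,
          (∑' k, (wt (1 - 1 / r + 1 / m) k * conv (c * 4 ^ k) (a k) t) ^ q) ^ (m / q) ≤
        C * (∫⁻ t in Set.Ioi 0, (∑' k, a k t ^ q) ^ (r / q)) ^ (m / r) := by
  have hq0 : 0 < q := by linarith
  have hr0 : 0 < r := by linarith
  have hm0 : 0 < m := by linarith
  have hM1 : 1 ≤ m / q := (one_le_div hq0).2 hqm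
  have hck : ∀ k : ℤ, 0 < c * (4 : ℝ) ^ k := fun k => by positivity
  rcases lt_or_ge q r with hqr | hrq
  -- For `q < r`, Jensen's inequality moves the power `q` inside the convolution at the price of
  -- `4^{-k(q-1)}`. The weights become those of the `ℓ¹` estimate with the exponents `r/q` and
  -- `m/q`.
  · obtain ⟨C, hC, h⟩ := exists_lintegral_tsum_conv_le hc ((one_lt_div hq0).2 hqr)
      (div_le_div_of_nonneg_right hrm hq0.le)
    have hD : (ENNReal.ofReal c⁻¹ ^ (q - 1)) ^ (m / q) ≠ ⊤ :=
      ENNReal.rpow_ne_top_of_nonneg (by positivity)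
        (ENNReal.rpow_ne_top_of_nonneg (by linarith) ENNReal.ofReal_ne_top)
    refine ⟨(ENNReal.ofReal c⁻¹ ^ (q - 1)) ^ (m / q) * C, ENNReal.mul_ne_top hD hC,
      fun a ha => ?_⟩
    have h1 := h (fun k t => a k t ^ q) fun k => (ha k).pow_const _
    have he : m / q / (r / q) = m / r := by field_simp
    have he2 : 1 - 1 / (r / q) + 1 / (m / q) = 1 - q / r + q / m := by field_simp
    rw [he, he2] at h1
    rw [mul_assoc]
    refine le_trans ?_ (mul_le_mul_right h1 _)
    rw [← lintegral_const_mul' _ _ hD]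
    refine lintegral_mono fun t => ?_
    rw [← ENNReal.mul_rpow_of_nonneg _ _ (by positivity), ← ENNReal.tsum_mul_left]
    gcongr with k
    rw [ENNReal.mul_rpow_of_nonneg _ _ hq0.le, wt_rpow]
    have h3 : ENNReal.ofReal ((c * 4 ^ k)⁻¹) ^ (q - 1) =
        ENNReal.ofReal c⁻¹ ^ (q - 1) * wt (-(q - 1)) k := by
      rw [mul_inv, ENNReal.ofReal_mul (by positivity),
        ENNReal.mul_rpow_of_nonneg _ _ (by linarith)]
      congr 1
      rw [wt_eq_ofReal, ENNReal.ofReal_rpow_of_pos (by positivity)]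
      congr 1
      rw [← Real.rpow_intCast, ← Real.rpow_neg (by norm_num), ← Real.rpow_mul (by norm_num)]
      ring_nf
    calc _ ≤ wt ((1 - 1 / r + 1 / m) * q) k * (ENNReal.ofReal ((c * 4 ^ k)⁻¹) ^ (q - 1) *
          conv (c * 4 ^ k) (fun τ => a k τ ^ q) t) := by
          gcongr
          exact conv_rpow_le (hck k) hq (ha k)
      _ = ENNReal.ofReal c⁻¹ ^ (q - 1) * ((wt ((1 - 1 / r + 1 / m) * q) k * wt (-(q - 1)) k) *
          conv (c * 4 ^ k) (fun τ => a k τ ^ q) t) := by rw [h3]; ring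
      _ = _ := by
          rw [wt_mul]
          congr 3
          ring
  -- For `r ≤ q ≤ m`, one has `L^m(ℓ^q) ⊇ ℓ^q(L^m)` and `ℓ^q(L^r) ⊇ L^r(ℓ^q)` by Minkowski. Between
  -- them a bound for each single frequency suffices, which is the `ℓ¹` estimate for a sequence with
  -- one nonzero entry.
  · obtain ⟨C, hC, h⟩ := exists_lintegral_tsum_conv_le hc hr hrm
    refine ⟨C, hC, fun a ha => ?_⟩
    set f : ℤ → ℝ → ℝ≥0∞ := fun k t => wt (1 - 1 / r + 1 / m) k * conv (c * 4 ^ k) (a k) t with hf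
    have hfm : ∀ k, Measurable (f k) := fun k => (measurable_conv _ (ha k)).const_mul _
    have hfk : ∀ k, ∫⁻ t in Set.Ioi 0, f k t ^ m ≤
        C * (∫⁻ t in Set.Ioi 0, a k t ^ r) ^ (m / r) := by
      intro k
      have h1 := h (Pi.single k (a k)) fun j => by
        rcases eq_or_ne j k with rfl | hjk
        · simpa using ha j
        · rw [Pi.single_eq_of_ne hjk]; exact measurable_const
      refine le_trans (lintegral_mono fun t => ?_) (h1.trans_eq ?_)
      · have h2 := ENNReal.le_tsum (f := fun j => wt (1 - 1 / r + 1 / m) j *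
          conv (c * 4 ^ j) (Pi.single (M := fun _ => ℝ → ℝ≥0∞) k (a k) j) t) k
        rw [Pi.single_eq_same] at h2
        gcongr
      · congr 4
        ext t
        rw [tsum_eq_single k fun j hj => by rw [Pi.single_eq_of_ne hj]; rfl, Pi.single_eq_same]
    have e1 : ∀ k t, (f k t ^ q) ^ (m / q) = f k t ^ m := fun k t => by
      rw [← ENNReal.rpow_mul, mul_div_cancel₀ _ hq0.ne']
    have e2 : ∀ k t, (a k t ^ r) ^ (q / r) = a k t ^ q := fun k t => by
      rw [← ENNReal.rpow_mul, mul_div_cancel₀ _ hr0.ne']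
    have hS := tsum_lintegral_rpow_le (volume.restrict (Set.Ioi (0 : ℝ)))
      (b := fun k t => a k t ^ r) (fun k => (ha k).pow_const _) ((one_le_div hr0).2 hrq)
    simp only [e2, one_div_div] at hS
    refine lintegral_rpow_tsum_le_of_finset (fun k => (hfm k).pow_const _) fun J b _ => ?_
    have hJ := lintegral_sum_rpow_le (volume.restrict (Set.Ioc 0 b)) J
      (F := fun k t => f k t ^ q) (fun k => (hfm k).pow_const _) hM1
    simp only [e1, one_div_div] at hJ
    have hm1 : q / m * (m / q) = 1 := by field_simp
    calc _ = ((∫⁻ t in Set.Ioc 0 b, (∑ k ∈ J, f k t ^ q) ^ (m / q)) ^ (q / m)) ^ (m / q) := by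
          rw [← ENNReal.rpow_mul, hm1, ENNReal.rpow_one]
      _ ≤ (∑ k ∈ J, (∫⁻ t in Set.Ioc 0 b, f k t ^ m) ^ (q / m)) ^ (m / q) := by gcongr
      _ ≤ (∑ k ∈ J, C ^ (q / m) * (∫⁻ t in Set.Ioi 0, a k t ^ r) ^ (q / r)) ^ (m / q) := by
          gcongr with k _
          calc _ ≤ (C * (∫⁻ t in Set.Ioi 0, a k t ^ r) ^ (m / r)) ^ (q / m) := by
                gcongr
                exact (lintegral_mono_set Set.Ioc_subset_Ioi_self).trans (hfk k)
            _ = _ := by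
                rw [ENNReal.mul_rpow_of_nonneg _ _ (by positivity), ← ENNReal.rpow_mul]
                congr 2; field_simp
      _ ≤ (C ^ (q / m) * (∫⁻ t in Set.Ioi 0, (∑' k, a k t ^ q) ^ (r / q)) ^ (q / r)) ^ (m / q) := by
          rw [← Finset.mul_sum]
          gcongr
          exact (ENNReal.sum_le_tsum J).trans hS
      _ = _ := by
          rw [ENNReal.mul_rpow_of_nonneg _ _ (by positivity), ← ENNReal.rpow_mul,
            ← ENNReal.rpow_mul, hm1, ENNReal.rpow_one]
          congr 2; field_simp

/-! ### Fourier multipliers with Schwartz symbols on `L^p` -/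

open FourierTransform

variable {d : ℕ}

/-- The space `ℝ^d`. -/
abbrev Rd (d : ℕ) : Type := EuclideanSpace ℝ (Fin d)

/-- `L^p(ℝ^d)`. -/
abbrev LpR (d : ℕ) (p : ℝ≥0∞) := Lp ℂ p (volume : Measure (EuclideanSpace ℝ (Fin d)))

/-- The transpose of the multiplier `θ(D)` is convolution with `𝓕 θ`. The convolution of Schwartz
functions is the inverse transform of the product of the transforms; since `𝓕 𝓕 θ` is the reflection
of `θ` and `𝓕 u` that of `𝓕⁻ u`, the reflections cancel. -/
theorem fourier_smulLeft_fourierInv_apply (θ u : 𝓢(Rd d, ℂ)) (x : Rd d) :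
    𝓕 (SchwartzMap.smulLeftCLM ℂ θ (𝓕⁻ u)) x = ∫ y, 𝓕 θ (x - y) * u y := by
  have h1 : SchwartzMap.convolution (ContinuousLinearMap.mul ℂ ℂ) (𝓕 θ) u x =
      ∫ y, 𝓕 θ (x - y) * u y := by
    rw [SchwartzMap.convolution_apply, convolution_eq_swap]
    rfl
  have hinv : ∀ (f : 𝓢(Rd d, ℂ)) (z : Rd d), 𝓕⁻ f z = 𝓕 f (-z) := fun f z => by
    rw [SchwartzMap.fourierInv_apply_eq]; rfl
  rw [← h1]
  set h := SchwartzMap.smulLeftCLM ℂ θ (𝓕⁻ u) with hh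
  have hpair : SchwartzMap.pairing (ContinuousLinearMap.mul ℂ ℂ) (𝓕 (𝓕 θ)) (𝓕 u) =
      SchwartzMap.compCLMOfContinuousLinearEquiv ℂ
        (LinearIsometryEquiv.neg ℝ (E := Rd d) : Rd d ≃L[ℝ] Rd d) h := by
    ext ξ
    have e1 : 𝓕 (𝓕 θ) ξ = θ (-ξ) := by
      have := hinv (𝓕 θ) (-ξ)
      rw [neg_neg, fourierInv_fourier_eq] at this
      exact this.symm
    have e2 : 𝓕 u ξ = 𝓕⁻ u (-ξ) := by rw [hinv, neg_neg]
    simp [e1, e2, hh, SchwartzMap.smulLeftCLM_apply_apply θ.hasTemperateGrowth]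
  have hconv : SchwartzMap.convolution (ContinuousLinearMap.mul ℂ ℂ) (𝓕 θ) u =
      𝓕⁻ (SchwartzMap.pairing (ContinuousLinearMap.mul ℂ ℂ) (𝓕 (𝓕 θ)) (𝓕 u)) := rfl
  rw [hconv, hpair, hinv]
  have hn : 𝓕 (SchwartzMap.compCLMOfContinuousLinearEquiv ℂ
      (LinearIsometryEquiv.neg ℝ (E := Rd d) : Rd d ≃L[ℝ] Rd d) h) (-x) = 𝓕 h x := by
    have := Real.fourier_comp_linearIsometry (LinearIsometryEquiv.neg ℝ (E := Rd d)) (h : Rd d → ℂ) (-x)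
    simpa [SchwartzMap.fourier_coe, Function.comp_def] using this
  exact hn.symm

/-- The exponent conjugate to `p`. -/
abbrev conjExp (p : ℝ≥0∞) : ℝ≥0∞ := (1 - p⁻¹)⁻¹

section Conv

variable {p : ℝ≥0∞} [Fact (1 ≤ p)]

/-- `y ↦ ∫ κ(x - y) b(x) dx`. -/
def corr (κ : 𝓢(Rd d, ℂ)) (b : Rd d → ℂ) (y : Rd d) : ℂ := ∫ x, κ (x - y) * b x

theorem lintegral_enorm_mul_le (κ : 𝓢(Rd d, ℂ)) (b : LpR d p) (y : Rd d) :
    ∫⁻ x, ‖κ (x - y)‖ₑ * ‖b x‖ₑ ≤ eLpNorm κ (conjExp p) volume * eLpNorm b p volume := by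
  have : ENNReal.HolderConjugate p (conjExp p) :=
    ENNReal.HolderConjugate.inv_one_sub_inv' Fact.out
  have : ENNReal.HolderConjugate (conjExp p) p := ENNReal.HolderConjugate.symm
  have hm : MeasurePreserving (fun x : Rd d => x - y) volume volume :=
    measurePreserving_sub_right volume y
  have h := eLpNorm_smul_le_mul_eLpNorm (p := conjExp p) (q := p) (r := 1) (μ := volume)
    (f := (b : Rd d → ℂ)) (φ := fun x : Rd d => κ (x - y)) (Lp.aestronglyMeasurable b)
    (κ.continuous.comp (continuous_id.sub continuous_const)).aestronglyMeasurable
  have h2 := eLpNorm_comp_measurePreserving (p := conjExp p)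
    κ.continuous.aestronglyMeasurable hm
  rw [Function.comp_def] at h2
  rw [h2, eLpNorm_one_eq_lintegral_enorm] at h
  simpa [enorm_mul] using h

theorem enorm_corr_le (κ : 𝓢(Rd d, ℂ)) (b : Rd d → ℂ) (y : Rd d) :
    ‖corr κ b y‖ₑ ≤ ∫⁻ x, ‖κ (x - y)‖ₑ * ‖b x‖ₑ := by
  refine (enorm_integral_le_lintegral_enorm _).trans_eq ?_
  simp [enorm_mul]

omit [Fact (1 ≤ p)] in
theorem stronglyMeasurable_corr (κ : 𝓢(Rd d, ℂ)) (b : LpR d p) :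
    StronglyMeasurable (corr κ b) := by
  refine StronglyMeasurable.integral_prod_right'
    (f := fun z : Rd d × Rd d => κ (z.2 - z.1) * b z.2) (ν := volume) ?_
  exact (κ.continuous.comp (continuous_snd.sub continuous_fst)).stronglyMeasurable.mul
    ((Lp.stronglyMeasurable b).comp_measurable measurable_snd)

theorem eLpNorm_corr_top_le (κ : 𝓢(Rd d, ℂ)) (b : LpR d p) :
    eLpNorm (corr κ b) ⊤ volume ≤ eLpNorm κ (conjExp p) volume * eLpNorm b p volume := by
  rw [eLpNorm_exponent_top]
  exact eLpNormEssSup_le_of_ae_enorm_bound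
    (ae_of_all _ fun y => (enorm_corr_le κ b y).trans (lintegral_enorm_mul_le κ b y))

/-- Young's inequality with an `L¹` kernel: Jensen for the weight `|κ(x - y)|`, then Tonelli. For `p
= ∞` it is the Hölder bound, the conjugate exponent being `1`. -/
theorem eLpNorm_corr_le (κ : 𝓢(Rd d, ℂ)) (b : LpR d p) :
    eLpNorm (corr κ b) p volume ≤ eLpNorm κ 1 volume * eLpNorm b p volume := by
  rcases eq_or_ne p ⊤ with rfl | hp
  · have := eLpNorm_corr_top_le κ b
    simpa [conjExp] using this
  have hp1 : 1 ≤ p := Fact.out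
  have hp0 : p ≠ 0 := by positivity
  set q := p.toReal with hq
  have hq1 : 1 ≤ q := by
    rw [hq, ← ENNReal.toReal_one]; exact ENNReal.toReal_mono hp hp1
  have hq0 : 0 < q := by linarith
  have hκm : Measurable fun x : Rd d => ‖κ x‖ₑ := κ.continuous.measurable.enorm
  have hbm : Measurable fun x : Rd d => ‖b x‖ₑ := (Lp.stronglyMeasurable b).measurable.enorm
  have hk1 : ∀ y, ∫⁻ x, ‖κ (x - y)‖ₑ = eLpNorm κ 1 volume := fun y => by
    rw [eLpNorm_one_eq_lintegral_enorm]
    exact lintegral_sub_right_eq_self (fun x => ‖κ x‖ₑ) y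
  have hk2 : ∀ x, ∫⁻ y, ‖κ (x - y)‖ₑ = eLpNorm κ 1 volume := fun x => by
    rw [eLpNorm_one_eq_lintegral_enorm]
    exact lintegral_sub_left_eq_self (fun x => ‖κ x‖ₑ) x
  have hfin : eLpNorm κ 1 volume ≠ ⊤ := (κ.memLp 1 volume).2.ne
  have key : ∫⁻ y, ‖corr κ b y‖ₑ ^ q ≤ eLpNorm κ 1 volume ^ q * ∫⁻ x, ‖b x‖ₑ ^ q := by
    calc ∫⁻ y, ‖corr κ b y‖ₑ ^ q
        ≤ ∫⁻ y, eLpNorm κ 1 volume ^ (q - 1) * ∫⁻ x, ‖κ (x - y)‖ₑ * ‖b x‖ₑ ^ q := by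
          refine lintegral_mono fun y => ?_
          refine (ENNReal.rpow_le_rpow (enorm_corr_le κ b y) hq0.le).trans ?_
          rw [← hk1 y]
          exact lintegral_mul_rpow_le _ (hκm.comp (measurable_id.sub_const y)) hbm hq1
      _ = eLpNorm κ 1 volume ^ (q - 1) * ∫⁻ y, ∫⁻ x, ‖κ (x - y)‖ₑ * ‖b x‖ₑ ^ q :=
          lintegral_const_mul' _ _ (ENNReal.rpow_ne_top_of_nonneg (by linarith) hfin)
      _ = eLpNorm κ 1 volume ^ (q - 1) * ∫⁻ x, ∫⁻ y, ‖κ (x - y)‖ₑ * ‖b x‖ₑ ^ q := by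
          rw [lintegral_lintegral_swap]
          refine Measurable.aemeasurable ?_
          exact (hκm.comp (measurable_snd.sub measurable_fst)).mul
            ((hbm.comp measurable_snd).pow_const _)
      _ = eLpNorm κ 1 volume ^ (q - 1) * (eLpNorm κ 1 volume * ∫⁻ x, ‖b x‖ₑ ^ q) := by
          congr 1
          rw [← lintegral_const_mul' _ _ hfin]
          refine lintegral_congr fun x => ?_
          rw [lintegral_mul_const' _ _ (ENNReal.rpow_ne_top_of_nonneg hq0.le (by simp)), hk2]
      _ = _ := by
          rw [← mul_assoc]
          congr 1
          conv_lhs => rw [← ENNReal.rpow_one (eLpNorm κ 1 volume), ← ENNReal.rpow_mul, one_mul]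
          rw [← ENNReal.rpow_add_of_nonneg _ _ (by linarith) (by norm_num)]
          ring_nf
  rw [eLpNorm_eq_lintegral_rpow_enorm_toReal hp0 hp, eLpNorm_eq_lintegral_rpow_enorm_toReal hp0 hp]
  calc _ ≤ (eLpNorm κ 1 volume ^ q * ∫⁻ x, ‖b x‖ₑ ^ q) ^ (1 / q) := by gcongr
    _ = _ := by
      rw [ENNReal.mul_rpow_of_nonneg _ _ (by positivity), ← ENNReal.rpow_mul,
        mul_one_div_cancel hq0.ne', ENNReal.rpow_one]

theorem integral_mul_corr (κ u : 𝓢(Rd d, ℂ)) (b : LpR d p) :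
    ∫ y, u y * corr κ b y = ∫ x, (∫ y, κ (x - y) * u y) * b x := by
  have hint : Integrable (fun z : Rd d × Rd d => u z.1 * (κ (z.2 - z.1) * b z.2))
      (volume.prod volume) := by
    have hm : StronglyMeasurable (fun z : Rd d × Rd d => u z.1 * (κ (z.2 - z.1) * b z.2)) :=
      (u.continuous.comp continuous_fst).stronglyMeasurable.mul
        ((κ.continuous.comp (continuous_snd.sub continuous_fst)).stronglyMeasurable.mul
        ((Lp.stronglyMeasurable b).comp_measurable measurable_snd))
    refine ⟨hm.aestronglyMeasurable, ?_⟩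
    rw [hasFiniteIntegral_iff_enorm, lintegral_prod _ hm.measurable.enorm.aemeasurable]
    have hB : eLpNorm κ (conjExp p) volume * eLpNorm b p volume ≠ ⊤ :=
      ENNReal.mul_ne_top (κ.memLp _ volume).2.ne (Lp.memLp b).2.ne
    calc _ ≤ ∫⁻ y, ‖u y‖ₑ * (eLpNorm κ (conjExp p) volume * eLpNorm b p volume) := by
          refine lintegral_mono fun y => ?_
          simp only [enorm_mul]
          rw [lintegral_const_mul' _ _ (by simp)]
          gcongr
          exact lintegral_enorm_mul_le κ b y
      _ = (∫⁻ y, ‖u y‖ₑ) * (eLpNorm κ (conjExp p) volume * eLpNorm b p volume) :=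
          lintegral_mul_const' _ _ hB
      _ < ⊤ := by
          refine ENNReal.mul_lt_top ?_ hB.lt_top
          have := (u.memLp 1 volume).2
          rwa [eLpNorm_one_eq_lintegral_enorm] at this
  calc ∫ y, u y * corr κ b y = ∫ y, ∫ x, u y * (κ (x - y) * b x) := by
        simp only [corr, integral_const_mul]
    _ = ∫ x, ∫ y, u y * (κ (x - y) * b x) := integral_integral_swap hint
    _ = _ := by
        refine integral_congr_ae (ae_of_all _ fun x => ?_)
        simp only
        rw [← integral_mul_const]
        congr 1; ext y; ring

theorem ofLp_corr {p' : ℝ≥0∞} [Fact (1 ≤ p')] (θ : 𝓢(Rd d, ℂ)) (b : LpR d p)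
    (h : MemLp (corr (𝓕 θ) b) p' volume) :
    ofLp p' h.toLp = TemperedDistribution.fourierMultiplierCLM ℂ θ (ofLp p b) := by
  ext u
  rw [TemperedDistribution.fourierMultiplierCLM_apply_apply]
  simp only [Lp.toTemperedDistributionCLM_apply, Lp.toTemperedDistribution_apply,
    fourier_smulLeft_fourierInv_apply, smul_eq_mul]
  rw [← integral_mul_corr]
  refine integral_congr_ae ?_
  filter_upwards [h.coeFn_toLp] with y hy
  rw [hy]

/-- The `L^s` norm of the kernel of the Fourier multiplier with symbol `θ`. -/
def kerNorm (s : ℝ≥0∞) (θ : 𝓢(Rd d, ℂ)) : ℝ :=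
  (eLpNorm (𝓕 θ : 𝓢(Rd d, ℂ)) s volume).toReal

theorem exists_multiplier_Lp (θ : 𝓢(Rd d, ℂ)) (b : LpR d p) :
    ∃ c : LpR d p,
      ofLp p c = TemperedDistribution.fourierMultiplierCLM ℂ θ (ofLp p b) ∧
      ‖c‖ ≤ kerNorm 1 θ * ‖b‖ := by
  have hle := eLpNorm_corr_le (𝓕 θ) b
  have hfin : eLpNorm (𝓕 θ : 𝓢(Rd d, ℂ)) 1 volume * eLpNorm b p volume ≠ ⊤ :=
    ENNReal.mul_ne_top ((𝓕 θ).memLp 1 volume).2.ne (Lp.memLp b).2.ne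
  have h : MemLp (corr (𝓕 θ) b) p volume :=
    ⟨(stronglyMeasurable_corr _ b).aestronglyMeasurable, hle.trans_lt hfin.lt_top⟩
  refine ⟨h.toLp, ofLp_corr θ b h, ?_⟩
  rw [Lp.norm_toLp, kerNorm, Lp.norm_def, ← ENNReal.toReal_mul]
  exact ENNReal.toReal_mono hfin hle

theorem exists_multiplier_Lp_top (θ : 𝓢(Rd d, ℂ)) (b : LpR d p) :
    ∃ c : LpR d ⊤,
      ofLp ⊤ c = TemperedDistribution.fourierMultiplierCLM ℂ θ (ofLp p b) ∧
      ‖c‖ ≤ kerNorm (conjExp p) θ * ‖b‖ := by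
  have hle := eLpNorm_corr_top_le (𝓕 θ) b
  have hfin : eLpNorm (𝓕 θ : 𝓢(Rd d, ℂ)) (conjExp p) volume * eLpNorm b p volume ≠ ⊤ :=
    ENNReal.mul_ne_top ((𝓕 θ).memLp _ volume).2.ne (Lp.memLp b).2.ne
  have h : MemLp (corr (𝓕 θ) b) ⊤ volume :=
    ⟨(stronglyMeasurable_corr _ b).aestronglyMeasurable, hle.trans_lt hfin.lt_top⟩
  refine ⟨h.toLp, ofLp_corr θ b h, ?_⟩
  rw [Lp.norm_toLp, kerNorm, Lp.norm_def, ← ENNReal.toReal_mul]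
  exact ENNReal.toReal_mono hfin hle

variable {p' : ℝ≥0∞} [Fact (1 ≤ p')]

/-- Linearity in the symbol and in the function is verified for tempered distributions, into which
`L^p` embeds injectively. Linearity in the symbol will turn estimates for differences of symbols
into continuity in time. -/
theorem exists_multiplier_clm {N : 𝓢(Rd d, ℂ) → ℝ}
    (h : ∀ (θ : 𝓢(Rd d, ℂ)) (b : LpR d p),
      ∃ c : LpR d p',
        ofLp p' c = TemperedDistribution.fourierMultiplierCLM ℂ θ (ofLp p b) ∧ ‖c‖ ≤ N θ * ‖b‖)
    (hN : ∀ θ, 0 ≤ N θ) :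
    ∃ T : 𝓢(Rd d, ℂ) →ₗ[ℂ]
        (LpR d p →L[ℂ] LpR d p'),
      (∀ θ b, ofLp p' (T θ b) = TemperedDistribution.fourierMultiplierCLM ℂ θ (ofLp p b)) ∧
      ∀ θ, ‖T θ‖ ≤ N θ := by
  choose c hc hcN using h
  let T0 : 𝓢(Rd d, ℂ) → (LpR d p →L[ℂ] LpR d p') := fun θ =>
    LinearMap.mkContinuous
      { toFun := c θ
        map_add' := fun b₁ b₂ => by
          apply ofLp_injective p'
          simp only [map_add, hc]
        map_smul' := fun a b => by
          apply ofLp_injective p'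
          simp only [map_smul, hc, RingHom.id_apply] } (N θ) (hcN θ)
  have hT0 : ∀ θ b, ofLp p' (T0 θ b) = TemperedDistribution.fourierMultiplierCLM ℂ θ (ofLp p b) :=
    fun θ b => hc θ b
  refine ⟨{ toFun := T0, map_add' := fun θ₁ θ₂ => ?_, map_smul' := fun a θ => ?_ },
    hT0, fun θ => LinearMap.mkContinuous_norm_le _ (hN θ) (hcN θ)⟩
  · ext1 b
    apply ofLp_injective p'
    rw [_root_.add_apply, map_add, hT0, hT0, hT0]
    generalize ofLp p b = v
    ext u
    simp [SchwartzMap.smulLeftCLM_add θ₁.hasTemperateGrowth θ₂.hasTemperateGrowth]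
  · ext1 b
    apply ofLp_injective p'
    rw [RingHom.id_apply, _root_.smul_apply, map_smul, hT0, hT0]
    generalize ofLp p b = v
    ext u
    simp [SchwartzMap.smulLeftCLM_smul θ.hasTemperateGrowth]

/-- The Fourier multiplier with symbol `θ ∈ 𝓢` on `L^p`. -/
def mulLp (p : ℝ≥0∞) [Fact (1 ≤ p)] : 𝓢(Rd d, ℂ) →ₗ[ℂ]
    (LpR d p →L[ℂ] LpR d p) :=
  (exists_multiplier_clm (p := p) exists_multiplier_Lp fun _ => ENNReal.toReal_nonneg).choose

theorem ofLp_mulLp (θ : 𝓢(Rd d, ℂ)) (b : LpR d p) :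
    ofLp p (mulLp p θ b) = TemperedDistribution.fourierMultiplierCLM ℂ θ (ofLp p b) :=
  (exists_multiplier_clm (p := p) exists_multiplier_Lp fun _ => ENNReal.toReal_nonneg).choose_spec.1 θ b

theorem norm_mulLp_le (θ : 𝓢(Rd d, ℂ)) : ‖mulLp p θ‖ ≤ kerNorm 1 θ :=
  (exists_multiplier_clm (p := p) exists_multiplier_Lp fun _ => ENNReal.toReal_nonneg).choose_spec.2 θ

/-- The Fourier multiplier with symbol `θ ∈ 𝓢` from `L^p` to `L^∞`. -/
def mulLpTop (p : ℝ≥0∞) [Fact (1 ≤ p)] : 𝓢(Rd d, ℂ) →ₗ[ℂ]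
    (LpR d p →L[ℂ] LpR d ⊤) :=
  (exists_multiplier_clm (p := p) exists_multiplier_Lp_top fun _ => ENNReal.toReal_nonneg).choose

theorem ofLp_mulLpTop (θ : 𝓢(Rd d, ℂ)) (b : LpR d p) :
    ofLp ⊤ (mulLpTop p θ b) = TemperedDistribution.fourierMultiplierCLM ℂ θ (ofLp p b) :=
  (exists_multiplier_clm (p := p) exists_multiplier_Lp_top
    fun _ => ENNReal.toReal_nonneg).choose_spec.1 θ b

theorem norm_mulLpTop_le (θ : 𝓢(Rd d, ℂ)) : ‖mulLpTop p θ‖ ≤ kerNorm (conjExp p) θ :=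
  (exists_multiplier_clm (p := p) exists_multiplier_Lp_top
    fun _ => ENNReal.toReal_nonneg).choose_spec.2 θ

end Conv

/-! ### The heat kernel localised to an annulus -/

/-- A smooth function on `ℝ^d` supported in the annulus `1/8 ≤ |ξ| ≤ 8`. -/
structure AnnulusSymbol (d : ℕ) where
  χ : EuclideanSpace ℝ (Fin d) → ℝ
  contDiff : ContDiff ℝ ∞ χ
  support : ∀ ξ, χ ξ ≠ 0 → 1 / 8 ≤ ‖ξ‖ ∧ ‖ξ‖ ≤ 8

namespace AnnulusSymbol

variable (B : AnnulusSymbol d)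

theorem contDiff_rescale : ContDiff ℝ ∞ fun x => B.χ ((2 * Real.pi) • x) :=
  B.contDiff.comp (contDiff_const_smul _)

theorem norm_of_mem_tsupport {x : Rd d} (hx : x ∈ tsupport fun x => B.χ ((2 * Real.pi) • x)) :
    1 / 8 ≤ ‖(2 * Real.pi) • x‖ ∧ ‖(2 * Real.pi) • x‖ ≤ 8 := by
  have hc : IsClosed {x : Rd d | 1 / 8 ≤ ‖(2 * Real.pi) • x‖ ∧ ‖(2 * Real.pi) • x‖ ≤ 8} :=
    isClosed_Icc.preimage (f := fun x : Rd d => ‖(2 * Real.pi) • x‖) (by fun_prop)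
  exact closure_minimal (fun y hy => B.support _ hy) hc hx

theorem tsupport_subset_closedBall :
    tsupport (fun x => B.χ ((2 * Real.pi) • x)) ⊆ Metric.closedBall (0 : Rd d) 8 := by
  intro x hx
  have h := (B.norm_of_mem_tsupport hx).2
  rw [norm_smul, Real.norm_of_nonneg (by positivity)] at h
  have := Real.two_le_pi
  rw [mem_closedBall_zero_iff]
  nlinarith [norm_nonneg x]

theorem hasCompactSupport_rescale : HasCompactSupport fun x => B.χ ((2 * Real.pi) • x) :=
  HasCompactSupport.of_support_subset_isCompact (isCompact_closedBall (0 : Rd d) 8)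
    ((subset_tsupport _).trans B.tsupport_subset_closedBall)

theorem contDiff_normSq : ContDiff ℝ ∞ fun x : Rd d => ‖(2 * Real.pi) • x‖ ^ 2 :=
  (contDiff_norm_sq ℝ).comp (contDiff_const_smul _)

theorem hasCompactSupport_smul (g : ℝ → ℝ) : HasCompactSupport fun x : Rd d =>
    g (‖(2 * Real.pi) • x‖ ^ 2) • ((B.χ ((2 * Real.pi) • x) : ℝ) : ℂ) := by
  refine HasCompactSupport.of_support_subset_isCompact B.hasCompactSupport_rescale fun x hx => ?_
  refine subset_tsupport _ fun h0 => hx ?_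
  have h0' : B.χ ((2 * Real.pi) • x) = 0 := h0
  simp only [h0', Complex.ofReal_zero, smul_zero]

theorem contDiff_smul {g : ℝ → ℝ} (hg : ContDiff ℝ ∞ g) : ContDiff ℝ ∞ fun x : Rd d =>
    g (‖(2 * Real.pi) • x‖ ^ 2) • ((B.χ ((2 * Real.pi) • x) : ℝ) : ℂ) :=
  ContDiff.smul (hg.comp contDiff_normSq) (Complex.ofRealCLM.contDiff.comp B.contDiff_rescale)

/-- The Schwartz function `x ↦ χ(2πx) g(|2πx|²)`. -/
def symb (g : ℝ → ℝ) (hg : ContDiff ℝ ∞ g) : 𝓢(Rd d, ℂ) :=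
  HasCompactSupport.toSchwartzMap (B.hasCompactSupport_smul g) (B.contDiff_smul hg)

theorem symb_apply (g : ℝ → ℝ) (hg : ContDiff ℝ ∞ g) (x : Rd d) :
    B.symb g hg x = g (‖(2 * Real.pi) • x‖ ^ 2) • ((B.χ ((2 * Real.pi) • x) : ℝ) : ℂ) := rfl

theorem exists_bound_iteratedFDeriv {F : Type*} [NormedAddCommGroup F] [NormedSpace ℝ F]
    {f : Rd d → F} (hf : ContDiff ℝ ∞ f) (n : ℕ) :
    ∃ M, 1 ≤ M ∧ ∀ i ≤ n, ∀ x ∈ Metric.closedBall (0 : Rd d) 8, ‖iteratedFDeriv ℝ i f x‖ ≤ M := by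
  have h : ∀ i : ℕ, ∃ M, 0 ≤ M ∧
      ∀ x ∈ Metric.closedBall (0 : Rd d) 8, ‖iteratedFDeriv ℝ i f x‖ ≤ M := fun i => by
    obtain ⟨M, hM⟩ := (isCompact_closedBall (0 : Rd d) 8).exists_bound_of_continuousOn
      (hf.continuous_iteratedFDeriv (m := i) (mod_cast le_top)).continuousOn
    exact ⟨max M 0, le_max_right _ _, fun x hx => (hM x hx).trans (le_max_left _ _)⟩
  choose M hM0 hM using h
  refine ⟨1 + ∑ i ∈ Finset.range (n + 1), M i,
    le_add_of_nonneg_right (Finset.sum_nonneg fun i _ => hM0 i), fun i hi x hx => ?_⟩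
  refine (hM i x hx).trans ?_
  have := Finset.single_le_sum (f := M) (fun i _ => hM0 i) (Finset.mem_range.2 (Nat.lt_succ_of_le hi))
  linarith

/-- On the support of `χ` the argument `|2πx|²` of `g` stays in `[1/64, 64]`, so by the Leibniz and
chain rules only the derivatives of `g` on this interval enter, with constants independent of `g`.
-/
theorem exists_seminorm_symb_le (k n : ℕ) :
    ∃ K, 0 ≤ K ∧ ∀ (g : ℝ → ℝ) (hg : ContDiff ℝ ∞ g) (C : ℝ), 0 ≤ C →
      (∀ i ≤ n, ∀ y ∈ Set.Icc (1 / 64 : ℝ) 64, ‖iteratedFDeriv ℝ i g y‖ ≤ C) →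
      SchwartzMap.seminorm ℂ k n (B.symb g hg) ≤ K * C := by
  obtain ⟨D, hD1, hD⟩ := exists_bound_iteratedFDeriv (contDiff_normSq (d := d)) n
  have hχ : ContDiff ℝ ∞ fun x => ((B.χ ((2 * Real.pi) • x) : ℝ) : ℂ) :=
    Complex.ofRealCLM.contDiff.comp B.contDiff_rescale
  obtain ⟨M, hM1, hM⟩ := exists_bound_iteratedFDeriv hχ n
  refine ⟨8 ^ k * ∑ i ∈ Finset.range (n + 1), (n.choose i : ℝ) * (i.factorial * D ^ i) * M,
    by positivity, fun g hg C hC hgC => ?_⟩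
  refine SchwartzMap.seminorm_le_bound ℂ k n _ (by positivity) fun x => ?_
  by_cases hx : x ∈ tsupport fun x => B.χ ((2 * Real.pi) • x)
  · have hxb := B.tsupport_subset_closedBall hx
    obtain ⟨h1, h2⟩ := B.norm_of_mem_tsupport hx
    have hy : ‖(2 * Real.pi) • x‖ ^ 2 ∈ Set.Icc (1 / 64 : ℝ) 64 :=
      ⟨by nlinarith, by nlinarith [norm_nonneg ((2 * Real.pi) • x)]⟩
    have hx8 : ‖x‖ ≤ 8 := by simpa using hxb
    rw [mul_assoc]
    refine mul_le_mul (by gcongr) ?_ (norm_nonneg _) (by positivity)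
    have hL := norm_iteratedFDeriv_smul_le (𝕜 := ℝ) (hg.comp (contDiff_normSq (d := d))) hχ x
      (n := n) (mod_cast le_top)
    refine hL.trans ?_
    rw [Finset.sum_mul]
    refine Finset.sum_le_sum fun i hi => ?_
    have hin : i ≤ n := Nat.lt_succ_iff.1 (Finset.mem_range.1 hi)
    have hcomp : ‖iteratedFDeriv ℝ i (g ∘ fun x : Rd d => ‖(2 * Real.pi) • x‖ ^ 2) x‖ ≤
        i.factorial * C * D ^ i := by
      refine norm_iteratedFDeriv_comp_le hg contDiff_normSq (mod_cast le_top) x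
        (fun j hj => hgC j (hj.trans hin) _ hy) fun j hj1 hj => ?_
      exact (hD j (hj.trans hin) x hxb).trans (le_self_pow₀ hD1 (by omega))
    calc _ ≤ (n.choose i : ℝ) * (i.factorial * C * D ^ i) * M := by
          gcongr
          exact hM _ (Nat.sub_le _ _) x hxb
      _ = _ := by ring
  · have : iteratedFDeriv ℝ n (B.symb g hg) x = 0 := by
      refine image_eq_zero_of_notMem_tsupport fun hmem => hx ?_
      refine closure_mono ?_ ((tsupport_iteratedFDeriv_subset n) hmem)
      intro z hz h0
      apply hz
      have h0' : B.χ ((2 * Real.pi) • z) = 0 := h0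
      rw [symb_apply, h0']
      simp
    rw [this, norm_zero, mul_zero]
    positivity

/-- The `L^s` norm of the Fourier transform is a continuous seminorm on the Schwartz space, hence
dominated by finitely many of the defining seminorms. -/
theorem exists_kerNorm_symb_le (s : ℝ≥0∞) [Fact (1 ≤ s)] :
    ∃ (n : ℕ) (K : ℝ), 0 ≤ K ∧ ∀ (g : ℝ → ℝ) (hg : ContDiff ℝ ∞ g) (C : ℝ), 0 ≤ C →
      (∀ i ≤ n, ∀ y ∈ Set.Icc (1 / 64 : ℝ) 64, ‖iteratedFDeriv ℝ i g y‖ ≤ C) →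
      kerNorm s (B.symb g hg) ≤ K * C := by
  let A : 𝓢(Rd d, ℂ) →L[ℂ] LpR d s :=
    SchwartzMap.toLpCLM ℂ ℂ s volume ∘L fourierCLM ℂ 𝓢(Rd d, ℂ)
  let P : Seminorm ℂ 𝓢(Rd d, ℂ) := (normSeminorm ℂ (LpR d s)).comp A.toLinearMap
  have hP : ∀ θ, P θ = kerNorm s θ := fun θ => by
    simp [P, A, kerNorm, SchwartzMap.norm_toLp]
  have hPc : Continuous P := continuous_norm.comp A.continuous
  obtain ⟨J, c, -, hJ⟩ := Seminorm.bound_of_continuous (schwartz_withSeminorms ℂ (Rd d) ℂ) P hPc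
  choose K hK0 hK using B.exists_seminorm_symb_le
  refine ⟨J.sup Prod.snd, c * ∑ j ∈ J, K j.1 j.2,
    mul_nonneg c.2 (Finset.sum_nonneg fun j _ => hK0 _ _), fun g hg C hC h => ?_⟩
  rw [← hP]
  refine (hJ _).trans ?_
  rw [mul_assoc]
  change (c : ℝ) * _ ≤ _
  gcongr
  rw [Finset.sum_mul]
  refine Seminorm.finset_sup_apply_le
    (Finset.sum_nonneg fun j _ => mul_nonneg (hK0 _ _) hC) fun j hj => ?_
  refine (hK j.1 j.2 g hg C hC fun i hi => h i (hi.trans (Finset.le_sup (f := Prod.snd) hj))).trans ?_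
  exact Finset.single_le_sum (f := fun j : ℕ × ℕ => K j.1 j.2 * C)
    (fun j _ => mul_nonneg (hK0 _ _) hC) hj

theorem contDiff_exp_mul (t : ℝ) : ContDiff ℝ ∞ fun y : ℝ => Real.exp (-t * y) := by fun_prop

/-- The Schwartz function `x ↦ χ(2πx) e^{-t|2πx|²}`. -/
def heatUnit (t : ℝ) : 𝓢(Rd d, ℂ) := B.symb _ (contDiff_exp_mul t)

theorem iteratedFDeriv_exp_mul_norm (t y : ℝ) (i : ℕ) :
    ‖iteratedFDeriv ℝ i (fun y : ℝ => Real.exp (-t * y)) y‖ = |t| ^ i * Real.exp (-t * y) := by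
  rw [norm_iteratedFDeriv_eq_norm_iteratedDeriv, iteratedDeriv_exp_const_mul]
  simp

theorem exists_kerNorm_heatUnit_le (s : ℝ≥0∞) [Fact (1 ≤ s)] :
    ∃ K, 0 ≤ K ∧ ∀ t, 0 ≤ t → kerNorm s (B.heatUnit t) ≤ K * Real.exp (-(1 / 128) * t) := by
  obtain ⟨n, K, hK, h⟩ := B.exists_kerNorm_symb_le s
  refine ⟨K * (n.factorial * 128 ^ n), by positivity, fun t ht => ?_⟩
  rw [mul_assoc]
  refine h _ _ _ (by positivity) fun i hi y hy => ?_
  rw [iteratedFDeriv_exp_mul_norm, abs_of_nonneg ht]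
  have h1 : (t / 128) ^ i ≤ i.factorial * Real.exp (t / 128) := by
    have := Real.pow_div_factorial_le_exp (t / 128) (by positivity) i
    rwa [div_le_iff₀' (by positivity)] at this
  -- Since `y ≥ 1/64`, the decay is at least `e^{-t/64}`. One half of the rate absorbs the factor
  -- `t^i` from the derivatives; the other half remains.
  have h2 : Real.exp (-t * y) ≤ Real.exp (-(t / 128)) * Real.exp (-(1 / 128) * t) := by
    rw [← Real.exp_add]
    apply Real.exp_le_exp.2
    nlinarith [hy.1]
  have hfac : (i.factorial : ℝ) ≤ n.factorial := by exact_mod_cast Nat.factorial_le hi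
  have hpow : (128 : ℝ) ^ i ≤ 128 ^ n := pow_le_pow_right₀ (by norm_num) hi
  calc t ^ i * Real.exp (-t * y) = 128 ^ i * (t / 128) ^ i * Real.exp (-t * y) := by
        rw [← mul_pow, mul_div_cancel₀ _ (by norm_num)]
    _ ≤ 128 ^ n * (n.factorial * Real.exp (t / 128)) *
        (Real.exp (-(t / 128)) * Real.exp (-(1 / 128) * t)) := by
        gcongr
        exact h1.trans (by gcongr)
    _ = n.factorial * 128 ^ n * Real.exp (-(1 / 128) * t) *
        (Real.exp (t / 128) * Real.exp (-(t / 128))) := by ring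
    _ = _ := by rw [← Real.exp_add]; simp

theorem heatUnit_sub (t t' : ℝ) :
    B.heatUnit t - B.heatUnit t' =
      B.symb (fun y => Real.exp (-t * y) - Real.exp (-t' * y))
        ((contDiff_exp_mul t).sub (contDiff_exp_mul t')) := by
  ext x
  simp only [heatUnit, symb_apply, _root_.sub_apply, sub_smul]

theorem iteratedFDeriv_exp_sub (t t' y : ℝ) (i : ℕ) :
    ‖iteratedFDeriv ℝ i (fun y : ℝ => Real.exp (-t * y) - Real.exp (-t' * y)) y‖ =
      ‖(-t) ^ i * Real.exp (-t * y) - (-t') ^ i * Real.exp (-t' * y)‖ := by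
  rw [norm_iteratedFDeriv_eq_norm_iteratedDeriv]
  have : iteratedDeriv i (fun y : ℝ => Real.exp (-t * y) - Real.exp (-t' * y)) y =
      iteratedDeriv i (fun y : ℝ => Real.exp (-t * y)) y -
        iteratedDeriv i (fun y : ℝ => Real.exp (-t' * y)) y :=
    iteratedDeriv_fun_sub ((contDiff_exp_mul t).of_le (mod_cast le_top)).contDiffAt
      ((contDiff_exp_mul t').of_le (mod_cast le_top)).contDiffAt
  rw [this, iteratedDeriv_exp_const_mul, iteratedDeriv_exp_const_mul]

/-- The `y`-derivatives of `e^{-ty}` depend continuously on `t`, uniformly for `y` in the compact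
interval; this is the continuity of a curried map. It yields norm continuity of the localised heat
operators, hence measurability of the Duhamel integrands. -/
theorem tendsto_kerNorm_heatUnit_sub (s : ℝ≥0∞) [Fact (1 ≤ s)] (t₀ : ℝ) :
    Tendsto (fun t => kerNorm s (B.heatUnit t - B.heatUnit t₀)) (𝓝 t₀) (𝓝 0) := by
  obtain ⟨n, K, hK, h⟩ := B.exists_kerNorm_symb_le s
  let F : ℕ → C(ℝ, C(Set.Icc (1 / 64 : ℝ) 64, ℝ)) := fun i =>
    ContinuousMap.curry ⟨fun z => (-z.1) ^ i * Real.exp (-z.1 * z.2), by fun_prop⟩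
  have hF : ∀ i, Tendsto (fun t => ‖F i t - F i t₀‖) (𝓝 t₀) (𝓝 0) := fun i => by
    have : Tendsto (F i) (𝓝 t₀) (𝓝 (F i t₀)) := (F i).continuous.tendsto t₀
    simpa using (this.sub_const (F i t₀)).norm
  have hsum : Tendsto (fun t => K * ∑ i ∈ Finset.range (n + 1), ‖F i t - F i t₀‖) (𝓝 t₀) (𝓝 0) := by
    have := (tendsto_finsetSum (Finset.range (n + 1)) fun i _ => hF i).const_mul K
    simpa using this
  refine squeeze_zero (fun _ => ENNReal.toReal_nonneg) (fun t => ?_) hsum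
  rw [heatUnit_sub]
  refine h _ _ _ (Finset.sum_nonneg fun _ _ => norm_nonneg _) fun i hi y hy => ?_
  rw [iteratedFDeriv_exp_sub]
  refine (ContinuousMap.norm_coe_le_norm (F i t - F i t₀) ⟨y, hy⟩).trans ?_
  exact Finset.single_le_sum (f := fun i => ‖F i t - F i t₀‖) (fun _ _ => norm_nonneg _)
    (Finset.mem_range.2 (Nat.lt_succ_of_le hi))

end AnnulusSymbol

/-! ### Dilation to frequency `2^k` -/

/-- The dilation `θ ↦ θ(2^{-k} ·)` of Schwartz functions. -/
def dil (k : ℤ) : 𝓢(Rd d, ℂ) →L[ℂ] 𝓢(Rd d, ℂ) :=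
  SchwartzMap.compCLMOfContinuousLinearEquiv ℂ
    (ContinuousLinearEquiv.smulLeft (Units.mk0 ((2 : ℝ) ^ (-k)) (by positivity)))

theorem dil_apply (k : ℤ) (θ : 𝓢(Rd d, ℂ)) (x : Rd d) : dil k θ x = θ ((2 : ℝ) ^ (-k) • x) := rfl

theorem fourier_dil_apply (k : ℤ) (θ : 𝓢(Rd d, ℂ)) (x : Rd d) :
    𝓕 (dil k θ) x = ((2 : ℝ) ^ k) ^ d • 𝓕 θ ((2 : ℝ) ^ k • x) := by
  rw [SchwartzMap.fourier_coe, SchwartzMap.fourier_coe, Real.fourier_eq, Real.fourier_eq]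
  have h := Measure.integral_comp_smul (volume : Measure (Rd d))
    (fun v => Real.fourierChar (-inner ℝ v ((2 : ℝ) ^ k • x)) • θ v) ((2 : ℝ) ^ (-k))
  have h2 : ∀ v : Rd d, inner ℝ ((2 : ℝ) ^ (-k) • v) ((2 : ℝ) ^ k • x) = inner ℝ v x := fun v => by
    rw [real_inner_smul_left, real_inner_smul_right, ← mul_assoc, ← zpow_add₀ (by norm_num)]
    simp
  simp only [h2] at h
  simp only [dil_apply]
  rw [h, finrank_euclideanSpace_fin, abs_of_pos (by positivity), zpow_neg, inv_pow, inv_inv]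

/-- The kernel becomes `2^{kd} κ(2^k ·)`. Its `L¹` norm is invariant, which gives bounds on `L^p`
uniform in `k`; in the conjugate exponent of `p` it scales by `2^{kd/p}`, the Bernstein factor from
`L^p` to `L^∞`. -/
theorem kerNorm_dil (s : ℝ≥0∞) (k : ℤ) (θ : 𝓢(Rd d, ℂ)) :
    kerNorm s (dil k θ) = (((2 : ℝ) ^ k) ^ d) ^ (1 - (s⁻¹).toReal) * kerNorm s θ := by
  set c : ℝ := (2 : ℝ) ^ k with hc
  have hc0 : 0 < c := by positivity
  have h1 : ((𝓕 (dil k θ) : 𝓢(Rd d, ℂ)) : Rd d → ℂ) =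
      (c ^ d) • ((𝓕 θ : 𝓢(Rd d, ℂ)) ∘ fun x => c • x) := by
    ext x
    exact fourier_dil_apply k θ x
  have hm : AEMeasurable (fun x : Rd d => c • x) volume := (measurable_const_smul c).aemeasurable
  have hmap : Measure.map (fun x : Rd d => c • x) volume =
      ENNReal.ofReal ((c ^ d)⁻¹) • (volume : Measure (Rd d)) := by
    have := Measure.map_addHaar_smul (volume : Measure (Rd d)) hc0.ne'
    rwa [finrank_euclideanSpace_fin, abs_of_pos (by positivity)] at this
  rw [kerNorm, h1, eLpNorm_const_smul,
    ← eLpNorm_map_measure (SchwartzMap.continuous _).aestronglyMeasurable hm, hmap,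
    eLpNorm_smul_measure_of_ne_zero (by simp; positivity)]
  rw [smul_eq_mul, ENNReal.toReal_mul, ENNReal.toReal_mul, ← mul_assoc, kerNorm]
  congr 1
  rw [toReal_enorm, Real.norm_of_nonneg (by positivity), ← ENNReal.toReal_rpow,
    ENNReal.toReal_ofReal (by positivity), Real.inv_rpow (by positivity),
    Real.rpow_sub (by positivity), Real.rpow_one, one_div]
  rfl

theorem kerNorm_one_dil (k : ℤ) (θ : 𝓢(Rd d, ℂ)) : kerNorm 1 (dil k θ) = kerNorm 1 θ := by
  rw [kerNorm_dil]; simp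

theorem kerNorm_conjExp_dil (p : ℝ≥0∞) [Fact (1 ≤ p)] (k : ℤ) (θ : 𝓢(Rd d, ℂ)) :
    kerNorm (conjExp p) (dil k θ) =
      (2 : ℝ) ^ ((k : ℝ) * (d * (p⁻¹).toReal)) * kerNorm (conjExp p) θ := by
  have hp : p⁻¹ ≤ 1 := ENNReal.inv_le_one.2 Fact.out
  rw [kerNorm_dil, conjExp, inv_inv, ENNReal.toReal_sub_of_le hp (by simp), ENNReal.toReal_one,
    sub_sub_cancel]
  congr 1
  rw [← Real.rpow_intCast, ← Real.rpow_natCast, ← Real.rpow_mul (by positivity),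
    ← Real.rpow_mul (by norm_num)]

instance (p : ℝ≥0∞) : Fact (1 ≤ conjExp p) := by
  simp [fact_iff]

namespace AnnulusSymbol

variable (B : AnnulusSymbol d)

/-- The Schwartz function `x ↦ χ(2^{-k} 2πx) e^{-t|2πx|²}`. -/
def heatSymb (k : ℤ) (t : ℝ) : 𝓢(Rd d, ℂ) := dil k (B.heatUnit ((4 : ℝ) ^ k * t))

theorem heatSymb_apply (k : ℤ) (t : ℝ) (x : Rd d) :
    B.heatSymb k t x = ((B.χ ((2 : ℝ) ^ (-k) • (2 * Real.pi) • x) *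
      Real.exp (-t * ‖(2 * Real.pi) • x‖ ^ 2) : ℝ) : ℂ) := by
  rw [heatSymb, dil_apply, heatUnit, symb_apply, smul_comm (2 * Real.pi), Complex.real_smul,
    ← Complex.ofReal_mul, mul_comm]
  congr 3
  rw [norm_smul, Real.norm_of_nonneg (by positivity), mul_pow]
  have h4 : (4 : ℝ) ^ k * ((2 : ℝ) ^ (-k)) ^ 2 = 1 := by
    rw [show (4 : ℝ) = 2 * 2 by norm_num, mul_zpow, zpow_neg]
    field_simp
  linear_combination (-t * ‖(2 * Real.pi) • x‖ ^ 2) * h4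

theorem fourierMultiplierCLM_heatSymb (k : ℤ) (t : ℝ) :
    TemperedDistribution.fourierMultiplierCLM ℂ (B.heatSymb k t) =
      multiplier fun ξ => B.χ ((2 : ℝ) ^ (-k) • ξ) * Real.exp (-t * ‖ξ‖ ^ 2) := by
  rw [multiplier]
  congr 1
  ext x
  exact B.heatSymb_apply k t x

variable (p : ℝ≥0∞) [Fact (1 ≤ p)]

theorem exists_norm_mulLp_heatSymb_le :
    ∃ K : ℝ, 0 ≤ K ∧ ∀ (k : ℤ) (t : ℝ), 0 ≤ t →
      ‖mulLp p (B.heatSymb k t)‖ ≤ K * Real.exp (-(1 / 128 * 4 ^ k) * t) := by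
  obtain ⟨K, hK, h⟩ := B.exists_kerNorm_heatUnit_le 1
  refine ⟨K, hK, fun k t ht => (norm_mulLp_le _).trans ?_⟩
  rw [heatSymb, kerNorm_one_dil]
  refine (h _ (by positivity)).trans_eq ?_
  ring_nf

theorem exists_norm_mulLpTop_heatSymb_le :
    ∃ K : ℝ, 0 ≤ K ∧ ∀ (k : ℤ) (t : ℝ), 0 ≤ t →
      ‖mulLpTop p (B.heatSymb k t)‖ ≤ K * (2 : ℝ) ^ ((k : ℝ) * (d * (p⁻¹).toReal)) := by
  obtain ⟨K, hK, h⟩ := B.exists_kerNorm_heatUnit_le (conjExp p)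
  refine ⟨K, hK, fun k t ht => (norm_mulLpTop_le _).trans ?_⟩
  rw [heatSymb, kerNorm_conjExp_dil, mul_comm]
  gcongr
  refine (h _ (by positivity)).trans (mul_le_of_le_one_right hK ?_)
  rw [Real.exp_le_one_iff]
  have : 0 ≤ (4 : ℝ) ^ k * t := by positivity
  linarith

theorem continuous_of_norm_sub_le {E : Type*} [NormedAddCommGroup E] {s : ℝ≥0∞}
    [Fact (1 ≤ s)] {A : 𝓢(Rd d, ℂ) → E}
    (hA : ∀ θ θ', ‖A θ - A θ'‖ ≤ kerNorm s (θ - θ')) (k : ℤ) :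
    Continuous fun t => A (B.heatSymb k t) := by
  have h : Continuous fun u => A (dil k (B.heatUnit u)) := by
    rw [continuous_iff_continuousAt]
    intro t
    rw [ContinuousAt, tendsto_iff_norm_sub_tendsto_zero]
    have := (B.tendsto_kerNorm_heatUnit_sub s t).const_mul
      ((((2 : ℝ) ^ k) ^ d) ^ (1 - (s⁻¹).toReal))
    rw [mul_zero] at this
    refine squeeze_zero (fun _ => norm_nonneg _) (fun u => ?_) this
    refine (hA _ _).trans_eq ?_
    rw [← map_sub, kerNorm_dil]
  exact h.comp (continuous_const_mul _)

theorem continuous_mulLp_heatSymb (k : ℤ) : Continuous fun t => mulLp p (B.heatSymb k t) :=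
  B.continuous_of_norm_sub_le (s := 1) (fun θ θ' => by rw [← map_sub]; exact norm_mulLp_le _) k

theorem continuous_mulLpTop_heatSymb (k : ℤ) : Continuous fun t => mulLpTop p (B.heatSymb k t) :=
  B.continuous_of_norm_sub_le (s := conjExp p)
    (fun θ θ' => by rw [← map_sub]; exact norm_mulLpTop_le _) k

end AnnulusSymbol

/-! ### Calculus of multipliers on tempered distributions -/

section Multiplier

/-- Symbols whose Fourier multiplier acts on tempered distributions. -/
def IsSymbol (m : Rd d → ℝ) : Prop :=
  Function.HasTemperateGrowth fun ξ : Rd d => ((m ((2 * Real.pi) • ξ) : ℝ) : ℂ)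

theorem _root_.Function.HasTemperateGrowth.isSymbol {m : Rd d → ℝ} (hm : m.HasTemperateGrowth) :
    IsSymbol m := by
  have h : Function.HasTemperateGrowth fun ξ : Rd d => (2 * Real.pi) • ξ :=
    ((2 * Real.pi) • ContinuousLinearMap.id ℝ (Rd d)).hasTemperateGrowth
  exact Function.Complex.hasTemperateGrowth_ofReal.comp (hm.comp h)

theorem hasTemperateGrowth_of_support {m : Rd d → ℝ} (hm : ContDiff ℝ ∞ m) {R : ℝ}
    (hR : ∀ ξ, m ξ ≠ 0 → ‖ξ‖ ≤ R) : m.HasTemperateGrowth := by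
  refine HasCompactSupport.hasTemperateGrowth ?_ hm
  exact HasCompactSupport.of_support_subset_isCompact (isCompact_closedBall (0 : Rd d) R)
    fun ξ hξ => by simpa using hR ξ hξ

theorem hasTemperateGrowth_comp_smul {m : Rd d → ℝ} (hm : m.HasTemperateGrowth) (c : ℝ) :
    (fun ξ => m (c • ξ)).HasTemperateGrowth :=
  hm.comp (c • ContinuousLinearMap.id ℝ (Rd d)).hasTemperateGrowth

theorem hasTemperateGrowth_heat {t : ℝ} (ht : 0 ≤ t) :
    Function.HasTemperateGrowth fun ξ : Rd d => Real.exp (-t * ‖ξ‖ ^ 2) := by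
  -- The exponential does not have temperate growth on the whole line. An open half-line containing
  -- the values of `|ξ|²` is enough, and there all its derivatives are bounded.
  have hr : Set.range (fun ξ : Rd d => ‖ξ‖ ^ 2) ⊆ Set.Ioi (-1 : ℝ) := by
    rintro - ⟨ξ, rfl⟩
    have := sq_nonneg ‖ξ‖
    simp only [Set.mem_Ioi]
    linarith
  refine Function.HasTemperateGrowth.comp' (g := fun y : ℝ => Real.exp (-t * y)) hr
    isOpen_Ioi.uniqueDiffOn (AnnulusSymbol.contDiff_exp_mul t).contDiffOn (fun N => ?_)
    (Function.hasTemperateGrowth_norm_sq (Rd d))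
  refine ⟨0, (1 + t) ^ N * Real.exp t, by positivity, fun n hn y hy => ?_⟩
  rw [iteratedFDerivWithin_of_isOpen n isOpen_Ioi hy, AnnulusSymbol.iteratedFDeriv_exp_mul_norm,
    abs_of_nonneg ht, pow_zero, mul_one]
  have hy' : -1 < y := hy
  gcongr ?_ * Real.exp ?_
  · calc t ^ n ≤ (1 + t) ^ n := by gcongr; linarith
      _ ≤ (1 + t) ^ N := pow_le_pow_right₀ (by linarith) hn
  · nlinarith

theorem multiplier_multiplier {m₁ m₂ : Rd d → ℝ} (h₁ : IsSymbol m₁) (h₂ : IsSymbol m₂)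
    (u : 𝓢'(Rd d, ℂ)) :
    multiplier m₁ (multiplier m₂ u) = multiplier (fun ξ => m₁ ξ * m₂ ξ) u := by
  rw [multiplier, multiplier,
    TemperedDistribution.fourierMultiplierCLM_fourierMultiplierCLM_apply h₂ h₁, multiplier]
  congr 2
  ext ξ
  simp [mul_comm]

theorem multiplier_add {m₁ m₂ : Rd d → ℝ} (h₁ : IsSymbol m₁) (h₂ : IsSymbol m₂)
    (u : 𝓢'(Rd d, ℂ)) :
    multiplier (fun ξ => m₁ ξ + m₂ ξ) u = multiplier m₁ u + multiplier m₂ u := by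
  ext χ
  simp only [multiplier, _root_.add_apply,
    TemperedDistribution.fourierMultiplierCLM_apply_apply]
  rw [← map_add, ← FourierTransform.fourier_add]
  congr 2
  have : (fun ξ : Rd d => ((m₁ ((2 * Real.pi) • ξ) + m₂ ((2 * Real.pi) • ξ) : ℝ) : ℂ)) =
      (fun ξ : Rd d => ((m₁ ((2 * Real.pi) • ξ) : ℝ) : ℂ)) +
        fun ξ : Rd d => ((m₂ ((2 * Real.pi) • ξ) : ℝ) : ℂ) := by
    ext ξ; simp
  rw [this, SchwartzMap.smulLeftCLM_add h₁ h₂]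
  rfl

/-- The transpose of `multiplier m`, acting on Schwartz functions. -/
def dualMultiplier (m : Rd d → ℝ) : 𝓢(Rd d, ℂ) →L[ℂ] 𝓢(Rd d, ℂ) :=
  fourierCLM ℂ 𝓢(Rd d, ℂ) ∘L
    SchwartzMap.smulLeftCLM ℂ (fun ξ => ((m ((2 * Real.pi) • ξ) : ℝ) : ℂ)) ∘L
      fourierInvCLM ℂ 𝓢(Rd d, ℂ)

theorem multiplier_apply_apply (m : Rd d → ℝ) (u : 𝓢'(Rd d, ℂ)) (χ : 𝓢(Rd d, ℂ)) :
    multiplier m u χ = u (dualMultiplier m χ) := rfl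

end Multiplier

/-! ### The Littlewood-Paley decomposition -/

namespace LittlewoodPaley

variable (L : LittlewoodPaley d)

/-- The series of the partition at `ξ/2` is the one at `ξ` without its term `k = 0`. This is what
makes `S_{k+1} - S_k = Δ_k` telescope. -/
theorem ψ_half_sub_ψ (ξ : Rd d) : L.ψ ((2 : ℝ)⁻¹ • ξ) - L.ψ ξ = L.φ ξ := by
  have h1 := L.partition ((2 : ℝ)⁻¹ • ξ)
  have h2 := (hasSum_nat_add_iff' 1).2 (L.partition ξ)
  have e : (fun k : ℕ => L.φ ((2 : ℝ) ^ (-((k + 1 : ℕ) : ℤ)) • ξ)) =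
      fun k : ℕ => L.φ ((2 : ℝ) ^ (-(k : ℤ)) • (2 : ℝ)⁻¹ • ξ) := by
    ext k
    rw [smul_smul, ← zpow_neg_one, ← zpow_add₀ (by norm_num)]
    push_cast
    ring_nf
  rw [e] at h2
  have h3 := h1.unique h2
  simp only [Finset.range_one, Finset.sum_singleton, CharP.cast_eq_zero, neg_zero, zpow_zero,
    one_smul] at h3
  linarith

theorem ψ_eq_one {ξ : Rd d} (hξ : ‖ξ‖ < 1 / 2) : L.ψ ξ = 1 := by
  have h := L.partition ξ
  have h0 : (fun k : ℕ => L.φ ((2 : ℝ) ^ (-(k : ℤ)) • ξ)) = fun _ => 0 := by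
    ext k
    by_contra hne
    have h1 := (L.support_φ _ hne).1
    rw [norm_smul, Real.norm_of_nonneg (by positivity)] at h1
    have h2 : (2 : ℝ) ^ (-(k : ℤ)) ≤ 1 := by
      rw [zpow_neg, zpow_natCast]
      exact inv_le_one_of_one_le₀ (one_le_pow₀ (by norm_num))
    nlinarith [norm_nonneg ξ]
  rw [h0] at h
  have := h.unique hasSum_zero
  linarith

theorem ψ_eq_zero {ξ : Rd d} (hξ : 1 < ‖ξ‖) : L.ψ ξ = 0 := by
  by_contra h
  exact absurd (L.support_ψ ξ h) (not_le.2 hξ)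

/-- A smooth function equal to `1` on the support of `φ` and supported in an annulus. -/
def fat : AnnulusSymbol d where
  -- The first term is `1` for `|ξ| < 4` and the second vanishes for `|ξ| > 1/4`, which covers the
  -- annulus of `φ`. Both are `1` for `|ξ| < 1/8` and both are `0` for `|ξ| > 8`.
  χ ξ := L.ψ ((8 : ℝ)⁻¹ • ξ) - L.ψ ((4 : ℝ) • ξ)
  contDiff := (L.contDiff_ψ.comp (contDiff_const_smul _)).sub
    (L.contDiff_ψ.comp (contDiff_const_smul _))
  support ξ h := by
    by_contra hc
    rw [not_and_or, not_le, not_le] at hc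
    apply h
    have n1 : ‖(8 : ℝ)⁻¹ • ξ‖ = 8⁻¹ * ‖ξ‖ := by rw [norm_smul]; norm_num
    have n2 : ‖(4 : ℝ) • ξ‖ = 4 * ‖ξ‖ := by rw [norm_smul]; norm_num
    rcases hc with hc | hc
    · rw [L.ψ_eq_one (by rw [n1]; linarith), L.ψ_eq_one (by rw [n2]; linarith), sub_self]
    · rw [L.ψ_eq_zero (by rw [n1]; linarith), L.ψ_eq_zero (by rw [n2]; linarith), sub_self]

theorem fat_eq_one {ξ : Rd d} (h : L.φ ξ ≠ 0) : L.fat.χ ξ = 1 := by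
  obtain ⟨h1, h2⟩ := L.support_φ ξ h
  change L.ψ ((8 : ℝ)⁻¹ • ξ) - L.ψ ((4 : ℝ) • ξ) = 1
  have n1 : ‖(8 : ℝ)⁻¹ • ξ‖ = 8⁻¹ * ‖ξ‖ := by rw [norm_smul]; norm_num
  have n2 : ‖(4 : ℝ) • ξ‖ = 4 * ‖ξ‖ := by rw [norm_smul]; norm_num
  rw [L.ψ_eq_one (by rw [n1]; linarith), L.ψ_eq_zero (by rw [n2]; linarith), sub_zero]

theorem fat_mul_φ (ξ : Rd d) : L.fat.χ ξ * L.φ ξ = L.φ ξ := by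
  by_cases h : L.φ ξ = 0
  · simp [h]
  · rw [L.fat_eq_one h, one_mul]

theorem hasTemperateGrowth_ψ : L.ψ.HasTemperateGrowth :=
  hasTemperateGrowth_of_support L.contDiff_ψ L.support_ψ

theorem hasTemperateGrowth_φ : L.φ.HasTemperateGrowth :=
  hasTemperateGrowth_of_support L.contDiff_φ fun ξ h => (L.support_φ ξ h).2

theorem isSymbol_ψ (k : ℤ) : IsSymbol fun ξ => L.ψ ((2 : ℝ) ^ (-k) • ξ) :=
  (hasTemperateGrowth_comp_smul L.hasTemperateGrowth_ψ _).isSymbol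

theorem isSymbol_φ (k : ℤ) : IsSymbol fun ξ => L.φ ((2 : ℝ) ^ (-k) • ξ) :=
  (hasTemperateGrowth_comp_smul L.hasTemperateGrowth_φ _).isSymbol

theorem S_succ (k : ℤ) (u : 𝓢'(Rd d, ℂ)) : L.S (k + 1) u = L.S k u + L.block k u := by
  rw [S, S, block, ← multiplier_add (L.isSymbol_ψ k) (L.isSymbol_φ k)]
  congr 2
  ext ξ
  rw [← L.ψ_half_sub_ψ, smul_smul, neg_add, zpow_add₀ (by norm_num), zpow_neg_one,
    mul_comm ((2 : ℝ) ^ (-k))]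
  ring

theorem S_nat_sub (n : ℕ) (u : 𝓢'(Rd d, ℂ)) :
    L.S n u - L.S (-n) u = ∑ k ∈ Finset.Ico (-n : ℤ) n, L.block k u := by
  have h : ∀ (N : ℕ) (a : ℤ), L.S (a + N) u - L.S a u =
      ∑ i ∈ Finset.range N, L.block (a + i) u := by
    intro N a
    induction N with
    | zero => simp
    | succ N ih =>
      rw [Finset.sum_range_succ, ← ih]
      push_cast
      rw [← add_assoc, S_succ]
      abel
  have h2 := h (2 * n) (-n)
  rw [show (-n : ℤ) + ((2 * n : ℕ) : ℤ) = n by push_cast; ring] at h2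
  rw [h2]
  refine Finset.sum_bij (fun i _ => -(n : ℤ) + i) (fun i hi => ?_) (fun i _ j _ hij => by simpa using hij)
    (fun j hj => ?_) (fun _ _ => rfl)
  · rw [Finset.mem_range] at hi; rw [Finset.mem_Ico]; omega
  · rw [Finset.mem_Ico] at hj
    refine ⟨(j + n).toNat, ?_, ?_⟩
    · rw [Finset.mem_range]; omega
    · omega

/-- The low-frequency cut-off as a function of Mathlib's frequency variable. -/
def cut (c : ℝ) (ξ : Rd d) : ℂ := ((L.ψ (c • ξ) : ℝ) : ℂ)

theorem contDiff_cut (c : ℝ) : ContDiff ℝ ∞ (L.cut c) :=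
  Complex.ofRealCLM.contDiff.comp (L.contDiff_ψ.comp (contDiff_const_smul _))

theorem exists_iteratedFDeriv_cut_sub_le (n : ℕ) :
    ∃ M, 0 ≤ M ∧ ∀ c ∈ Set.Ioc (0 : ℝ) 8, ∀ i ≤ n, ∀ ξ : Rd d,
      ‖iteratedFDeriv ℝ i (fun ξ => L.cut c ξ - 1) ξ‖ ≤ M := by
  have hcs : HasCompactSupport (L.cut 1) := by
    refine HasCompactSupport.of_support_subset_isCompact (isCompact_closedBall (0 : Rd d) 1)
      fun ξ hξ => ?_
    rw [mem_closedBall_zero_iff]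
    refine L.support_ψ ξ fun h => hξ ?_
    simp [cut, h]
  have h : ∀ i : ℕ, ∃ M, ∀ ξ, ‖iteratedFDeriv ℝ i (fun ξ => L.cut 1 ξ - 1) ξ‖ ≤ M := by
    intro i
    have hsub : ∀ j : ℕ, ∃ M, ∀ ξ, ‖iteratedFDeriv ℝ j (L.cut 1) ξ‖ ≤ M := fun j =>
      ((hcs.iteratedFDeriv j).exists_bound_of_continuous
        ((L.contDiff_cut 1).continuous_iteratedFDeriv (mod_cast le_top)))
    obtain ⟨M, hM⟩ := hsub i
    refine ⟨M + 1, fun ξ => ?_⟩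
    have e : iteratedFDeriv ℝ i (fun ξ => L.cut 1 ξ - 1) ξ =
        iteratedFDeriv ℝ i (L.cut 1) ξ - iteratedFDeriv ℝ i (fun _ : Rd d => (1 : ℂ)) ξ :=
      iteratedFDeriv_sub_apply ((L.contDiff_cut 1).of_le (mod_cast le_top)).contDiffAt
        contDiff_const.contDiffAt
    rw [e]
    refine (norm_sub_le _ _).trans (add_le_add (hM ξ) ?_)
    rcases Nat.eq_zero_or_pos i with rfl | hi
    · simp
    · rw [iteratedFDeriv_const_of_ne hi.ne']; simp
  choose M hM using h
  have hM0 : ∀ i, 0 ≤ M i := fun i => (norm_nonneg _).trans (hM i 0)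
  refine ⟨8 ^ n * ∑ i ∈ Finset.range (n + 1), M i,
    mul_nonneg (by positivity) (Finset.sum_nonneg fun i _ => hM0 i), fun c hc i hi ξ => ?_⟩
  have e : (fun ξ => L.cut c ξ - 1) = fun ξ => (fun ξ => L.cut 1 ξ - 1) (c • ξ) := by
    ext ξ; simp [cut]
  rw [e, iteratedFDeriv_comp_const_smul c
    (((L.contDiff_cut 1).sub contDiff_const).of_le (mod_cast le_top)), norm_smul, norm_pow,
    Real.norm_of_nonneg hc.1.le]
  have h8 : c ^ i ≤ 8 ^ n := (pow_le_pow_left₀ hc.1.le hc.2 i).trans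
    (pow_le_pow_right₀ (by norm_num) hi)
  refine mul_le_mul h8 ((hM i _).trans ?_) (norm_nonneg _) (by positivity)
  exact Finset.single_le_sum (f := M) (fun i _ => hM0 i) (Finset.mem_range.2 (Nat.lt_succ_of_le hi))

theorem hasTemperateGrowth_cut (c : ℝ) : (L.cut c).HasTemperateGrowth :=
  Function.Complex.hasTemperateGrowth_ofReal.comp (hasTemperateGrowth_comp_smul L.hasTemperateGrowth_ψ c)

/-- The difference vanishes where `|ξ| < 1/(2c)`. Elsewhere `1 ≤ 2c|ξ|`, so a factor `c` is gained
in exchange for one more power of `|ξ|` in the seminorm of `θ`. The range `c ≤ 8` is large enough to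
contain `2π`. -/
theorem exists_seminorm_cut_sub_le (k n : ℕ) (θ : 𝓢(Rd d, ℂ)) :
    ∃ K, 0 ≤ K ∧ ∀ c ∈ Set.Ioc (0 : ℝ) 8,
      SchwartzMap.seminorm ℂ k n (SchwartzMap.smulLeftCLM ℂ (L.cut c) θ - θ) ≤ K * c := by
  obtain ⟨M, hM0, hM⟩ := L.exists_iteratedFDeriv_cut_sub_le n
  refine ⟨2 * ∑ i ∈ Finset.range (n + 1),
    (n.choose i : ℝ) * M * SchwartzMap.seminorm ℂ (k + 1) (n - i) θ, by positivity,
    fun c hc => ?_⟩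
  have hc0 : 0 < c := hc.1
  refine SchwartzMap.seminorm_le_bound ℂ k n _ (by positivity) fun ξ => ?_
  have e : ((SchwartzMap.smulLeftCLM ℂ (L.cut c) θ - θ : 𝓢(Rd d, ℂ)) : Rd d → ℂ) =
      fun ξ => (L.cut c ξ - 1) • θ ξ := by
    ext ξ
    rw [_root_.sub_apply, SchwartzMap.smulLeftCLM_apply_apply (L.hasTemperateGrowth_cut c),
      sub_smul, one_smul]
  rcases lt_or_ge ‖ξ‖ (1 / (2 * c)) with h | h
  · have hz : iteratedFDeriv ℝ n (SchwartzMap.smulLeftCLM ℂ (L.cut c) θ - θ : 𝓢(Rd d, ℂ)) ξ = 0 := by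
      have hev : ((SchwartzMap.smulLeftCLM ℂ (L.cut c) θ - θ : 𝓢(Rd d, ℂ)) : Rd d → ℂ) =ᶠ[𝓝 ξ]
          fun _ => 0 := by
        filter_upwards [(isOpen_lt continuous_norm continuous_const).mem_nhds h] with η hη
        have hη' : ‖η‖ < 1 / (2 * c) := hη
        rw [e]
        simp only
        rw [cut, L.ψ_eq_one, Complex.ofReal_one, sub_self, zero_smul]
        rw [norm_smul, Real.norm_of_nonneg hc0.le]
        rw [lt_div_iff₀ (by positivity)] at hη'
        linarith
      rw [(hev.iteratedFDeriv ℝ n).eq_of_nhds]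
      simp
    rw [hz, norm_zero, mul_zero]
    positivity
  · rw [e]
    have hL := norm_iteratedFDeriv_smul_le (𝕜 := ℝ)
      ((L.contDiff_cut c).sub (contDiff_const (c := (1 : ℂ))))
      (θ.smooth ⊤) ξ (n := n) (mod_cast le_top)
    have h1 : 1 ≤ 2 * c * ‖ξ‖ := by
      rw [div_le_iff₀ (by positivity)] at h
      linarith
    calc _ ≤ ‖ξ‖ ^ k * (2 * c * ‖ξ‖) * ∑ i ∈ Finset.range (n + 1), (n.choose i : ℝ) *
          ‖iteratedFDeriv ℝ i (fun ξ => L.cut c ξ - 1) ξ‖ * ‖iteratedFDeriv ℝ (n - i) θ ξ‖ := by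
          refine mul_le_mul (le_mul_of_one_le_right (by positivity) h1) hL (norm_nonneg _)
            (by positivity)
      _ = 2 * c * ∑ i ∈ Finset.range (n + 1), (n.choose i : ℝ) *
          ‖iteratedFDeriv ℝ i (fun ξ => L.cut c ξ - 1) ξ‖ *
            (‖ξ‖ ^ (k + 1) * ‖iteratedFDeriv ℝ (n - i) θ ξ‖) := by
          rw [Finset.mul_sum, Finset.mul_sum]
          refine Finset.sum_congr rfl fun i _ => by ring
      _ ≤ 2 * c * ∑ i ∈ Finset.range (n + 1),
          (n.choose i : ℝ) * M * SchwartzMap.seminorm ℂ (k + 1) (n - i) θ := by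
          gcongr with i hi
          · exact hM c hc i (Nat.lt_succ_iff.1 (Finset.mem_range.1 hi)) ξ
          · exact SchwartzMap.le_seminorm ℂ _ _ θ ξ
      _ = _ := by ring

theorem tendsto_smulLeftCLM_cut (θ : 𝓢(Rd d, ℂ)) :
    Tendsto (fun n : ℕ => SchwartzMap.smulLeftCLM ℂ (L.cut ((2 : ℝ) ^ (-(n : ℤ)) * (2 * Real.pi))) θ)
      atTop (𝓝 θ) := by
  rw [(schwartz_withSeminorms ℂ (Rd d) ℂ).tendsto_nhds]
  rintro ⟨k, n⟩ ε hε
  obtain ⟨K, hK, h⟩ := L.exists_seminorm_cut_sub_le k n θ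
  have hlim : Tendsto (fun n : ℕ => K * ((2 : ℝ) ^ (-(n : ℤ)) * (2 * Real.pi))) atTop (𝓝 0) := by
    have := ((tendsto_pow_atTop_nhds_zero_of_lt_one (r := (2 : ℝ)⁻¹) (by norm_num)
      (by norm_num)).mul_const (2 * Real.pi)).const_mul K
    rw [zero_mul, mul_zero] at this
    refine this.congr fun n => ?_
    rw [zpow_neg, zpow_natCast, inv_pow]
  filter_upwards [hlim.eventually_lt_const hε] with N hN
  refine (h _ ⟨by positivity, ?_⟩).trans_lt hN
  have h2 : (2 : ℝ) ^ (-(N : ℤ)) ≤ 1 := by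
    rw [zpow_neg, zpow_natCast]
    exact inv_le_one_of_one_le₀ (one_le_pow₀ (by norm_num))
  nlinarith [Real.pi_le_four, Real.pi_pos]

theorem tendsto_S_apply (u : 𝓢'(Rd d, ℂ)) (χ : 𝓢(Rd d, ℂ)) :
    Tendsto (fun n : ℕ => L.S n u χ) atTop (𝓝 (u χ)) := by
  have h := ((u.continuous.comp (fourierCLM ℂ 𝓢(Rd d, ℂ)).continuous).tendsto _).comp
    (L.tendsto_smulLeftCLM_cut (𝓕⁻ χ))
  simp only [Function.comp_def, fourierCLM_apply, fourier_fourierInv_eq] at h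
  refine h.congr fun n => ?_
  rw [S, multiplier, TemperedDistribution.fourierMultiplierCLM_apply_apply]
  congr 4
  ext ξ
  simp [cut, mul_smul]

end LittlewoodPaley

theorem LowFreqVanish.tendsto_S_apply {L : LittlewoodPaley d} {u : 𝓢'(Rd d, ℂ)}
    (h : LowFreqVanish L u) (χ : 𝓢(Rd d, ℂ)) :
    Tendsto (fun n : ℕ => L.S (-n) u χ) atTop (𝓝 0) := by
  obtain ⟨g, hg, ht⟩ := h
  have hg0 : Tendsto g atBot (𝓝 0) := tendsto_zero_iff_norm_tendsto_zero.2 ht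
  have hc : Continuous fun v : LpR d ⊤ => ofLp ⊤ v χ :=
    (PointwiseConvergenceCLM.evalCLM (RingHom.id ℂ) ℂ χ).continuous.comp (ofLp ⊤).continuous
  have h1 : Tendsto (fun k => ofLp ⊤ (g k) χ) atBot (𝓝 0) := by
    have := (hc.tendsto 0).comp hg0
    simpa [Function.comp_def] using this
  have h2 : Tendsto (fun k => L.S k u χ) atBot (𝓝 0) := by
    refine h1.congr' ?_
    filter_upwards [hg] with k hk
    rw [hk]
  exact h2.comp (tendsto_neg_atTop_atBot.comp tendsto_natCast_atTop_atTop)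

/-- The Littlewood-Paley decomposition. -/
theorem LowFreqVanish.tendsto_sum_block {L : LittlewoodPaley d} {u : 𝓢'(Rd d, ℂ)}
    (h : LowFreqVanish L u) (χ : 𝓢(Rd d, ℂ)) :
    Tendsto (fun n : ℕ => ∑ k ∈ Finset.Ico (-n : ℤ) n, L.block k u χ) atTop (𝓝 (u χ)) := by
  have := (L.tendsto_S_apply u χ).sub (h.tendsto_S_apply χ)
  rw [sub_zero] at this
  refine this.congr fun n => ?_
  have e := congrArg (fun v => PointwiseConvergenceCLM.evalCLM (RingHom.id ℂ) ℂ χ v) (L.S_nat_sub n u)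
  simp only [map_sub, map_sum] at e
  exact e

/-- Blocks do not see polynomials; vanishing at low frequencies removes this ambiguity, because each
distribution is then the sum of its blocks. -/
theorem LowFreqVanish.eq_of_block_eq {L : LittlewoodPaley d} {u v : 𝓢'(Rd d, ℂ)}
    (hu : LowFreqVanish L u) (hv : LowFreqVanish L v) (h : ∀ k, L.block k u = L.block k v) :
    u = v := by
  ext χ
  refine tendsto_nhds_unique (hu.tendsto_sum_block χ) ?_
  simp only [h]
  exact hv.tendsto_sum_block χ

/-! ### Norms and measurability in `ℓ^q` -/

section Lp

variable {E : Type*} [NormedAddCommGroup E] {q : ℝ≥0∞}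

theorem enorm_lp_rpow_eq_tsum [Fact (1 ≤ q)] (hq : 0 < q.toReal) (f : lp (fun _ : ℤ => E) q) :
    ‖f‖ₑ ^ q.toReal = ∑' k, ‖f k‖ₑ ^ q.toReal := by
  have h := lp.hasSum_norm hq f
  have h2 := ENNReal.ofReal_tsum_of_nonneg (fun k => by positivity) h.summable
  rw [h.tsum_eq] at h2
  rw [← ofReal_norm, ENNReal.ofReal_rpow_of_nonneg (norm_nonneg _) hq.le, h2]
  refine tsum_congr fun k => ?_
  rw [← ofReal_norm, ENNReal.ofReal_rpow_of_nonneg (norm_nonneg _) hq.le]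

theorem memℓp_of_tsum_enorm_ne_top (hq : 0 < q.toReal) {f : ℤ → E}
    (h : ∑' k, ‖f k‖ₑ ^ q.toReal ≠ ⊤) : Memℓp f q := by
  rw [memℓp_gen_iff hq]
  have := ENNReal.summable_toReal h
  refine this.congr fun k => ?_
  rw [← ENNReal.toReal_rpow, toReal_enorm]

/-- For finite `q` the truncations to finitely many components converge in norm, so measurability
can be tested on components. -/
theorem aestronglyMeasurable_lp [Fact (1 ≤ q)] (hq : q ≠ ⊤) {α : Type*} {_ : MeasurableSpace α}
    {μ : Measure α} {V : α → lp (fun _ : ℤ => E) q}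
    (h : ∀ k, AEStronglyMeasurable (fun t => V t k) μ) : AEStronglyMeasurable V μ := by
  refine aestronglyMeasurable_of_tendsto_ae (u := atTop)
    (f := fun n : ℕ => fun t => ∑ k ∈ Finset.Ico (-n : ℤ) n, lp.single q k (V t k)) (fun n => ?_)
    (ae_of_all _ fun t => ?_)
  · refine Finset.aestronglyMeasurable_fun_sum _ fun k _ => ?_
    exact (lp.singleContinuousAddMonoidHom (fun _ : ℤ => E) q k).continuous.comp_aestronglyMeasurable
      (h k)
  · have := lp.hasSum_single hq (V t)
    exact this.comp (tendsto_atTop_finset_of_monotone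
      (fun a b hab => Finset.Ico_subset_Ico (by omega) (by omega))
      fun x => ⟨x.natAbs + 1, by rw [Finset.mem_Ico]; omega⟩)

theorem integrableOn_coeff_apply [NormedSpace ℂ E] [Fact (1 ≤ q)] {c : ℝ → lp (fun _ : ℤ => E) q} {I : Set ℝ} (hc : IntegrableOn c I) (k : ℤ) :
    IntegrableOn (fun τ => c τ k) I :=
  (lp.evalCLM ℂ (fun _ : ℤ => E) q k).integrable_comp hc

end Lp

/-! ### Besov-valued functions and the blocks of a solution -/

section Besov

variable {L : LittlewoodPaley d} {s : ℝ} {p q : ℝ≥0∞} [Fact (1 ≤ p)] [Fact (1 ≤ q)]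

namespace Besov

theorem toDist_mem (f : Besov L s p q) : LowFreqVanish L f.toDist := f.2.1

/-- Together with the choice of the norm this makes the Besov space a subspace of `ℓ^q(L^p)`, so
that strong measurability can be transferred in both directions. -/
theorem coeff_injective : Function.Injective (coeff : Besov L s p q → _) := by
  intro f g h
  apply Subtype.ext
  refine f.toDist_mem.eq_of_block_eq g.toDist_mem fun k => ?_
  have h1 := ofLp_coeff f k
  rw [h, ofLp_coeff g k] at h1
  have h2 : (((2 : ℝ) ^ ((k : ℝ) * s) : ℝ) : ℂ) ≠ 0 := by
    rw [Complex.ofReal_ne_zero]; positivity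
  exact (smul_right_injective _ h2 h1).symm

theorem isEmbedding_coeff : IsEmbedding (coeff : Besov L s p q → _) :=
  ⟨⟨rfl⟩, coeff_injective⟩

theorem enorm_coeff (f : Besov L s p q) : ‖coeff f‖ₑ = ‖f‖ₑ := rfl

end Besov

theorem memLp_coeff {f : ℝ → Besov L s p q} {r : ℝ≥0∞} {μ : Measure ℝ} (hf : MemLp f r μ) :
    MemLp (fun τ => (f τ).coeff) r μ :=
  ⟨Besov.isEmbedding_coeff.continuous.comp_aestronglyMeasurable hf.1, by
    refine (le_of_eq ?_).trans_lt hf.2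
    exact eLpNorm_congr_enorm_ae (ae_of_all _ fun _ => Besov.enorm_coeff _)⟩

theorem measurableSet_timeInterval (T : ℝ≥0∞) : MeasurableSet (timeInterval T) :=
  measurableSet_Ici.inter (ENNReal.measurable_ofReal measurableSet_Iic)

theorem Ioc_subset_timeInterval {T : ℝ≥0∞} {t : ℝ} (ht : t ∈ timeInterval T) :
    Set.Ioc 0 t ⊆ timeInterval T :=
  fun _ hτ => ⟨hτ.1.le, (ENNReal.ofReal_le_ofReal hτ.2).trans ht.2⟩

theorem integrableOn_of_memLp_timeInterval {E : Type*} [NormedAddCommGroup E] {T : ℝ≥0∞}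
    {f : ℝ → E} {r : ℝ≥0∞} (hr : 1 ≤ r) (hf : MemLp f r (volume.restrict (timeInterval T))) {t : ℝ}
    (ht : t ∈ timeInterval T) : IntegrableOn f (Set.Ioc 0 t) :=
  (hf.mono_measure (Measure.restrict_mono (Ioc_subset_timeInterval ht) le_rfl)).integrable hr

theorem integrableOn_clm_apply {X Y : Type*} [NormedAddCommGroup X] [NormedSpace ℂ X]
    [NormedAddCommGroup Y] [NormedSpace ℂ Y] {A : ℝ → X →L[ℂ] Y} (hA : Continuous A) {M : ℝ}
    (hM : ∀ t, 0 ≤ t → ‖A t‖ ≤ M) {b : ℝ → X} {t : ℝ} (hb : IntegrableOn b (Set.Ioc 0 t)) :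
    IntegrableOn (fun τ => A (t - τ) (b τ)) (Set.Ioc 0 t) := by
  refine (hb.norm.const_mul M).mono' ?_ ?_
  · exact isBoundedBilinearMap_apply.continuous.comp_aestronglyMeasurable
      ((hA.comp (continuous_const.sub continuous_id)).aestronglyMeasurable.prodMk hb.1)
  · filter_upwards [ae_restrict_mem measurableSet_Ioc] with τ hτ
    exact (ContinuousLinearMap.le_opNorm _ _).trans
      (mul_le_mul_of_nonneg_right (hM _ (sub_nonneg.2 hτ.2)) (norm_nonneg _))

/-- Pairing of `ofLp` with a Schwartz function, as a continuous linear functional. -/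
def pairLp (p : ℝ≥0∞) [Fact (1 ≤ p)] (χ : 𝓢(Rd d, ℂ)) : LpR d p →L[ℂ] ℂ :=
  PointwiseConvergenceCLM.evalCLM (RingHom.id ℂ) ℂ χ ∘L ofLp p

theorem pairLp_apply (χ : 𝓢(Rd d, ℂ)) (v : LpR d p) : pairLp p χ v = ofLp p v χ := rfl

theorem isSymbol_heat {t : ℝ} (ht : 0 ≤ t) :
    IsSymbol fun ξ : Rd d => Real.exp (-t * ‖ξ‖ ^ 2) := (hasTemperateGrowth_heat ht).isSymbol

theorem AnnulusSymbol.isSymbol_heatSymb (B : AnnulusSymbol d) (k : ℤ) (t : ℝ) :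
    IsSymbol fun ξ => B.χ ((2 : ℝ) ^ (-k) • ξ) * Real.exp (-t * ‖ξ‖ ^ 2) := by
  have := (B.heatSymb k t).hasTemperateGrowth
  refine (congrArg Function.HasTemperateGrowth ?_).mp this
  ext x
  exact B.heatSymb_apply k t x

/-- Since the fattened cut-off is `1` on the support of `φ`, it can be inserted for free; the
semigroup then acts on the block through a compactly supported symbol, to which the kernel bounds
apply. -/
theorem block_heat (L : LittlewoodPaley d) {t : ℝ} (ht : 0 ≤ t) (k : ℤ) (u : 𝓢'(Rd d, ℂ)) :
    L.block k (heat t u) =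
      TemperedDistribution.fourierMultiplierCLM ℂ (L.fat.heatSymb k t) (L.block k u) := by
  rw [AnnulusSymbol.fourierMultiplierCLM_heatSymb, LittlewoodPaley.block, heat,
    multiplier_multiplier (L.isSymbol_φ k) (isSymbol_heat ht),
    multiplier_multiplier (L.fat.isSymbol_heatSymb k t) (L.isSymbol_φ k)]
  congr 2
  ext ξ
  rw [mul_right_comm, L.fat_mul_φ]

theorem ofLp_mulLp_heatSymb_coeff {t : ℝ} (ht : 0 ≤ t) (k : ℤ) (f : Besov L s p q) :
    ofLp p (mulLp p (L.fat.heatSymb k t) (f.coeff k)) =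
      (((2 : ℝ) ^ ((k : ℝ) * s) : ℝ) : ℂ) • L.block k (heat t f.toDist) := by
  rw [ofLp_mulLp, Besov.ofLp_coeff, map_smul, block_heat L ht]

theorem IsHeatSolution.block_eq {T : ℝ≥0∞} {f : ℝ → Besov L s p q} {w : ℝ → 𝓢'(Rd d, ℂ)}
    (hw : IsHeatSolution T (fun t => (f t).toDist) w) {r : ℝ≥0∞} (hr : 1 ≤ r)
    (hf : MemLp f r (volume.restrict (timeInterval T))) {t : ℝ} (ht : t ∈ timeInterval T) (k : ℤ) :
    ofLp p (∫ τ in Set.Ioc 0 t, mulLp p (L.fat.heatSymb k (t - τ)) ((f τ).coeff k)) =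
      (((2 : ℝ) ^ ((k : ℝ) * s) : ℝ) : ℂ) • L.block k (w t) := by
  have hb : IntegrableOn (fun τ => (f τ).coeff k) (Set.Ioc 0 t) :=
    integrableOn_coeff_apply (integrableOn_of_memLp_timeInterval hr (memLp_coeff hf) ht) k
  obtain ⟨K, hK, hKb⟩ := L.fat.exists_norm_mulLp_heatSymb_le p
  have hint := integrableOn_clm_apply (L.fat.continuous_mulLp_heatSymb p k) (M := K)
    (fun t ht => (hKb k t ht).trans (mul_le_of_le_one_right hK (by
      rw [Real.exp_le_one_iff]
      have : 0 ≤ 1 / 128 * (4 : ℝ) ^ k * t := by positivity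
      linarith))) hb
  ext χ
  rw [← pairLp_apply, ← (pairLp p χ).integral_comp_comm hint]
  -- Testing the weak formula on the transposed block of `χ` takes `Δ_k` under the time integral;
  -- the result is compared with the pairing of a Bochner integral in `L^p`.
  have h2 := (hw t ht (dualMultiplier (fun ξ => L.φ ((2 : ℝ) ^ (-k) • ξ)) χ)).2
  rw [intervalIntegral.integral_of_le ht.1] at h2
  have h3 : (((2 : ℝ) ^ ((k : ℝ) * s) : ℝ) : ℂ) • L.block k (w t) χ =
      ∫ τ in Set.Ioc 0 t, (((2 : ℝ) ^ ((k : ℝ) * s) : ℝ) : ℂ) • L.block k (heat (t - τ) (f τ).toDist) χ := by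
    rw [integral_smul]
    congr 1
  refine Eq.trans ?_ h3.symm
  refine setIntegral_congr_fun measurableSet_Ioc fun τ hτ => ?_
  simp only
  rw [pairLp_apply, ofLp_mulLp_heatSymb_coeff (sub_nonneg.2 hτ.2)]
  rfl

end Besov

/-! ### The maximal estimate -/

section Maximal

variable {p q : ℝ≥0∞} [Fact (1 ≤ p)] [Fact (1 ≤ q)]

theorem stronglyMeasurable_duhamel {X Y : Type*} [NormedAddCommGroup X] [NormedSpace ℂ X]
    [NormedAddCommGroup Y] [NormedSpace ℂ Y] {A : ℝ → X →L[ℂ] Y} (hA : Continuous A)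
    {b : ℝ → X} (hb : StronglyMeasurable b) :
    StronglyMeasurable fun t => ∫ τ in Set.Ioc 0 t, A (t - τ) (b τ) := by
  have h : StronglyMeasurable (Set.indicator {z : ℝ × ℝ | 0 < z.2 ∧ z.2 ≤ z.1}
      fun z : ℝ × ℝ => A (z.1 - z.2) (b z.2)) := by
    refine StronglyMeasurable.indicator ?_ ?_
    · exact isBoundedBilinearMap_apply.continuous.comp_stronglyMeasurable
        ((hA.comp (continuous_fst.sub continuous_snd)).stronglyMeasurable.prodMk
          (hb.comp_measurable measurable_snd))
    · exact (measurableSet_lt measurable_const measurable_snd).inter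
        (measurableSet_le measurable_snd measurable_fst)
  have e : (fun t => ∫ τ in Set.Ioc 0 t, A (t - τ) (b τ)) = fun t => ∫ τ, Set.indicator
      {z : ℝ × ℝ | 0 < z.2 ∧ z.2 ≤ z.1} (fun z : ℝ × ℝ => A (z.1 - z.2) (b z.2)) (t, τ) := by
    ext t
    rw [← integral_indicator measurableSet_Ioc]
    rfl
  rw [e]
  exact h.integral_prod_right' (ν := volume)

theorem enorm_duhamel_le {X Y : Type*} [NormedAddCommGroup X] [NormedSpace ℂ X]
    [NormedAddCommGroup Y] [NormedSpace ℂ Y] {A : ℝ → X →L[ℂ] Y} {K c : ℝ}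
    (hK : 0 ≤ K) (hA : ∀ t, 0 ≤ t → ‖A t‖ ≤ K * Real.exp (-c * t)) (b : ℝ → X) (t : ℝ) :
    ‖∫ τ in Set.Ioc 0 t, A (t - τ) (b τ)‖ₑ ≤ ENNReal.ofReal K * conv c (fun τ => ‖b τ‖ₑ) t := by
  refine (enorm_integral_le_lintegral_enorm _).trans ?_
  rw [conv, ← lintegral_const_mul' _ _ ENNReal.ofReal_ne_top]
  refine setLIntegral_mono' measurableSet_Ioc fun τ hτ => ?_
  refine ((A (t - τ)).le_opENorm _).trans ?_
  rw [← mul_assoc, ← ENNReal.ofReal_mul hK]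
  gcongr
  rw [← ofReal_norm]
  exact ENNReal.ofReal_le_ofReal (hA _ (sub_nonneg.2 hτ.2))

/-- The operator decay `K e^{-4^k t/128}` bounds each block by a scalar convolution, and the `ℓ^q`
estimate applies. The `2` in `α` converts weights `2^{kα}` into powers of `4^k`. -/
theorem exists_lintegral_duhamel_le (L : LittlewoodPaley d) (p : ℝ≥0∞) [Fact (1 ≤ p)]
    {r m Q α : ℝ} (hr : 1 < r) (hrm : r ≤ m) (hQ : 1 ≤ Q) (hQm : Q ≤ m)
    (hα : α = 2 * (1 - 1 / r + 1 / m)) :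
    ∃ C : ℝ≥0∞, C ≠ ⊤ ∧ ∀ c : ℤ → ℝ → LpR d p, (∀ k, StronglyMeasurable (c k)) →
      ∫⁻ t in Set.Ioi 0, (∑' k : ℤ, ‖(((2 : ℝ) ^ ((k : ℝ) * α) : ℝ) : ℂ) •
          ∫ τ in Set.Ioc 0 t, mulLp p (L.fat.heatSymb k (t - τ)) (c k τ)‖ₑ ^ Q) ^ (m / Q) ≤
        C * (∫⁻ t in Set.Ioi 0, (∑' k, ‖c k t‖ₑ ^ Q) ^ (r / Q)) ^ (m / r) := by
  obtain ⟨K, hK, hKb⟩ := L.fat.exists_norm_mulLp_heatSymb_le p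
  obtain ⟨C, hC, h⟩ := exists_lintegral_lq_conv_le (c := 1 / 128) (by norm_num) hr hrm hQ hQm
  have hQ0 : 0 < Q := by linarith
  have hm0 : 0 < m := by linarith
  have hKm : ENNReal.ofReal K ^ m ≠ ⊤ := ENNReal.rpow_ne_top_of_nonneg hm0.le ENNReal.ofReal_ne_top
  refine ⟨ENNReal.ofReal K ^ m * C, ENNReal.mul_ne_top hKm hC, fun c hc => ?_⟩
  rw [mul_assoc]
  refine le_trans ?_ (mul_le_mul_right (h (fun k τ => ‖c k τ‖ₑ) fun k => (hc k).enorm) _)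
  rw [← lintegral_const_mul' _ _ hKm]
  refine lintegral_mono fun t => ?_
  have e : ENNReal.ofReal K ^ m = (ENNReal.ofReal K ^ Q) ^ (m / Q) := by
    rw [← ENNReal.rpow_mul, mul_div_cancel₀ _ hQ0.ne']
  rw [e, ← ENNReal.mul_rpow_of_nonneg _ _ (by positivity), ← ENNReal.tsum_mul_left]
  gcongr with k
  rw [← ENNReal.mul_rpow_of_nonneg _ _ hQ0.le]
  gcongr
  rw [enorm_smul, wt_eq_ofReal]
  have e2 : ‖(((2 : ℝ) ^ ((k : ℝ) * α) : ℝ) : ℂ)‖ₑ =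
      ENNReal.ofReal ((4 : ℝ) ^ ((k : ℝ) * (1 - 1 / r + 1 / m))) := by
    rw [← ofReal_norm, Complex.norm_real, Real.norm_of_nonneg (by positivity),
      show (4 : ℝ) = 2 ^ (2 : ℝ) by norm_num, ← Real.rpow_mul (by norm_num), hα]
    ring_nf
  rw [e2, mul_left_comm]
  gcongr
  exact enorm_duhamel_le hK (hKb k) (c k) t

theorem aestronglyMeasurable_of_coeff {L : LittlewoodPaley d} {s : ℝ} {g : ℝ → Besov L s p q}
    {μ : Measure ℝ} (h : AEStronglyMeasurable (fun t => (g t).coeff) μ) :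
    AEStronglyMeasurable g μ :=
  (Besov.isEmbedding_coeff (L := L) (s := s) (p := p) (q := q)).aestronglyMeasurable_comp_iff.1 h

theorem restrict_timeInterval_le (T : ℝ≥0∞) :
    (volume.restrict (timeInterval T) : Measure ℝ) ≤ volume.restrict (Set.Ioi 0) := by
  rw [restrict_Ioi_eq_restrict_Ici]
  exact Measure.restrict_mono (fun t ht => ht.1) le_rfl

set_option maxHeartbeats 1600000 in
theorem exists_maximal_estimate (L : LittlewoodPaley d) {σ r m : ℝ} (hr : 1 < r) (hrm : r ≤ m)
    (hqm : q ≤ ENNReal.ofReal m) :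
    ∃ C : ℝ≥0, ∀ (T : ℝ≥0∞) (f : ℝ → Besov L (σ + 2 / r) p q),
      MemLp f (ENNReal.ofReal r) (volume.restrict (timeInterval T)) →
      ∀ w : ℝ → 𝓢'(Rd d, ℂ), IsHeatSolution T (fun t => (f t).toDist) w →
        (∀ᵐ t ∂(volume.restrict (timeInterval T)), LowFreqVanish L (w t)) →
        ∃ W : ℝ → Besov L (σ + 2 + 2 / m) p q,
          (∀ᵐ t ∂(volume.restrict (timeInterval T)), (W t).toDist = w t) ∧
          MemLp W (ENNReal.ofReal m) (volume.restrict (timeInterval T)) ∧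
          eLpNorm W (ENNReal.ofReal m) (volume.restrict (timeInterval T)) ≤
            C * eLpNorm f (ENNReal.ofReal r) (volume.restrict (timeInterval T)) := by
  have hq1 : 1 ≤ q := Fact.out
  have hqt : q ≠ ⊤ := (hqm.trans_lt ENNReal.ofReal_lt_top).ne
  have hr0 : 0 < r := by linarith
  have hm0 : 0 < m := by linarith
  have hQ : 1 ≤ q.toReal := by
    rw [← ENNReal.toReal_one]; exact ENNReal.toReal_mono hqt hq1
  have hQ0 : 0 < q.toReal := by linarith
  have hQm : q.toReal ≤ m := ENNReal.toReal_le_of_le_ofReal hm0.le hqm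
  set s : ℝ := σ + 2 / r with hs
  set s' : ℝ := σ + 2 + 2 / m with hs'
  obtain ⟨C, hC, hest⟩ := exists_lintegral_duhamel_le L p hr hrm hQ hQm (α := s' - s)
    (by rw [hs, hs']; ring)
  refine ⟨(C ^ (1 / m)).toNNReal, fun T f hf w hw hlow => ?_⟩
  set μ : Measure ℝ := volume.restrict (timeInterval T) with hμ
  have hf1 : AEStronglyMeasurable (fun τ => (f τ).coeff) μ := (memLp_coeff hf).1
  set g := hf1.mk _ with hg
  have hgm : StronglyMeasurable g := hf1.stronglyMeasurable_mk
  have hgf : (fun τ => (f τ).coeff) =ᵐ[μ] g := hf1.ae_eq_mk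
  -- A strongly measurable representative extended by zero: the estimate on the half-line applies to
  -- it with a constant that does not depend on `T`.
  set c : ℝ → lp (fun _ : ℤ => LpR d p) q := (timeInterval T).indicator g with hc
  have hcm : StronglyMeasurable c := hgm.indicator (measurableSet_timeInterval T)
  have hck : ∀ k, StronglyMeasurable fun τ => c τ k := fun k =>
    (lp.evalCLM ℂ (fun _ : ℤ => LpR d p) q k).continuous.comp_stronglyMeasurable hcm
  have hcf : ∀ᵐ τ, τ ∈ timeInterval T → c τ = (f τ).coeff := by
    have := (ae_restrict_iff' (measurableSet_timeInterval T)).1 hgf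
    filter_upwards [this] with τ h1 h2
    rw [hc, Set.indicator_of_mem h2, ← h1 h2]
  have hN : (∫⁻ t in Set.Ioi 0, (∑' k, ‖c t k‖ₑ ^ q.toReal) ^ (r / q.toReal)) ^ (m / r) ≤
      eLpNorm f (ENNReal.ofReal r) μ ^ m := by
    have e : m = r * (m / r) := by field_simp
    conv_rhs => rw [e, ENNReal.rpow_mul]
    gcongr
    rw [eLpNorm_eq_lintegral_rpow_enorm_toReal (by simpa using hr0) ENNReal.ofReal_ne_top,
      ENNReal.toReal_ofReal hr0.le, ← ENNReal.rpow_mul, one_div_mul_cancel hr0.ne',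
      ENNReal.rpow_one]
    have e1 : ∀ t, (∑' k, ‖c t k‖ₑ ^ q.toReal) ^ (r / q.toReal) =
        (timeInterval T).indicator (fun t => ‖g t‖ₑ ^ r) t := fun t => by
      rw [← enorm_lp_rpow_eq_tsum hQ0, ← ENNReal.rpow_mul, mul_div_cancel₀ _ hQ0.ne', hc]
      by_cases h : t ∈ timeInterval T
      · simp [h]
      · simp [h, hr0]
    simp only [e1]
    refine (setLIntegral_le_lintegral _ _).trans_eq ?_
    rw [lintegral_indicator (measurableSet_timeInterval T)]
    refine lintegral_congr_ae ?_
    filter_upwards [hgf] with τ hτ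
    rw [← hτ, Besov.enorm_coeff]
  set V : ℤ → ℝ → LpR d p := fun k t => (((2 : ℝ) ^ ((k : ℝ) * (s' - s)) : ℝ) : ℂ) •
    ∫ τ in Set.Ioc 0 t, mulLp p (L.fat.heatSymb k (t - τ)) (c τ k) with hV
  have hVm : ∀ k, StronglyMeasurable (V k) := fun k =>
    (stronglyMeasurable_duhamel (L.fat.continuous_mulLp_heatSymb p k) (hck k)).const_smul
      (((2 : ℝ) ^ ((k : ℝ) * (s' - s)) : ℝ) : ℂ)
  have hF := (hest (fun k τ => c τ k) hck).trans (mul_le_mul_right hN C)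
  have hFm : Measurable fun t => (∑' k, ‖V k t‖ₑ ^ q.toReal) ^ (m / q.toReal) :=
    (Measurable.tsum fun k => ((hVm k).enorm.pow_const _)).pow_const _
  -- The estimate comes before membership: finiteness of its left side shows that almost every
  -- `w(t)` has a finite Besov norm.
  have hfin : ∀ᵐ t ∂μ, ∑' k, ‖V k t‖ₑ ^ q.toReal ≠ ⊤ := by
    have h1 := ae_lt_top hFm (hF.trans_lt (ENNReal.mul_lt_top hC.lt_top
      (ENNReal.rpow_lt_top_of_nonneg hm0.le hf.2.ne))).ne
    filter_upwards [ae_mono (restrict_timeInterval_le T) h1] with t ht htop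
    simp only [htop] at ht
    rw [ENNReal.top_rpow_of_pos (by positivity)] at ht
    exact lt_irrefl _ ht
  have hVw : ∀ t ∈ timeInterval T, ∀ k,
      ofLp p (V k t) = (((2 : ℝ) ^ ((k : ℝ) * s') : ℝ) : ℂ) • L.block k (w t) := by
    intro t ht k
    have h1 := hw.block_eq (r := ENNReal.ofReal r) (by simpa using hr.le) hf ht k
    have h2 : ∫ τ in Set.Ioc 0 t, mulLp p (L.fat.heatSymb k (t - τ)) (c τ k) =
        ∫ τ in Set.Ioc 0 t, mulLp p (L.fat.heatSymb k (t - τ)) ((f τ).coeff k) := by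
      refine setIntegral_congr_ae measurableSet_Ioc ?_
      filter_upwards [hcf] with τ h3 h4
      rw [h3 (Ioc_subset_timeInterval ht h4)]
    rw [hV]
    simp only
    rw [map_smul, h2, h1, smul_smul, ← Complex.ofReal_mul, ← Real.rpow_add (by norm_num)]
    ring_nf
  have hmem : ∀ᵐ t ∂μ, w t ∈ besovSubmodule L s' p q ∧ t ∈ timeInterval T ∧
      ∑' k, ‖V k t‖ₑ ^ q.toReal ≠ ⊤ := by
    filter_upwards [hfin, hlow, ae_restrict_mem (measurableSet_timeInterval T)] with t h1 h2 h3
    exact ⟨⟨h2, ⟨fun k => V k t, memℓp_of_tsum_enorm_ne_top hQ0 h1⟩, fun k => hVw t h3 k⟩, h3, h1⟩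
  classical
  -- The value `0` is taken only where `w(t)` is not in the space; within the time interval this is
  -- a null set.
  let W : ℝ → Besov L s' p q := fun t =>
    if h : w t ∈ besovSubmodule L s' p q then ⟨w t, h⟩ else 0
  have hW : ∀ᵐ t ∂μ, (W t).toDist = w t ∧ t ∈ timeInterval T := by
    filter_upwards [hmem] with t ht
    refine ⟨?_, ht.2.1⟩
    have hWt : W t = ⟨w t, ht.1⟩ := dif_pos ht.1
    rw [hWt]
    rfl
  have hWV : ∀ᵐ t ∂μ, ∀ k, (W t).coeff k = V k t := by
    filter_upwards [hW] with t ht k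
    apply ofLp_injective p
    rw [hVw t ht.2, Besov.ofLp_coeff, ht.1]
  have hWm : AEStronglyMeasurable W μ := by
    refine aestronglyMeasurable_of_coeff ?_
    refine aestronglyMeasurable_lp hqt fun k => (hVm k).aestronglyMeasurable.congr ?_
    filter_upwards [hWV] with t ht
    exact (ht k).symm
  have hnorm : eLpNorm W (ENNReal.ofReal m) μ ≤
      (C ^ (1 / m)).toNNReal * eLpNorm f (ENNReal.ofReal r) μ := by
    rw [ENNReal.coe_toNNReal (ENNReal.rpow_ne_top_of_nonneg (by positivity) hC),
      eLpNorm_eq_lintegral_rpow_enorm_toReal (by simpa using hm0) ENNReal.ofReal_ne_top,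
      ENNReal.toReal_ofReal hm0.le]
    have e1 : ∫⁻ t, ‖W t‖ₑ ^ m ∂μ ≤ C * eLpNorm f (ENNReal.ofReal r) μ ^ m := by
      refine le_trans ?_ ((lintegral_mono' (restrict_timeInterval_le T) le_rfl).trans hF)
      refine (lintegral_congr_ae ?_).le
      filter_upwards [hWV] with t ht
      rw [← Besov.enorm_coeff]
      have e2 : ∀ k, ‖V k t‖ₑ = ‖(W t).coeff k‖ₑ := fun k => by rw [ht]
      change _ = (∑' k, ‖V k t‖ₑ ^ q.toReal) ^ (m / q.toReal)
      simp only [e2]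
      rw [← enorm_lp_rpow_eq_tsum hQ0, ← ENNReal.rpow_mul, mul_div_cancel₀ _ hQ0.ne']
    calc _ ≤ (C * eLpNorm f (ENNReal.ofReal r) μ ^ m) ^ (1 / m) := by gcongr
      _ = _ := by
        rw [ENNReal.mul_rpow_of_nonneg _ _ (by positivity), ← ENNReal.rpow_mul,
          mul_one_div_cancel hm0.ne', ENNReal.rpow_one]
  refine ⟨W, hW.mono fun t ht => ht.1, ⟨hWm, hnorm.trans_lt ?_⟩, hnorm⟩
  exact ENNReal.mul_lt_top ENNReal.coe_lt_top hf.2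

end Maximal

/-! ### Absolutely convergent series of operators and their tails -/

section Series

variable {E Y : Type*} [NormedAddCommGroup E] [NormedSpace ℂ E] [NormedAddCommGroup Y]
  [NormedSpace ℂ Y] {q : ℝ≥0∞} [Fact (1 ≤ q)]

/-- A series of operators `a ↦ ∑ A_n(t) a_{e(n)}` on `ℓ^q(ℤ; E)` which converges absolutely. -/
structure SeriesOp (q : ℝ≥0∞) [Fact (1 ≤ q)] (E Y : Type*) [NormedAddCommGroup E]
    [NormedSpace ℂ E] [NormedAddCommGroup Y] [NormedSpace ℂ Y] where
  A : ℕ → ℝ → E →L[ℂ] Y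
  e : ℕ → ℤ
  M : ℕ → ℝ
  D : ℝ
  cont : ∀ n, Continuous (A n)
  bound : ∀ n t, 0 ≤ t → ‖A n t‖ ≤ M n
  summable : ∀ a : lp (fun _ : ℤ => E) q, Summable fun n => M n * ‖a (e n)‖
  tsum_le : ∀ a : lp (fun _ : ℤ => E) q, ∑' n, M n * ‖a (e n)‖ ≤ D * ‖a‖

namespace SeriesOp

variable (B : SeriesOp q E Y)

theorem M_nonneg (n : ℕ) : 0 ≤ B.M n := (norm_nonneg _).trans (B.bound n 0 le_rfl)

/-- The tail of the series from the index `N` on. -/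
def tail (N : ℕ) (t : ℝ) (a : lp (fun _ : ℤ => E) q) : Y :=
  ∑' n, B.A (n + N) t (a (B.e (n + N)))

theorem norm_apply_le {t : ℝ} (ht : 0 ≤ t) (a : lp (fun _ : ℤ => E) q) (n : ℕ) :
    ‖B.A n t (a (B.e n))‖ ≤ B.M n * ‖a (B.e n)‖ :=
  (ContinuousLinearMap.le_opNorm _ _).trans
    (mul_le_mul_of_nonneg_right (B.bound n t ht) (norm_nonneg _))

theorem summable_tail (a : lp (fun _ : ℤ => E) q) (N : ℕ) :
    Summable fun n => B.M (n + N) * ‖a (B.e (n + N))‖ :=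
  (summable_nat_add_iff (f := fun n => B.M n * ‖a (B.e n)‖) N).2 (B.summable a)

theorem norm_tail_le {t : ℝ} (ht : 0 ≤ t) (N : ℕ) (a : lp (fun _ : ℤ => E) q) :
    ‖B.tail N t a‖ ≤ B.D * ‖a‖ := by
  have h1 := tsum_of_norm_bounded (B.summable_tail a N).hasSum
    fun n => B.norm_apply_le ht a (n + N)
  refine (h1.trans ?_).trans (B.tsum_le a)
  have h2 := (B.summable a).sum_add_tsum_nat_add N
  have h3 : 0 ≤ ∑ n ∈ Finset.range N, B.M n * ‖a (B.e n)‖ :=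
    Finset.sum_nonneg fun n _ => mul_nonneg (B.M_nonneg n) (norm_nonneg _)
  linarith

variable [CompleteSpace Y]

theorem hasSum_tail {t : ℝ} (ht : 0 ≤ t) (N : ℕ) (a : lp (fun _ : ℤ => E) q) :
    HasSum (fun n => B.A (n + N) t (a (B.e (n + N)))) (B.tail N t a) :=
  (Summable.of_norm_bounded (B.summable_tail a N) fun n => B.norm_apply_le ht a (n + N)).hasSum

omit [CompleteSpace Y] in
theorem tendsto_tail {t : ℝ} (a : lp (fun _ : ℤ => E) q) :
    Tendsto (fun N => B.tail N t a) atTop (𝓝 0) :=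
  tendsto_sum_nat_add fun n => B.A n t (a (B.e n))

theorem integrableOn_tail (N : ℕ) {c : ℝ → lp (fun _ : ℤ => E) q} {t : ℝ}
    (hc : IntegrableOn c (Set.Ioc 0 t)) :
    IntegrableOn (fun τ => B.tail N (t - τ) (c τ)) (Set.Ioc 0 t) := by
  refine (hc.norm.const_mul B.D).mono' ?_ ?_
  · refine aestronglyMeasurable_of_tendsto_ae (u := atTop) (f := fun m : ℕ => fun τ =>
      ∑ n ∈ Finset.range m, B.A (n + N) (t - τ) (c τ (B.e (n + N)))) (fun m => ?_) ?_
    · exact Finset.aestronglyMeasurable_fun_sum _ fun n _ =>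
        (integrableOn_clm_apply (B.cont _) (B.bound _) (integrableOn_coeff_apply hc _)).1
    · filter_upwards [ae_restrict_mem measurableSet_Ioc] with τ hτ
      exact (B.hasSum_tail (sub_nonneg.2 hτ.2) N (c τ)).tendsto_sum_nat
  · filter_upwards [ae_restrict_mem measurableSet_Ioc] with τ hτ
    exact B.norm_tail_le (sub_nonneg.2 hτ.2) N (c τ)

/-- Dominated convergence: the tails vanish for each fixed time and are bounded by `D ‖c(τ)‖`
uniformly in `N`. Applied to the low frequencies, this gives the decay of `S_k w(t)`. -/
theorem tendsto_integral_tail {c : ℝ → lp (fun _ : ℤ => E) q} {t : ℝ}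
    (hc : IntegrableOn c (Set.Ioc 0 t)) :
    Tendsto (fun N => ∫ τ in Set.Ioc 0 t, B.tail N (t - τ) (c τ)) atTop (𝓝 0) := by
  have h := tendsto_integral_of_dominated_convergence (μ := volume.restrict (Set.Ioc 0 t))
    (F := fun N τ => B.tail N (t - τ) (c τ)) (f := fun _ => 0) (fun τ => B.D * ‖c τ‖)
    (fun N => (B.integrableOn_tail N hc).1) (hc.norm.const_mul B.D) (fun N => ?_) ?_
  · simpa using h
  · filter_upwards [ae_restrict_mem measurableSet_Ioc] with τ hτ
    exact B.norm_tail_le (sub_nonneg.2 hτ.2) N (c τ)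
  · exact ae_of_all _ fun τ => B.tendsto_tail (c τ)

end SeriesOp

/-- A series of operators with summable norms. -/
def SeriesOp.ofSummable (A : ℕ → ℝ → E →L[ℂ] Y) (e : ℕ → ℤ) (M : ℕ → ℝ)
    (cont : ∀ n, Continuous (A n)) (bound : ∀ n t, 0 ≤ t → ‖A n t‖ ≤ M n) (hM : Summable M) :
    SeriesOp q E Y :=
  have hq0 : q ≠ 0 := (zero_lt_one.trans_le Fact.out).ne'
  have hM0 : ∀ n, 0 ≤ M n := fun n => (norm_nonneg _).trans (bound n 0 le_rfl)
  have hs : ∀ a : lp (fun _ : ℤ => E) q, Summable fun n => M n * ‖a (e n)‖ := fun a =>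
    Summable.of_nonneg_of_le (fun n => mul_nonneg (hM0 n) (norm_nonneg _))
      (fun n => mul_le_mul_of_nonneg_left (lp.norm_apply_le_norm hq0 a (e n)) (hM0 n))
      (hM.mul_right ‖a‖)
  { A := A, e := e, M := M, D := ∑' n, M n, cont := cont, bound := bound
    summable := hs
    tsum_le := fun a => by
      rw [← tsum_mul_right]
      exact (hs a).tsum_le_tsum
        (fun n => mul_le_mul_of_nonneg_left (lp.norm_apply_le_norm hq0 a (e n)) (hM0 n))
        (hM.mul_right ‖a‖) }

/-- A series of uniformly bounded operators on `ℓ^1`. -/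
def SeriesOp.ofOne (A : ℕ → ℝ → E →L[ℂ] Y) (e : ℕ → ℤ) (he : Function.Injective e) (K : ℝ)
    (cont : ∀ n, Continuous (A n)) (bound : ∀ n t, 0 ≤ t → ‖A n t‖ ≤ K) (hq : q = 1) :
    SeriesOp q E Y :=
  have hK : 0 ≤ K := (norm_nonneg _).trans (bound 0 0 le_rfl)
  have hs : ∀ a : lp (fun _ : ℤ => E) q, HasSum (fun k => ‖a k‖) ‖a‖ := fun a => by
    have := lp.hasSum_norm (p := q) (by simp [hq]) a
    simpa [hq] using this
  { A := A, e := e, M := fun _ => K, D := K, cont := cont, bound := bound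
    summable := fun a => ((hs a).summable.comp_injective he).mul_left K
    tsum_le := fun a => by
      rw [tsum_mul_left]
      refine mul_le_mul_of_nonneg_left ?_ hK
      rw [← (hs a).tsum_eq]
      exact tsum_comp_le_tsum_of_inj (hs a).summable (fun _ => norm_nonneg _) he }

end Series

/-! ### Low-frequency and high-frequency series of the heat flow -/

theorem multiplier_const_mul {m : Rd d → ℝ} (hm : IsSymbol m) (c : ℝ) (u : 𝓢'(Rd d, ℂ)) :
    multiplier (fun ξ => c * m ξ) u = (c : ℂ) • multiplier m u := by
  have e : (fun ξ : Rd d => ((c * m ((2 * Real.pi) • ξ) : ℝ) : ℂ)) =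
      (c : ℂ) • fun ξ : Rd d => ((m ((2 * Real.pi) • ξ) : ℝ) : ℂ) := by
    ext ξ; simp
  rw [multiplier, e, TemperedDistribution.fourierMultiplierCLM_smul hm]
  rfl

/-- The symbol `χ(ξ)/|ξ|^{2N}`. -/
def AnnulusSymbol.divNormPow (B : AnnulusSymbol d) (N : ℕ) : AnnulusSymbol d where
  χ ξ := B.χ ξ / (‖ξ‖ ^ 2) ^ N
  contDiff := by
    rw [contDiff_iff_contDiffAt]
    intro ξ
    by_cases h : ξ = 0
    · have hev : (fun ξ => B.χ ξ / (‖ξ‖ ^ 2) ^ N) =ᶠ[𝓝 ξ] fun _ => 0 := by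
        filter_upwards [Metric.ball_mem_nhds ξ (show (0 : ℝ) < 1 / 8 by norm_num)] with η hη
        rw [h, mem_ball_zero_iff] at hη
        have : B.χ η = 0 := by
          by_contra hne
          exact absurd (B.support η hne).1 (not_le.2 hη)
        rw [this, zero_div]
      exact contDiffAt_const.congr_of_eventuallyEq hev
    · refine B.contDiff.contDiffAt.div (((contDiff_norm_sq ℝ).pow N).contDiffAt) ?_
      have : ‖ξ‖ ≠ 0 := norm_ne_zero_iff.2 h
      positivity
  support ξ h := B.support ξ fun h0 => h (by rw [h0, zero_div])

theorem AnnulusSymbol.divNormPow_χ (B : AnnulusSymbol d) (N : ℕ) (ξ : Rd d) :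
    (‖ξ‖ ^ 2) ^ N * (B.divNormPow N).χ ξ = B.χ ξ := by
  change (‖ξ‖ ^ 2) ^ N * (B.χ ξ / (‖ξ‖ ^ 2) ^ N) = B.χ ξ
  by_cases h : ξ = 0
  · have h0 : B.χ ξ = 0 := by
      by_contra hne
      have := (B.support ξ hne).1
      rw [h, norm_zero] at this
      norm_num at this
    rw [h0]; simp
  · have : ‖ξ‖ ≠ 0 := norm_ne_zero_iff.2 h
    field_simp

theorem isSymbol_normPow (N : ℕ) : IsSymbol fun ξ : Rd d => (‖ξ‖ ^ 2) ^ N :=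
  ((Function.hasTemperateGrowth_norm_sq (Rd d)).pow N).isSymbol

theorem multiplier_normPow_heatSymb (B : AnnulusSymbol d) (N : ℕ) (k : ℤ) (t : ℝ)
    (v : 𝓢'(Rd d, ℂ)) :
    multiplier (fun ξ => (‖ξ‖ ^ 2) ^ N)
        (TemperedDistribution.fourierMultiplierCLM ℂ ((B.divNormPow N).heatSymb k t) v) =
      ((((4 : ℝ) ^ k) ^ N : ℝ) : ℂ) •
        TemperedDistribution.fourierMultiplierCLM ℂ (B.heatSymb k t) v := by
  rw [AnnulusSymbol.fourierMultiplierCLM_heatSymb, AnnulusSymbol.fourierMultiplierCLM_heatSymb,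
    multiplier_multiplier (isSymbol_normPow N) (AnnulusSymbol.isSymbol_heatSymb _ k t)]
  have e : (fun ξ : Rd d => (‖ξ‖ ^ 2) ^ N *
      ((B.divNormPow N).χ ((2 : ℝ) ^ (-k) • ξ) * Real.exp (-t * ‖ξ‖ ^ 2))) =
      fun ξ => ((4 : ℝ) ^ k) ^ N * (B.χ ((2 : ℝ) ^ (-k) • ξ) * Real.exp (-t * ‖ξ‖ ^ 2)) := by
    ext ξ
    rw [← B.divNormPow_χ N ((2 : ℝ) ^ (-k) • ξ), norm_smul, Real.norm_of_nonneg (by positivity)]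
    have h4 : (4 : ℝ) ^ k * ((2 : ℝ) ^ (-k)) ^ 2 = 1 := by
      rw [show (4 : ℝ) = 2 * 2 by norm_num, mul_zpow, zpow_neg]
      field_simp
    have h5 : ((4 : ℝ) ^ k) ^ N * (((2 : ℝ) ^ (-k) * ‖ξ‖) ^ 2) ^ N = (‖ξ‖ ^ 2) ^ N := by
      rw [mul_pow, ← mul_pow, ← mul_assoc, h4, one_mul]
    rw [← h5]
    ring
  rw [e, multiplier_const_mul (AnnulusSymbol.isSymbol_heatSymb _ k t)]

variable {p q : ℝ≥0∞} [Fact (1 ≤ p)] [Fact (1 ≤ q)]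

/-- By Bernstein, the block at frequency `2^k` maps the coefficient into `L^∞` with norm at most `K
2^{k(d/p-s)}`. For `s < d/p` these bounds are summable as `k → -∞`; for `s = d/p` they are only
bounded, and the coefficients themselves are summable because `q = 1`. -/
theorem exists_lowSeries (L : LittlewoodPaley d) {s : ℝ}
    (hs : s < d * (p⁻¹).toReal ∨ (s = d * (p⁻¹).toReal ∧ q = 1)) :
    ∃ B : SeriesOp q (LpR d p) (LpR d ⊤), ∀ (n : ℕ) (t : ℝ) (f : Besov L s p q), 0 ≤ t →
      ofLp ⊤ (B.A n t (f.coeff (B.e n))) = L.block (-1 - n) (heat t f.toDist) := by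
  obtain ⟨K, hK, hKb⟩ := L.fat.exists_norm_mulLpTop_heatSymb_le p
  let e : ℕ → ℤ := fun n => -1 - n
  have he : Function.Injective e := fun a b h => by simpa [e] using h
  let A : ℕ → ℝ → LpR d p →L[ℂ] LpR d ⊤ := fun n t =>
    (((2 : ℝ) ^ (-((e n : ℝ) * s)) : ℝ) : ℂ) • mulLpTop p (L.fat.heatSymb (e n) t)
  have hA : ∀ n, Continuous (A n) := fun n =>
    (L.fat.continuous_mulLpTop_heatSymb p (e n)).const_smul
      (((2 : ℝ) ^ (-((e n : ℝ) * s)) : ℝ) : ℂ)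
  set β : ℝ := d * (p⁻¹).toReal - s with hβ
  have hAb : ∀ n t, 0 ≤ t → ‖A n t‖ ≤ K * (2 : ℝ) ^ ((e n : ℝ) * β) := fun n t ht => by
    rw [norm_smul, Complex.norm_real, Real.norm_of_nonneg (by positivity)]
    calc _ ≤ (2 : ℝ) ^ (-((e n : ℝ) * s)) *
          (K * (2 : ℝ) ^ ((e n : ℝ) * (d * (p⁻¹).toReal))) := by
          gcongr
          exact hKb (e n) t ht
      _ = K * ((2 : ℝ) ^ (-((e n : ℝ) * s)) * (2 : ℝ) ^ ((e n : ℝ) * (d * (p⁻¹).toReal))) := by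
          ring
      _ = _ := by
          rw [← Real.rpow_add (by norm_num), hβ]
          ring_nf
  have hval : ∀ (n : ℕ) (t : ℝ) (f : Besov L s p q), 0 ≤ t →
      ofLp ⊤ (A n t (f.coeff (e n))) = L.block (-1 - n) (heat t f.toDist) := by
    intro n t f ht
    change ofLp ⊤ ((((2 : ℝ) ^ (-((e n : ℝ) * s)) : ℝ) : ℂ) •
      mulLpTop p (L.fat.heatSymb (e n) t) (f.coeff (e n))) = _
    rw [map_smul, ofLp_mulLpTop, Besov.ofLp_coeff, map_smul, smul_smul, ← Complex.ofReal_mul,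
      ← Real.rpow_add (by norm_num), neg_add_cancel, Real.rpow_zero, Complex.ofReal_one, one_smul,
      block_heat L ht]
  rcases hs with hs | ⟨hs, hq⟩
  · have hβ0 : 0 < β := by rw [hβ]; linarith
    have hM : Summable fun n => K * (2 : ℝ) ^ ((e n : ℝ) * β) := by
      refine Summable.mul_left K ?_
      have h1 : (2 : ℝ) ^ (-β) < 1 := Real.rpow_lt_one_of_one_lt_of_neg (by norm_num) (by linarith)
      have h2 := (summable_geometric_of_lt_one (by positivity) h1).mul_left ((2 : ℝ) ^ (-β))
      refine h2.congr fun n => ?_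
      rw [← Real.rpow_natCast, ← Real.rpow_mul (by norm_num), ← Real.rpow_add (by norm_num)]
      simp only [e]
      push_cast
      ring_nf
    exact ⟨SeriesOp.ofSummable A e _ hA hAb hM, hval⟩
  · have hβ0 : β = 0 := by rw [hβ]; linarith
    exact ⟨SeriesOp.ofOne A e he K hA (fun n t ht => by simpa [hβ0] using hAb n t ht) hq, hval⟩

set_option maxHeartbeats 800000 in
-- For very negative `s` the blocks need not be summable in `L^p`. Dividing their symbols by
-- `|ξ|^{2N}` gains `4^{-nN}`, and the multiplier `|ξ|^{2N}` is restored afterwards on the level of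
-- tempered distributions.
theorem exists_highSeries (L : LittlewoodPaley d) (s : ℝ) :
    ∃ (N : ℕ) (B : SeriesOp q (LpR d p) (LpR d p)),
      ∀ (n : ℕ) (t : ℝ) (f : Besov L s p q), 0 ≤ t →
        multiplier (fun ξ => (‖ξ‖ ^ 2) ^ N) (ofLp p (B.A n t (f.coeff (B.e n)))) =
          L.block n (heat t f.toDist) := by
  -- This makes the ratio `2^{-s} 4^{-N}` of the majorising geometric series less than `1`.
  obtain ⟨N, hN⟩ := pow_unbounded_of_one_lt ((2 : ℝ) ^ (-s)) (show (1 : ℝ) < 4 by norm_num)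
  obtain ⟨K, hK, hKb⟩ := (L.fat.divNormPow N).exists_norm_mulLp_heatSymb_le p
  let A : ℕ → ℝ → LpR d p →L[ℂ] LpR d p := fun n t =>
    (((2 : ℝ) ^ (-((n : ℝ) * s)) * (((4 : ℝ) ^ (n : ℤ)) ^ N)⁻¹ : ℝ) : ℂ) •
      mulLp p ((L.fat.divNormPow N).heatSymb n t)
  have hA : ∀ n, Continuous (A n) := fun n =>
    ((L.fat.divNormPow N).continuous_mulLp_heatSymb p n).const_smul
      (((2 : ℝ) ^ (-((n : ℝ) * s)) * (((4 : ℝ) ^ (n : ℤ)) ^ N)⁻¹ : ℝ) : ℂ)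
  have hAb : ∀ n t, 0 ≤ t → ‖A n t‖ ≤ ((2 : ℝ) ^ (-s) * ((4 : ℝ) ^ N)⁻¹) ^ n * K := by
    intro n t ht
    rw [norm_smul, Complex.norm_real, Real.norm_of_nonneg (by positivity)]
    refine mul_le_mul (le_of_eq ?_) ((hKb n t ht).trans (mul_le_of_le_one_right hK ?_))
      (norm_nonneg _) (by positivity)
    · have e : (2 : ℝ) ^ (-((n : ℝ) * s)) = ((2 : ℝ) ^ (-s)) ^ n := by
        rw [← Real.rpow_natCast, ← Real.rpow_mul (by norm_num)]
        ring_nf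
      rw [e, mul_pow, inv_pow, zpow_natCast, ← pow_mul, ← pow_mul, mul_comm N]
    · rw [Real.exp_le_one_iff]
      have : 0 ≤ 1 / 128 * (4 : ℝ) ^ (n : ℤ) * t := by positivity
      linarith
  have hM : Summable fun n => ((2 : ℝ) ^ (-s) * ((4 : ℝ) ^ N)⁻¹) ^ n * K := by
    refine Summable.mul_right K (summable_geometric_of_lt_one (by positivity) ?_)
    rwa [mul_inv_lt_iff₀ (by positivity), one_mul]
  refine ⟨N, SeriesOp.ofSummable A (fun n => (n : ℤ)) _ hA hAb hM, fun n t f ht => ?_⟩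
  change multiplier _ (ofLp p ((((2 : ℝ) ^ (-((n : ℝ) * s)) * (((4 : ℝ) ^ (n : ℤ)) ^ N)⁻¹ : ℝ) : ℂ) •
      mulLp p ((L.fat.divNormPow N).heatSymb n t) (f.coeff n))) = _
  rw [map_smul, map_smul, ofLp_mulLp, Besov.ofLp_coeff, map_smul, map_smul,
    multiplier_normPow_heatSymb, ← block_heat L ht, smul_smul, smul_smul, ← Complex.ofReal_mul,
    ← Complex.ofReal_mul]
  have hc : (2 : ℝ) ^ (-((n : ℝ) * s)) * (((4 : ℝ) ^ (n : ℤ)) ^ N)⁻¹ *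
      (2 : ℝ) ^ (((n : ℤ) : ℝ) * s) * ((4 : ℝ) ^ (n : ℤ)) ^ N = 1 := by
    rw [mul_right_comm, inv_mul_cancel_right₀ (by positivity), ← Real.rpow_add (by norm_num)]
    simp
  rw [hc, Complex.ofReal_one, one_smul]

theorem S_heat (L : LittlewoodPaley d) {t : ℝ} (ht : 0 ≤ t) (k : ℤ) (u : 𝓢'(Rd d, ℂ)) :
    L.S k (heat t u) = heat t (L.S k u) := by
  rw [LittlewoodPaley.S, heat, multiplier_multiplier (L.isSymbol_ψ k) (isSymbol_heat ht),
    multiplier_multiplier (isSymbol_heat ht) (L.isSymbol_ψ k)]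
  congr 2
  ext ξ
  ring

theorem tendsto_S_neg_heat {L : LittlewoodPaley d} {u : 𝓢'(Rd d, ℂ)} (hu : LowFreqVanish L u)
    {t : ℝ} (ht : 0 ≤ t) (χ : 𝓢(Rd d, ℂ)) :
    Tendsto (fun n : ℕ => L.S (-n) (heat t u) χ) atTop (𝓝 0) := by
  simp only [S_heat L ht]
  exact hu.tendsto_S_apply (dualMultiplier (fun ξ => Real.exp (-t * ‖ξ‖ ^ 2)) χ)

theorem S_sub_neg_eq_sum (L : LittlewoodPaley d) (N n : ℕ) (v : 𝓢'(Rd d, ℂ)) :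
    L.S (-N) v = L.S (-((n + N : ℕ) : ℤ)) v +
      ∑ i ∈ Finset.range n, L.block (-1 - ((i + N : ℕ) : ℤ)) v := by
  induction n with
  | zero => simp
  | succ n ih =>
    rw [Finset.sum_range_succ, ih]
    have h := L.S_succ (-1 - ((n + N : ℕ) : ℤ)) v
    rw [show -1 - ((n + N : ℕ) : ℤ) + 1 = -((n + N : ℕ) : ℤ) by ring] at h
    rw [h, show -((n + 1 + N : ℕ) : ℤ) = -1 - ((n + N : ℕ) : ℤ) by push_cast; ring]
    abel

theorem S_nat_eq_sum (L : LittlewoodPaley d) (n : ℕ) (v : 𝓢'(Rd d, ℂ)) :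
    L.S n v = L.S 0 v + ∑ i ∈ Finset.range n, L.block i v := by
  induction n with
  | zero => simp
  | succ n ih =>
    rw [Finset.sum_range_succ, ← add_assoc, ← ih, ← L.S_succ]
    push_cast
    rfl

/-! ### Construction of the solution -/

section Solution

variable {L : LittlewoodPaley d} {s : ℝ} {B : SeriesOp q (LpR d p) (LpR d ⊤)}

/-- Telescoping towards frequency zero expresses `S_{-N}` by the blocks of index at most `-1-N`. As
the `n`-th operator belongs to the block `-1-n`, this is exactly the tail from `N` on; the remainder
tends to zero by the low-frequency condition. -/
theorem S_neg_heat_apply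
    (hB : ∀ (n : ℕ) (t : ℝ) (f : Besov L s p q), 0 ≤ t →
      ofLp ⊤ (B.A n t (f.coeff (B.e n))) = L.block (-1 - n) (heat t f.toDist))
    (N : ℕ) {t : ℝ} (ht : 0 ≤ t) (f : Besov L s p q) (χ : 𝓢(Rd d, ℂ)) :
    L.S (-N) (heat t f.toDist) χ = pairLp ⊤ χ (B.tail N t f.coeff) := by
  have h1 := ((pairLp ⊤ χ).continuous.tendsto _).comp (B.hasSum_tail ht N f.coeff).tendsto_sum_nat
  have h2 : Tendsto (fun n : ℕ => L.S (-((n + N : ℕ) : ℤ)) (heat t f.toDist) χ) atTop (𝓝 0) :=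
    (tendsto_S_neg_heat f.toDist_mem ht χ).comp (tendsto_add_atTop_nat N)
  have h3 := h2.add h1
  rw [zero_add] at h3
  refine tendsto_nhds_unique (tendsto_const_nhds.congr fun n => ?_) h3
  have e := congrArg (PointwiseConvergenceCLM.evalCLM (RingHom.id ℂ) ℂ χ)
    (S_sub_neg_eq_sum L N n (heat t f.toDist))
  rw [map_add, map_sum] at e
  refine e.trans ?_
  simp only [Function.comp_def, map_sum]
  congr 1
  refine Finset.sum_congr rfl fun i _ => ?_
  rw [pairLp_apply, hB _ _ _ ht]
  rfl

theorem heat_apply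
    (hB : ∀ (n : ℕ) (t : ℝ) (f : Besov L s p q), 0 ≤ t →
      ofLp ⊤ (B.A n t (f.coeff (B.e n))) = L.block (-1 - n) (heat t f.toDist))
    {N : ℕ} {B' : SeriesOp q (LpR d p) (LpR d p)}
    (hB' : ∀ (n : ℕ) (t : ℝ) (f : Besov L s p q), 0 ≤ t →
        multiplier (fun ξ => (‖ξ‖ ^ 2) ^ N) (ofLp p (B'.A n t (f.coeff (B'.e n)))) =
          L.block n (heat t f.toDist))
    {t : ℝ} (ht : 0 ≤ t) (f : Besov L s p q) (χ : 𝓢(Rd d, ℂ)) :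
    heat t f.toDist χ = pairLp ⊤ χ (B.tail 0 t f.coeff) +
      pairLp p (dualMultiplier (fun ξ => (‖ξ‖ ^ 2) ^ N) χ) (B'.tail 0 t f.coeff) := by
  set χ' := dualMultiplier (fun ξ : Rd d => (‖ξ‖ ^ 2) ^ N) χ with hχ'
  have h1 := ((pairLp p χ').continuous.tendsto _).comp (B'.hasSum_tail ht 0 f.coeff).tendsto_sum_nat
  have h2 := (tendsto_const_nhds (x := L.S 0 (heat t f.toDist) χ) (f := atTop (α := ℕ))).add h1
  have h0 := S_neg_heat_apply hB 0 ht f χ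
  simp only [CharP.cast_eq_zero, neg_zero] at h0
  rw [← h0]
  refine tendsto_nhds_unique (L.tendsto_S_apply (heat t f.toDist) χ) (h2.congr fun n => ?_)
  have e := congrArg (PointwiseConvergenceCLM.evalCLM (RingHom.id ℂ) ℂ χ)
    (S_nat_eq_sum L n (heat t f.toDist))
  rw [map_add, map_sum] at e
  refine Eq.trans ?_ e.symm
  simp only [Function.comp_def, map_sum]
  congr 1
  refine Finset.sum_congr rfl fun i _ => ?_
  rw [pairLp_apply, hχ', ← multiplier_apply_apply, add_zero, hB' _ _ _ ht]
  rfl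

end Solution

theorem exists_solution (L : LittlewoodPaley d) {s : ℝ}
    (hs : s < d * (p⁻¹).toReal ∨ (s = d * (p⁻¹).toReal ∧ q = 1)) {r : ℝ≥0∞} (hr : 1 ≤ r)
    {T : ℝ≥0∞} {f : ℝ → Besov L s p q} (hf : MemLp f r (volume.restrict (timeInterval T))) :
    ∃ w : ℝ → 𝓢'(Rd d, ℂ), IsHeatSolution T (fun t => (f t).toDist) w ∧
      ∀ t ∈ timeInterval T, LowFreqVanish L (w t) := by
  obtain ⟨B, hB⟩ := exists_lowSeries (q := q) L hs
  obtain ⟨N, B', hB'⟩ := exists_highSeries (p := p) (q := q) L s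
  have hc : ∀ t ∈ timeInterval T, IntegrableOn (fun τ => (f τ).coeff) (Set.Ioc 0 t) := fun t ht =>
    integrableOn_of_memLp_timeInterval hr (memLp_coeff hf) ht
  -- The two series take values in the Banach spaces `L^∞` and `L^p`, so they can be integrated in
  -- the sense of Bochner before passing to distributions.
  let w : ℝ → 𝓢'(Rd d, ℂ) := fun t =>
    ofLp ⊤ (∫ τ in Set.Ioc 0 t, B.tail 0 (t - τ) (f τ).coeff) +
      multiplier (fun ξ => (‖ξ‖ ^ 2) ^ N)
        (ofLp p (∫ τ in Set.Ioc 0 t, B'.tail 0 (t - τ) (f τ).coeff))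
  have hw : IsHeatSolution T (fun t => (f t).toDist) w := by
    intro t ht χ
    have i1 := B.integrableOn_tail 0 (hc t ht)
    have i2 := B'.integrableOn_tail 0 (hc t ht)
    set χ' := dualMultiplier (fun ξ : Rd d => (‖ξ‖ ^ 2) ^ N) χ with hχ'
    have j1 := (pairLp ⊤ χ).integrable_comp i1
    have j2 := (pairLp p χ').integrable_comp i2
    have heq : Set.EqOn (fun τ => pairLp ⊤ χ (B.tail 0 (t - τ) (f τ).coeff) +
        pairLp p χ' (B'.tail 0 (t - τ) (f τ).coeff))
        (fun τ => heat (t - τ) (f τ).toDist χ) (Set.Ioc 0 t) := fun τ hτ =>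
      (heat_apply hB hB' (sub_nonneg.2 hτ.2) (f τ) χ).symm
    refine ⟨?_, ?_⟩
    · rw [intervalIntegrable_iff_integrableOn_Ioc_of_le ht.1]
      exact IntegrableOn.congr_fun (j1.add j2) heq measurableSet_Ioc
    · rw [intervalIntegral.integral_of_le ht.1, ← setIntegral_congr_fun measurableSet_Ioc heq,
        integral_add j1 j2, (pairLp ⊤ χ).integral_comp_comm i1, (pairLp p χ').integral_comp_comm i2]
      rfl
  refine ⟨w, hw, fun t ht => ⟨fun k =>
    ∫ τ in Set.Ioc 0 t, B.tail (-k).toNat (t - τ) (f τ).coeff, ?_, ?_⟩⟩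
  -- Only `k ≤ 0` matters, where `S_k` corresponds to the tail from `-k` on; for positive `k` the
  -- truncated index would be `0`.
  · filter_upwards [eventually_le_atBot (0 : ℤ)] with k hk
    ext χ
    have i1 := B.integrableOn_tail (-k).toNat (hc t ht)
    rw [← pairLp_apply, ← (pairLp ⊤ χ).integral_comp_comm i1]
    have h2 := (hw t ht (dualMultiplier (fun ξ => L.ψ ((2 : ℝ) ^ (-k) • ξ)) χ)).2
    rw [intervalIntegral.integral_of_le ht.1] at h2
    refine Eq.trans ?_ h2.symm
    refine setIntegral_congr_fun measurableSet_Ioc fun τ hτ => ?_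
    have h3 := S_neg_heat_apply hB (-k).toNat (sub_nonneg.2 hτ.2) (f τ) χ
    rw [Int.toNat_of_nonneg (by omega), neg_neg] at h3
    exact h3.symm
  · have h1 := (B.tendsto_integral_tail (hc t ht)).norm
    rw [norm_zero] at h1
    refine h1.comp (tendsto_atTop.2 fun n => ?_)
    filter_upwards [eventually_le_atBot (-(n : ℤ))] with k hk
    omega

end HeatBesov
end

/-! ### The proposition -/

theorem proposition3p1 (d : ℕ) (hd : 1 ≤ d) (L : HeatBesov.LittlewoodPaley d)
    (σ r m : ℝ) (hr : 1 < r) (hrm : r ≤ m)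
    (p q : ℝ≥0∞) [Fact (1 ≤ p)] [Fact (1 ≤ q)] (hqm : q ≤ ENNReal.ofReal m) :
    ∃ C : ℝ≥0, ∀ T : ℝ≥0∞, 0 < T →
      ∀ f : ℝ → HeatBesov.Besov L (σ + 2 / r) p q,
        MemLp f (ENNReal.ofReal r) (volume.restrict (HeatBesov.timeInterval T)) →
        -- existence of the solution, when the source takes values in a Banach space
        ((σ + 2 / r < d * (p⁻¹).toReal ∨ (σ + 2 / r = d * (p⁻¹).toReal ∧ q = 1)) →
          ∃ w : ℝ → 𝓢'(EuclideanSpace ℝ (Fin d), ℂ),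
            HeatBesov.IsHeatSolution T (fun t => (f t).toDist) w ∧
            ∀ t ∈ HeatBesov.timeInterval T, HeatBesov.LowFreqVanish L (w t)) ∧
        -- the maximal estimate, for every `σ`
        (∀ w : ℝ → 𝓢'(EuclideanSpace ℝ (Fin d), ℂ),
          HeatBesov.IsHeatSolution T (fun t => (f t).toDist) w →
          (∀ᵐ t ∂(volume.restrict (HeatBesov.timeInterval T)),
            HeatBesov.LowFreqVanish L (w t)) →
          ∃ W : ℝ → HeatBesov.Besov L (σ + 2 + 2 / m) p q,
            (∀ᵐ t ∂(volume.restrict (HeatBesov.timeInterval T)), (W t).toDist = w t) ∧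
            MemLp W (ENNReal.ofReal m) (volume.restrict (HeatBesov.timeInterval T)) ∧
            eLpNorm W (ENNReal.ofReal m) (volume.restrict (HeatBesov.timeInterval T)) ≤
              C * eLpNorm f (ENNReal.ofReal r)
                (volume.restrict (HeatBesov.timeInterval T))) := by
  have hq0 : (1 : ℝ≥0∞) ≤ ENNReal.ofReal r := by simpa using hr.le
  obtain ⟨C, hC⟩ := HeatBesov.exists_maximal_estimate (p := p) (q := q) L (σ := σ) hr hrm hqm
  exact ⟨C, fun T _ f hf => ⟨fun hs => HeatBesov.exists_solution L hs hq0 hf, hC T f hf⟩⟩
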